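/- **Setting.** Let $\mathcal F$ be the one-mode Fock space with Fock basis $(|n\rangle)_{n\ge 0}$, let $a|n\rangle=\sqrt n\,|n-1\rangle$ and $a^\dagger|n\rangle=\sqrt{n+1}\,|n+1\rangle$ be the annihilation and creation operators, and $N=a^\dagger a$. Let $\mathcal T_{1,\mathrm{sa}}$ be the real Banach space of self-adjoint trace class operators on $\mathcal F$ with the trace norm $\|x\|_1=\mathrm{tr}|x|$, and let $\mathcal T_f\subset\mathcal T_{1,\mathrm{sa}}$ be the self-adjoint operators with finitely many nonzero matrix entries in the Fock basis. For $k\ge 0$, $W^{k,1}$ is the space of all $x=(\mathbb 1+N)^{-k/4}\,y\,(\mathbb 1+N)^{-k/4}$ with $y\in\mathcal T_{1,\mathrm{sa}}$, with norm $\|x\|_{W^{k,1}}=\|y\|_1$. A state is a positive operator of trace one. For $l\ge 2$ and $\alpha\in\mathbb C$ put $L=a^l-\alpha^l$ and, on $\mathcal T_f$, $\mathcal L_l(x)=LxL^\dagger-\tfrac12\{L^\dagger L,x\}$ (the $l$-photon dissipation); for an operator $H$ put $\mathcal H[H](x)=-i[H,x]$. For a generator $\mathcal L$ given on $\mathcal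 T_f$, $(e^{t\mathcal L})_{t\ge0}$ denotes the $C_0$-semigroup on $\mathcal T_{1,\mathrm{sa}}$ whose generator is the closure of $(\mathcal L,\mathcal T_f)$. **Theorem.** Let $l\ge 2$. There are constants $C,K>0$ depending only on $l$ such that the following holds for every $\alpha\in\mathbb C$ and every polynomial $p_H$ over $\mathbb C$ in two noncommuting variables, of degree $d_H\le 2(l-1)$, with largest coefficient modulus $\Lambda$, such that $H=p_H(a,a^\dagger)$ is symmetric. With $$c=C\,\Lambda\,(1+|\alpha|^{2l}),\qquad \gamma_\varepsilon=K\,(1+|\alpha|^l+\varepsilon\Lambda)^{2l+d_H+1},$$ for every $\varepsilon\ge 0$ the semigroups $e^{t\mathcal L_l}$ and $e^{t(\mathcal L_l+\varepsilon\mathcal H[H])}$ exist, and for all $t\ge 0$ and all states $\rho\in W^{2(l+d_H+2),1}$ the operator $L\big(e^{t\mathcal L_l}(\rho)-e^{t(\mathcal L_l+\varepsilon\mathcal H[H])}(\rho)\big)L^\dagger$ is trace class and $$\Big|\mathrm{tr}\Big[L\big(e^{t\mathcal L_l}(\rho)-e^{t(\mathcal L_l+\varepsilon\mathcal H[H])}(\rho)\big)L^\dagger\Big]\Big|\le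 \varepsilon\,c\,\big(1-e^{-l!\,t}\big)\max\big\{\gamma_\varepsilon,\ \|\rho\|_{W^{2(l+d_H+2),1}}\big\}.$$ -/

import Mathlib

open scoped InnerProductSpace ENNReal NNReal Topology
open Filter

noncomputable section

namespace Boson

/-! ### Fock space and polynomials in the annihilation and creation operators -/

/-! Throughout, `F` is the one-mode Fock space: a complex Hilbert space (for instance `L²(ℝ)` or
`ℓ²(ℕ)`) with a distinguished Hilbert basis `b`, the Fock basis; `b n` is the vector `|n⟩`. -/

variable {F : Type*} [NormedAddCommGroup F] [InnerProductSpace ℂ F]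

/-- The space `𝓗_f` of vectors with finite support in the Fock basis. -/
abbrev FinVec : Type := ℕ →₀ ℂ

/-- The inclusion of `𝓗_f` in Fock space. -/
def toFock (b : HilbertBasis ℕ ℂ F) : FinVec →ₗ[ℂ] F :=
  Finsupp.linearCombination ℂ fun n => b n

/-- The algebra of linear maps `𝓗_f → 𝓗_f`. -/
abbrev FOp : Type := Module.End ℂ FinVec

/-- The annihilation operator: `a |n⟩ = √n |n - 1⟩`, `a |0⟩ = 0`. -/
def annihilation : FOp :=
  Finsupp.linearCombination ℂ fun n : ℕ => Finsupp.single (n - 1) ((Real.sqrt n : ℝ) : ℂ)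

/-- The creation operator: `a† |n⟩ = √(n + 1) |n + 1⟩`. -/
def creation : FOp :=
  Finsupp.linearCombination ℂ fun n : ℕ => Finsupp.single (n + 1) ((Real.sqrt (n + 1) : ℝ) : ℂ)

/-- Polynomials over `ℂ` in two noncommuting variables `X` (index `0`) and `Y` (index `1`). -/
abbrev NCPoly : Type := FreeAlgebra ℂ (Fin 2)

/-- The operator `p(a, a†)` on `𝓗_f`. -/
def ladder (p : NCPoly) : FOp :=
  FreeAlgebra.lift ℂ ![annihilation, creation] p

/-- The coefficient of the word `w` in the noncommutative polynomial `p`. -/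
def wordCoeff (p : NCPoly) : FreeMonoid (Fin 2) →₀ ℂ :=
  (FreeAlgebra.equivMonoidAlgebraFreeMonoid p).coeff

/-- The degree: the largest length of a word with nonzero coefficient (`0` if `p = 0`). -/
def ncDegree (p : NCPoly) : ℕ :=
  (wordCoeff p).support.sup FreeMonoid.length

/-- The largest modulus of a coefficient (`0` if `p = 0`). -/
def maxCoeff (p : NCPoly) : ℝ≥0 :=
  (wordCoeff p).support.sup fun w => ‖wordCoeff p w‖₊

/-- Symmetry of an operator given on `𝓗_f`
(a core for every polynomial in `a`, `a†` of degree `d` on the domain of `N ^ (d / 2)`). -/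
def IsSymm (b : HilbertBasis ℕ ℂ F) (A : FOp) : Prop :=
  ∀ u v : FinVec, ⟪toFock b (A u), toFock b v⟫_ℂ = ⟪toFock b u, toFock b (A v)⟫_ℂ

variable [CompleteSpace F]

/-! ### Trace class operators, states, Sobolev spaces -/

/-- The trace norm `‖A‖₁ = tr |A|` with `|A| = √(A† A)`, as an extended nonnegative real. -/
def traceNorm (b : HilbertBasis ℕ ℂ F) (A : F →L[ℂ] F) : ℝ≥0∞ :=
  ∑' n : ℕ, ENNReal.ofReal (RCLike.re ⟪b n, CFC.abs A (b n)⟫_ℂ)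

/-- `A` belongs to the space of self-adjoint trace class operators. -/
def IsTraceSA (b : HilbertBasis ℕ ℂ F) (A : F →L[ℂ] F) : Prop :=
  IsSelfAdjoint A ∧ traceNorm b A < ∞

/-- The trace of a trace class operator. -/
def trace (b : HilbertBasis ℕ ℂ F) (A : F →L[ℂ] F) : ℂ :=
  ∑' n : ℕ, ⟪b n, A (b n)⟫_ℂ

/-- Density operators: positive operators of trace one. -/
def IsState (b : HilbertBasis ℕ ℂ F) (ρ : F →L[ℂ] F) : Prop :=
  ρ.IsPositive ∧ HasSum (fun n : ℕ => ⟪b n, ρ (b n)⟫_ℂ) 1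

/-- `y = (1 + N) ^ (k / 4) x (1 + N) ^ (k / 4)`, that is
`x = (1 + N) ^ (-k / 4) y (1 + N) ^ (-k / 4)`, written in the Fock basis. -/
def IsWeighted (b : HilbertBasis ℕ ℂ F) (k : ℝ) (x y : F →L[ℂ] F) : Prop :=
  ∀ m n : ℕ, ⟪b m, y (b n)⟫_ℂ =
    ((((m : ℝ) + 1) ^ (k / 4) * ((n : ℝ) + 1) ^ (k / 4) : ℝ) : ℂ) * ⟪b m, x (b n)⟫_ℂ

/-- `x` belongs to the bosonic Sobolev space `W^{k,1}`. -/
def MemSobolev (b : HilbertBasis ℕ ℂ F) (k : ℝ) (x : F →L[ℂ] F) : Prop :=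
  IsTraceSA b x ∧ ∃ y : F →L[ℂ] F, IsTraceSA b y ∧ IsWeighted b k x y

/-- The norm `‖x‖_{W^{k,1}} = ‖(1 + N) ^ (k / 4) x (1 + N) ^ (k / 4)‖₁`
(`∞` if there is no such bounded operator, which otherwise is unique). -/
def sobolevNorm (b : HilbertBasis ℕ ℂ F) (k : ℝ) (x : F →L[ℂ] F) : ℝ≥0∞ :=
  ⨅ (y : F →L[ℂ] F) (_ : IsWeighted b k x y), traceNorm b y

/-! ### GKSL generators on finitely supported operators, and the semigroups they generate -/

/-- The elements of `𝓣_f`: self-adjoint operators with finitely many nonzero matrix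
coefficients in the Fock basis. -/
def IsFinSupp (b : HilbertBasis ℕ ℂ F) (x : F →L[ℂ] F) : Prop :=
  IsSelfAdjoint x ∧ ∃ M : ℕ, ∀ m n : ℕ, M < m ∨ M < n → ⟪b m, x (b n)⟫_ℂ = 0

/-- The bounded operator `x` maps `𝓗_f` to itself and acts there as `u`. -/
def RestrictsTo (b : HilbertBasis ℕ ℂ F) (x : F →L[ℂ] F) (u : FOp) : Prop :=
  ∀ v : FinVec, x (toFock b v) = toFock b (u v)

/-- The graph of the operator on `𝓣_f` given by the formula `𝓛`. -/
def CoreGraph (b : HilbertBasis ℕ ℂ F) (𝓛 : FOp → FOp) (x y : F →L[ℂ] F) : Prop :=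
  IsFinSupp b x ∧ ∃ u : FOp, RestrictsTo b x u ∧ RestrictsTo b y (𝓛 u)

/-- The dissipator `L x L† - ½ {L† L, x}`; the second argument is the formal adjoint `L†`. -/
def dissipator (L Ld : FOp) (x : FOp) : FOp :=
  L * x * Ld - (1 / 2 : ℂ) • (Ld * L * x + x * (Ld * L))

/-- The Hamiltonian part `-i [H, x]`. -/
def hamiltonian (H : FOp) (x : FOp) : FOp :=
  (-Complex.I) • (H * x - x * H)

/-- The jump operator `L = a^l - α^l` of the `l`-photon dissipation. -/
def jump (l : ℕ) (α : ℂ) : FOp :=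
  annihilation ^ l - (α ^ l) • (1 : FOp)

/-- Its formal adjoint `L† = (a†)^l - (conj α)^l`. -/
def jumpAdj (l : ℕ) (α : ℂ) : FOp :=
  creation ^ l - ((starRingEnd ℂ α) ^ l) • (1 : FOp)

/-- The `l`-photon dissipation `𝓛_l`. -/
def photon (l : ℕ) (α : ℂ) : FOp → FOp :=
  dissipator (jump l α) (jumpAdj l α)

/-- The perturbed generator `𝓛_l + ε 𝓗[H]`. -/
def perturbedPhoton (l : ℕ) (α : ℂ) (ε : ℝ) (H : FOp) : FOp → FOp :=
  fun x => photon l α x + (ε : ℂ) • hamiltonian H x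

/-- `P` is a strongly continuous one-parameter semigroup of bounded real-linear maps on the
Banach space of self-adjoint trace class operators with the trace norm
(the values of `P t` on other operators are irrelevant). -/
structure IsC0Semigroup (b : HilbertBasis ℕ ℂ F)
    (P : ℝ≥0 → (F →L[ℂ] F) → (F →L[ℂ] F)) : Prop where
  maps_to : ∀ t x, IsTraceSA b x → IsTraceSA b (P t x)
  map_add : ∀ t x y, IsTraceSA b x → IsTraceSA b y → P t (x + y) = P t x + P t y
  map_smul : ∀ t (r : ℝ) x, IsTraceSA b x → P t ((r : ℂ) • x) = (r : ℂ) • P t x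
  bounded : ∀ t, ∃ C : ℝ≥0, ∀ x, IsTraceSA b x → traceNorm b (P t x) ≤ C * traceNorm b x
  zero : ∀ x, IsTraceSA b x → P 0 x = x
  add : ∀ s t x, IsTraceSA b x → P (s + t) x = P s (P t x)
  continuous : ∀ x, IsTraceSA b x → Tendsto (fun t => traceNorm b (P t x - x)) (𝓝 0) (𝓝 0)

/-- The graph of the generator of `P`: `y = lim_{t → 0+} t⁻¹ (P_t x - x)` in trace norm. -/
def GeneratorGraph (b : HilbertBasis ℕ ℂ F) (P : ℝ≥0 → (F →L[ℂ] F) → (F →L[ℂ] F))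
    (x y : F →L[ℂ] F) : Prop :=
  IsTraceSA b x ∧ IsTraceSA b y ∧
    Tendsto (fun t : ℝ≥0 => traceNorm b ((((t : ℝ) : ℂ)⁻¹) • (P t x - x) - y)) (𝓝[>] 0) (𝓝 0)

/-- The closure of the graph of `𝓛` on `𝓣_f`, in the product of two copies of the space of
self-adjoint trace class operators. -/
def ClosureGraph (b : HilbertBasis ℕ ℂ F) (𝓛 : FOp → FOp) (x y : F →L[ℂ] F) : Prop :=
  IsTraceSA b x ∧ IsTraceSA b y ∧ ∀ δ : ℝ≥0∞, 0 < δ →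
    ∃ x' y' : F →L[ℂ] F, CoreGraph b 𝓛 x' y' ∧
      traceNorm b (x - x') < δ ∧ traceNorm b (y - y') < δ

/-- `P` is the semigroup `(e^{t 𝓛})_{t ≥ 0}`: a `C₀`-semigroup on the self-adjoint trace class
operators whose generator is the closure of `𝓛` on `𝓣_f`. -/
def IsSemigroupOf (b : HilbertBasis ℕ ℂ F) (𝓛 : FOp → FOp)
    (P : ℝ≥0 → (F →L[ℂ] F) → (F →L[ℂ] F)) : Prop :=
  IsC0Semigroup b P ∧ ∀ x y : F →L[ℂ] F, GeneratorGraph b P x y ↔ ClosureGraph b 𝓛 x y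

/-- The bounded operator `B` equals `L x L†` for `L = a^l - α^l`: for all finite vectors `v`, `w`,
`⟨v, B w⟩ = ⟨L† v, x L† w⟩`. As `L` is the adjoint of the restriction of `L†` to `𝓗_f`, this says
that `x L† w` is in the domain of `L` and `B w = L x L† w`. -/
def IsJumpConj (b : HilbertBasis ℕ ℂ F) (l : ℕ) (α : ℂ) (x B : F →L[ℂ] F) : Prop :=
  ∀ v w : FinVec, ⟪toFock b v, B (toFock b w)⟫_ℂ =
    ⟪toFock b (jumpAdj l α v), x (toFock b (jumpAdj l α w))⟫_ℂ

end Boson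

end

open scoped InnerProductSpace ENNReal NNReal Topology
open Filter

noncomputable section


namespace Boson

/-! ### The trace norm: triangle inequality and comparison with the operator norm -/

section TraceNorm

variable {F : Type*} [NormedAddCommGroup F] [InnerProductSpace ℂ F] (b : HilbertBasis ℕ ℂ F)

/-! Put l = r + 1 and β = α^l. Expanding the square shows that the dissipator of a^l - β is the
dissipator of a^l plus the commutator with the drive (i/2)(β a†^l - conj β a^l) (`gksl_identity`,
`gen_drive`). Both generators are therefore an a^l dissipation together with a Hermitian band matrix
whose entries are O(n^(l-1)): for the drive because l/2 ≤ l - 1, for H because d_H ≤ 2(l - 1). The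
estimate then rests on three facts.

Moments. On the weight (1+N)^(m+1) the dissipation acts with a negative term of order n^(m+l), and
the Hamiltonian with a term of order at most n^(m+l-1). So the derivative of the moment is at most
minus the moment plus a constant (`moment_weight_le`), and the moment stays bounded for all times
(`moment_flow_le`). With m = l + d_H + 1 this constant carries the power 2l + d_H + 1 of γ.

Decay. Under the unperturbed flow the derivative of tr(L x L†) is governed by the commutator of a^l
and a†^l, which is at least l! because consecutive binomial coefficients differ by at least one.
Hence tr(L x L†) decays like e^(-l! t) on positive x (`jump_form`, `jump_form_le`,
`tr_jump_flow_le`).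

Duhamel. The difference of the two evolutions is the integral over s of the unperturbed flow for
time t - s applied to ε 𝓗[H] σ, with σ the perturbed state at time s. The commutator is not
positive, but it lies between -z and z for z = B⁻¹ H σ H + B σ (`dominating_between`). The flow and
tr(L · L†) are positive, so the integrand is at most ε e^(-l!(t-s)) tr(L z L†), and tr(L z L†) is
bounded by a moment of σ. Integration produces 1 - e^(-l! t).

Unboundedness is handled by cutting all matrices to indices below M. The cut generators are bounded
Lindblad operators on the Banach space of self-adjoint trace class operators, and their exponentials
are positive, trace preserving contractions. Two cuts differ only through drift entries crossing the
index M, which cost M^(-1/2) times a moment; so the flows converge to a C₀-semigroup whose generator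
is the closure from 𝓣_f (`approximates_gen`, `Approximates.isGenerator_iff`). Any semigroup with
that generator is this limit (`IsSemigroup.eq_of_isGenerator`). A further moment makes the
conjugated operators converge in trace norm (`exists_tendsto_jump`), and the inequality for cut
flows, which has an error O(1/M), passes to the limit. -/

theorem hasSum_norm_inner_sq (v : F) : HasSum (fun m => ‖⟪b m, v⟫_ℂ‖ ^ 2) (‖v‖ ^ 2) := by
  have h := b.hasSum_inner_mul_inner v v
  have h2 := Complex.hasSum_re h
  convert! h2 using 1
  · ext m
    rw [← inner_conj_symm v (b m), ← Complex.normSq_eq_conj_mul_self, Complex.ofReal_re,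
      Complex.normSq_eq_norm_sq]
  · rw [inner_self_eq_norm_sq_to_K]
    norm_cast

theorem enorm_sq_eq_tsum (v : F) : ‖v‖ₑ ^ 2 = ∑' m, ‖⟪b m, v⟫_ℂ‖ₑ ^ 2 := by
  have h := hasSum_norm_inner_sq b v
  have e : ∀ {G : Type _} [NormedAddCommGroup G] (w : G), ‖w‖ₑ ^ 2 = ENNReal.ofReal (‖w‖ ^ 2) := by
    intro _ _ w
    rw [ENNReal.ofReal_pow (norm_nonneg _), ofReal_norm]
  have e2 : ∀ w : ℂ, ‖w‖ₑ ^ 2 = ENNReal.ofReal (‖w‖ ^ 2) := fun w => by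
    rw [ENNReal.ofReal_pow (norm_nonneg _), ofReal_norm]
  rw [e, ← h.tsum_eq, ENNReal.ofReal_tsum_of_nonneg (fun _ => by positivity) h.summable]
  simp only [e2]

instance operatorAlgebraReal : Algebra ℝ (F →L[ℂ] F) := inferInstance

/-- The square of the Hilbert–Schmidt norm. -/
def hsSq (A : F →L[ℂ] F) : ℝ≥0∞ := ∑' n, ‖A (b n)‖ₑ ^ 2

/-- The sum of the diagonal matrix coefficients of a positive operator. -/
def posTr (A : F →L[ℂ] F) : ℝ≥0∞ := ∑' n, ENNReal.ofReal (RCLike.re ⟪b n, A (b n)⟫_ℂ)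

theorem hsSq_mul_le (A B : F →L[ℂ] F) : hsSq b (A * B) ≤ ‖A‖ₑ ^ 2 * hsSq b B := by
  unfold hsSq
  rw [← ENNReal.tsum_mul_left]
  refine ENNReal.tsum_le_tsum fun _ => ?_
  rw [← mul_pow]
  gcongr
  exact A.le_opENorm _

theorem re_inner_nonneg {x : F →L[ℂ] F} (hx : 0 ≤ x) (v : F) : 0 ≤ RCLike.re ⟪v, x v⟫_ℂ :=
  ((ContinuousLinearMap.nonneg_iff_isPositive x).1 hx).re_inner_nonneg_right v

theorem posTr_smul {r : ℝ} (hr : 0 ≤ r) (x : F →L[ℂ] F) :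
    posTr b ((r : ℂ) • x) = ENNReal.ofReal r * posTr b x := by
  unfold posTr
  rw [← ENNReal.tsum_mul_left]
  refine tsum_congr fun n => ?_
  rw [smul_apply, inner_smul_right, ← ENNReal.ofReal_mul hr]
  congr 1
  exact RCLike.re_ofReal_mul r _

theorem re_inner_algebraMap (ε : ℝ) (v : F) :
    RCLike.re ⟪v, (algebraMap ℝ (F →L[ℂ] F) ε) v⟫_ℂ = ε * ‖v‖ ^ 2 := by
  have e4 : (algebraMap ℝ (F →L[ℂ] F) ε) v = (ε : ℂ) • v := rfl
  rw [e4, inner_smul_right, inner_self_eq_norm_sq_to_K]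
  change RCLike.re ((ε : ℂ) * ((‖v‖ : ℝ) : ℂ) ^ 2) = _
  rw [← Complex.ofReal_pow, ← Complex.ofReal_mul]
  rfl

variable [CompleteSpace F]

instance operatorPosPart : PosPart (F →L[ℂ] F) := inferInstance

instance operatorNegPart : NegPart (F →L[ℂ] F) := inferInstance

theorem hsSq_adjoint (A : F →L[ℂ] F) : hsSq b (star A) = hsSq b A := by
  unfold hsSq
  simp only [enorm_sq_eq_tsum b]
  rw [ENNReal.tsum_comm]
  refine tsum_congr fun m => tsum_congr fun n => ?_
  rw [ContinuousLinearMap.star_eq_adjoint, ContinuousLinearMap.adjoint_inner_right,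
    ← inner_conj_symm, RCLike.enorm_conj]

theorem re_inner_star_mul (A : F →L[ℂ] F) (v : F) :
    RCLike.re ⟪v, (star A * A) v⟫_ℂ = ‖A v‖ ^ 2 := by
  rw [mul_apply_eq_comp, ContinuousLinearMap.star_eq_adjoint,
    ContinuousLinearMap.adjoint_inner_right, inner_self_eq_norm_sq]

theorem posTr_star_mul (A : F →L[ℂ] F) : posTr b (star A * A) = hsSq b A := by
  unfold posTr hsSq
  refine tsum_congr fun n => ?_
  rw [re_inner_star_mul, ENNReal.ofReal_pow (norm_nonneg _), ofReal_norm]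

theorem sqrt_spec {x : F →L[ℂ] F} (hx : 0 ≤ x) :
    star (CFC.sqrt x) = CFC.sqrt x ∧ CFC.sqrt x * CFC.sqrt x = x :=
  ⟨(IsSelfAdjoint.of_nonneg (CFC.sqrt_nonneg x)).star_eq, CFC.sqrt_mul_sqrt_self x hx⟩

theorem posTr_eq_hsSq {x : F →L[ℂ] F} (hx : 0 ≤ x) : posTr b x = hsSq b (CFC.sqrt x) := by
  obtain ⟨h1, h2⟩ := sqrt_spec hx
  rw [← posTr_star_mul, h1, h2]

/-- A x A† is the product of A√x with its adjoint, and the Hilbert–Schmidt norm does not see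
adjoints. This replaces cyclicity of the trace throughout. -/
theorem posTr_conj {x : F →L[ℂ] F} (hx : 0 ≤ x) (A : F →L[ℂ] F) :
    posTr b (A * x * star A) = hsSq b (A * CFC.sqrt x) := by
  obtain ⟨h1, h2⟩ := sqrt_spec hx
  rw [← hsSq_adjoint b (A * _), star_mul, h1, ← posTr_star_mul, star_mul, star_star, h1]
  nth_rw 1 [← h2]
  simp only [mul_assoc]

theorem posTr_add {x y : F →L[ℂ] F} (hx : 0 ≤ x) (hy : 0 ≤ y) :
    posTr b (x + y) = posTr b x + posTr b y := by
  unfold posTr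
  rw [← ENNReal.tsum_add]
  refine tsum_congr fun n => ?_
  rw [add_apply, inner_add_right, map_add,
    ENNReal.ofReal_add (re_inner_nonneg hx _) (re_inner_nonneg hy _)]

/-- The operator h stands in for the spectral projection onto the positive part of x, which the
continuous functional calculus does not provide. -/
theorem exists_contraction_posPart_le {x : F →L[ℂ] F} (hx : IsSelfAdjoint x) {ε : ℝ}
    (hε : 0 < ε) : ∃ h : F →L[ℂ] F, star h = h ∧ ‖h‖ ≤ 1 ∧
      ∀ v, RCLike.re ⟪v, x⁺ v⟫_ℂ ≤ RCLike.re ⟪v, (h * x * h) v⟫_ℂ + ε * ‖v‖ ^ 2 := by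
  -- For t ≥ 0 one has f(t)² t = t²/(t + ε) ≥ t - ε, and f vanishes for t ≤ 0.
  set f : ℝ → ℝ := fun t => √(max t 0 / (max t 0 + ε)) with hf
  have hpos : ∀ t : ℝ, 0 < max t 0 + ε := fun t => by positivity
  have hfc : Continuous f := by
    refine Real.continuous_sqrt.comp (Continuous.div (by fun_prop) (by fun_prop) ?_)
    exact fun t => (hpos t).ne'
  have hsa : IsSelfAdjoint (cfc f x) := cfc_predicate f x
  refine ⟨cfc f x, hsa.star_eq, ?_, fun v => ?_⟩
  · refine norm_cfc_le zero_le_one fun t _ => ?_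
    rw [Real.norm_of_nonneg (Real.sqrt_nonneg _)]
    refine Real.sqrt_le_one.2 ?_
    rw [div_le_one (hpos t)]
    linarith
  · have e1 : cfc f x * x * cfc f x = cfc (fun t => f t * t * f t) x := by
      rw [cfc_mul (fun t => f t * t) f x (hfc.mul continuous_id).continuousOn hfc.continuousOn,
        cfc_mul f (fun t => t) x hfc.continuousOn continuous_id.continuousOn, cfc_id' ℝ x]
    have e2 : x⁺ = cfc (fun t : ℝ => t⁺) x := by
      rw [CFC.posPart_def, cfcₙ_eq_cfc]
    have hle : x⁺ ≤ cfc f x * x * cfc f x + algebraMap ℝ (F →L[ℂ] F) ε := by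
      rw [e1, e2, ← cfc_const ε x, ← cfc_add x (fun t => f t * t * f t) (fun _ => ε)
        ((hfc.mul continuous_id).mul hfc).continuousOn continuous_const.continuousOn]
      refine cfc_mono (fun t _ => ?_) continuous_posPart.continuousOn
        (((hfc.mul continuous_id).mul hfc).add continuous_const).continuousOn
      have hs : f t * t * f t = max t 0 / (max t 0 + ε) * t := by
        rw [mul_right_comm, hf, Real.mul_self_sqrt (by positivity)]
      rw [hs, posPart_def]
      change max t 0 ≤ _
      rcases le_total t 0 with h | h
      · simp [max_eq_right h, hε.le]
      · rw [max_eq_left h, div_mul_eq_mul_div, div_add' _ _ _ (by positivity),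
          le_div_iff₀ (by positivity)]
        nlinarith
    have := re_inner_nonneg (sub_nonneg.2 hle) v
    have e3 : RCLike.re ⟪v, (algebraMap ℝ (F →L[ℂ] F) ε) v⟫_ℂ = ε * ‖v‖ ^ 2 := by
      exact re_inner_algebraMap ε v
    rw [sub_apply, inner_sub_right, map_sub, add_apply,
      inner_add_right, map_add, e3] at this
    linarith

/-- Compressing by the approximate spectral projection u discards q, since u x u ≤ u p u, and a
contraction does not increase the trace of p. The error ε occurs once per diagonal entry, so the
limit ε → 0 is taken on finite partial sums. -/
theorem posTr_posPart_le {x p q : F →L[ℂ] F} (hp : 0 ≤ p) (hq : 0 ≤ q) (h : x = p - q) :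
    posTr b x⁺ ≤ posTr b p := by
  have hx : IsSelfAdjoint x := by
    rw [h]; exact (IsSelfAdjoint.of_nonneg hp).sub (IsSelfAdjoint.of_nonneg hq)
  refine ENNReal.tsum_le_of_sum_range_le fun k => ?_
  have key : ∀ ε : ℝ, 0 < ε →
      ∑ n ∈ Finset.range k, ENNReal.ofReal (RCLike.re ⟪b n, x⁺ (b n)⟫_ℂ) ≤
        posTr b p + k * ENNReal.ofReal ε := by
    intro ε hε
    obtain ⟨u, hu, hu1, hle⟩ := exists_contraction_posPart_le hx hε
    have h1 : ∀ v, RCLike.re ⟪v, x⁺ v⟫_ℂ ≤ RCLike.re ⟪v, (u * p * star u) v⟫_ℂ + ε * ‖v‖ ^ 2 := by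
      intro v
      refine (hle v).trans ?_
      have : RCLike.re ⟪v, (u * x * u) v⟫_ℂ =
          RCLike.re ⟪v, (u * p * star u) v⟫_ℂ - RCLike.re ⟪v, (u * q * star u) v⟫_ℂ := by
        rw [← map_sub, ← inner_sub_right, ← sub_apply, hu, h]
        simp only [mul_sub, sub_mul]
      have h3 := re_inner_nonneg (star_right_conjugate_nonneg hq u) v
      linarith
    calc ∑ n ∈ Finset.range k, ENNReal.ofReal (RCLike.re ⟪b n, x⁺ (b n)⟫_ℂ)
        ≤ ∑ n ∈ Finset.range k, (ENNReal.ofReal (RCLike.re ⟪b n, (u * p * star u) (b n)⟫_ℂ)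
            + ENNReal.ofReal ε) := by
          refine Finset.sum_le_sum fun n _ => ?_
          refine (ENNReal.ofReal_le_ofReal (h1 (b n))).trans ?_
          rw [b.orthonormal.1 n]
          simpa using ENNReal.ofReal_add_le
      _ ≤ posTr b (u * p * star u) + k * ENNReal.ofReal ε := by
          rw [Finset.sum_add_distrib]
          simp only [Finset.sum_const, Finset.card_range, nsmul_eq_mul]
          gcongr
          exact ENNReal.sum_le_tsum _
      _ ≤ posTr b p + k * ENNReal.ofReal ε := by
          gcongr
          rw [posTr_conj b hp, posTr_eq_hsSq b hp]
          refine (hsSq_mul_le b _ _).trans ?_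
          refine mul_le_of_le_one_left zero_le ?_
          refine pow_le_one₀ zero_le ?_
          rw [← ofReal_norm]
          exact ENNReal.ofReal_le_one.2 hu1
  have ht : Tendsto (fun ε : ℝ => posTr b p + k * ENNReal.ofReal ε) (𝓝[>] 0) (𝓝 (posTr b p)) := by
    have h0 : Tendsto (fun ε : ℝ => ENNReal.ofReal ε) (𝓝[>] 0) (𝓝 0) := by
      have := (ENNReal.continuous_ofReal.tendsto 0).mono_left (nhdsWithin_le_nhds (s := Set.Ioi 0))
      simpa using this
    have h1 := ENNReal.Tendsto.const_mul (a := (k : ℝ≥0∞)) h0 (Or.inr (ENNReal.natCast_ne_top k))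
    simpa using h1.const_add (posTr b p)
  exact ge_of_tendsto ht (Filter.eventually_of_mem self_mem_nhdsWithin fun ε hε => key ε hε)

theorem traceNorm_eq {x : F →L[ℂ] F} (hx : IsSelfAdjoint x) :
    traceNorm b x = posTr b x⁺ + posTr b x⁻ := by
  rw [← posTr_add b (CFC.posPart_nonneg x) (CFC.negPart_nonneg x), CFC.posPart_add_negPart x hx]
  rfl

theorem traceNorm_of_nonneg {x : F →L[ℂ] F} (hx : 0 ≤ x) : traceNorm b x = posTr b x := by
  rw [traceNorm, CFC.abs_of_nonneg x hx, posTr]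

/-- Among all decompositions into positive operators the Jordan decomposition has the least total
trace. The triangle inequality for the trace norm follows from this. -/
theorem traceNorm_sub_le {p q : F →L[ℂ] F} (hp : 0 ≤ p) (hq : 0 ≤ q) :
    traceNorm b (p - q) ≤ posTr b p + posTr b q := by
  have hx : IsSelfAdjoint (p - q) := (IsSelfAdjoint.of_nonneg hp).sub (IsSelfAdjoint.of_nonneg hq)
  rw [traceNorm_eq b hx]
  refine add_le_add (posTr_posPart_le b hp hq rfl) ?_
  rw [← CFC.posPart_neg]
  exact posTr_posPart_le b hq hp (by simp)

theorem traceNorm_add_le {x y : F →L[ℂ] F} (hx : IsSelfAdjoint x) (hy : IsSelfAdjoint y) :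
    traceNorm b (x + y) ≤ traceNorm b x + traceNorm b y := by
  have h : x + y = (x⁺ + y⁺) - (x⁻ + y⁻) := by
    conv_lhs => rw [← CFC.posPart_sub_negPart x hx, ← CFC.posPart_sub_negPart y hy]
    abel
  have h1 := CFC.posPart_nonneg x
  have h2 := CFC.posPart_nonneg y
  have h3 := CFC.negPart_nonneg x
  have h4 := CFC.negPart_nonneg y
  rw [h]
  refine (traceNorm_sub_le b (add_nonneg h1 h2) (add_nonneg h3 h4)).trans ?_
  rw [posTr_add b h1 h2, posTr_add b h3 h4, traceNorm_eq b hx, traceNorm_eq b hy]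
  exact (add_add_add_comm _ _ _ _).le

theorem traceNorm_smul (r : ℝ) (x : F →L[ℂ] F) :
    traceNorm b ((r : ℂ) • x) = ENNReal.ofReal |r| * traceNorm b x := by
  have : CFC.abs ((r : ℂ) • x) = ((|r| : ℝ) : ℂ) • CFC.abs x := by
    rw [CFC.abs_smul]
    simp
  exact (congrArg (posTr b) this).trans (posTr_smul b (abs_nonneg r) _)

theorem traceNorm_zero : traceNorm b (0 : F →L[ℂ] F) = 0 := by
  simpa using traceNorm_smul b 0 (0 : F →L[ℂ] F)

/-- The coordinates of A v are inner products of v with the vectors A† b n; apply Cauchy–Schwarz to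
each one. -/
theorem enorm_sq_le_hsSq (A : F →L[ℂ] F) : ‖A‖ₑ ^ 2 ≤ hsSq b A := by
  by_cases htop : hsSq b A = ∞
  · simp [htop]
  have h : ∀ v, ‖A v‖ₑ ^ 2 ≤ hsSq b A * ‖v‖ₑ ^ 2 := by
    intro v
    rw [← hsSq_adjoint, hsSq, ← ENNReal.tsum_mul_right, enorm_sq_eq_tsum b (A v)]
    refine ENNReal.tsum_le_tsum fun n => ?_
    rw [← mul_pow]
    gcongr
    rw [← ContinuousLinearMap.adjoint_inner_left, ContinuousLinearMap.star_eq_adjoint]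
    rw [← ofReal_norm, ← ofReal_norm, ← ofReal_norm, ← ENNReal.ofReal_mul (norm_nonneg _)]
    exact ENNReal.ofReal_le_ofReal (norm_inner_le_norm _ _)
  set c := (hsSq b A).toReal with hc
  have h2 : ‖A‖ ≤ √c := by
    refine A.opNorm_le_bound (Real.sqrt_nonneg _) fun v => ?_
    have := ENNReal.toReal_mono (by finiteness) (h v)
    rw [ENNReal.toReal_mul, ENNReal.toReal_pow, ENNReal.toReal_pow, toReal_enorm, toReal_enorm,
      ← hc] at this
    rw [← Real.sqrt_sq (norm_nonneg (A v)), ← Real.sqrt_sq (norm_nonneg v),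
      ← Real.sqrt_mul ENNReal.toReal_nonneg]
    exact Real.sqrt_le_sqrt this
  have h3 : ‖A‖ ^ 2 ≤ c := by
    have := pow_le_pow_left₀ (norm_nonneg _) h2 2
    rwa [Real.sq_sqrt ENNReal.toReal_nonneg] at this
  rw [← ofReal_norm, ← ENNReal.ofReal_pow (norm_nonneg _)]
  exact (ENNReal.ofReal_le_ofReal h3).trans (ENNReal.ofReal_toReal htop).le

theorem enorm_le_posTr {x : F →L[ℂ] F} (hx : 0 ≤ x) : ‖x‖ₑ ≤ posTr b x := by
  obtain ⟨h1, h2⟩ := sqrt_spec hx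
  rw [posTr_eq_hsSq b hx]
  refine le_trans ?_ (enorm_sq_le_hsSq b _)
  nth_rw 1 [← h2]
  rw [sq, ← ofReal_norm, ← ofReal_norm, ← ENNReal.ofReal_mul (norm_nonneg _)]
  exact ENNReal.ofReal_le_ofReal (norm_mul_le _ _)

theorem enorm_le_traceNorm (x : F →L[ℂ] F) : ‖x‖ₑ ≤ traceNorm b x := by
  have h := enorm_le_posTr b (CFC.abs_nonneg x)
  rw [← ofReal_norm, CFC.norm_abs, ofReal_norm] at h
  exact h

theorem posTr_tsum_le {p : ℕ → F →L[ℂ] F} (hp : ∀ j, 0 ≤ p j) {s : F →L[ℂ] F} (hs : HasSum p s) :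
    posTr b s ≤ ∑' j, posTr b (p j) := by
  unfold posTr
  rw [ENNReal.tsum_comm]
  refine ENNReal.tsum_le_tsum fun n => ?_
  have h1 : HasSum (fun j => RCLike.re ⟪b n, p j (b n)⟫_ℂ) (RCLike.re ⟪b n, s (b n)⟫_ℂ) := by
    have h2 := hs.mapL (ContinuousLinearMap.apply ℂ F (b n))
    have h3 := h2.mapL (innerSL ℂ (b n))
    exact RCLike.hasSum_re ℂ h3
  rw [← h1.tsum_eq, ENNReal.ofReal_tsum_of_nonneg (fun j => re_inner_nonneg (hp j) _) h1.summable]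

end TraceNorm

/-! ### The Banach space of self-adjoint trace class operators and its positive cone -/

section TraceClass

variable {F : Type*} [NormedAddCommGroup F] [InnerProductSpace ℂ F] [CompleteSpace F]
  (b : HilbertBasis ℕ ℂ F)

theorem IsTraceSA.smul {b : HilbertBasis ℕ ℂ F} {x : F →L[ℂ] F} (hx : IsTraceSA b x) (r : ℝ) :
    IsTraceSA b ((r : ℂ) • x) := by
  refine ⟨?_, ?_⟩
  · rw [isSelfAdjoint_iff, star_smul, hx.1.star_eq, RCLike.star_def, Complex.conj_ofReal]
  · rw [traceNorm_smul]
    exact ENNReal.mul_lt_top ENNReal.ofReal_lt_top hx.2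

/-- Self-adjoint trace class operators, as a real subspace of the bounded operators. -/
def traceSubmodule : Submodule ℝ (F →L[ℂ] F) where
  carrier := {x | IsTraceSA b x}
  add_mem' hx hy :=
    ⟨hx.1.add hy.1, (traceNorm_add_le b hx.1 hy.1).trans_lt (ENNReal.add_lt_top.2 ⟨hx.2, hy.2⟩)⟩
  zero_mem' := ⟨IsSelfAdjoint.zero _, by rw [traceNorm_zero]; exact ENNReal.zero_lt_top⟩
  smul_mem' r x hx := by
    rw [← Complex.coe_smul]
    exact hx.smul r

/-- The real Banach space of self-adjoint trace class operators with the trace norm. -/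
def TraceClass : Type _ := traceSubmodule b

variable {b}

namespace TraceClass

instance : AddCommGroup (TraceClass b) := inferInstanceAs (AddCommGroup (traceSubmodule b))

instance : Module ℝ (TraceClass b) := inferInstanceAs (Module ℝ (traceSubmodule b))

/-- The underlying bounded operator. -/
def op : TraceClass b →ₗ[ℝ] (F →L[ℂ] F) := (traceSubmodule b).subtype

theorem isTraceSA (x : TraceClass b) : IsTraceSA b (op x) := x.2

theorem op_injective : Function.Injective (op : TraceClass b → F →L[ℂ] F) :=
  Subtype.val_injective

/-- Bundling of a self-adjoint trace class operator. -/
def mk (x : F →L[ℂ] F) (hx : IsTraceSA b x) : TraceClass b := ⟨x, hx⟩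

@[simp] theorem op_mk (x : F →L[ℂ] F) (hx : IsTraceSA b x) : op (mk x hx) = x := rfl

@[simp] theorem mk_op (x : TraceClass b) : mk (op x) x.isTraceSA = x := rfl

instance : Norm (TraceClass b) := ⟨fun x => (traceNorm b (op x)).toReal⟩

theorem norm_def (x : TraceClass b) : ‖x‖ = (traceNorm b (op x)).toReal := rfl

theorem traceNorm_op (x : TraceClass b) : traceNorm b (op x) = ENNReal.ofReal ‖x‖ :=
  (ENNReal.ofReal_toReal x.isTraceSA.2.ne).symm

theorem normedSpaceCore : NormedSpace.Core ℝ (TraceClass b) where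
  norm_nonneg _ := ENNReal.toReal_nonneg
  norm_smul c x := by
    rw [norm_def, norm_def, map_smul, ← Complex.coe_smul, traceNorm_smul, ENNReal.toReal_mul,
      ENNReal.toReal_ofReal (abs_nonneg _), Real.norm_eq_abs]
  norm_triangle x y := by
    rw [norm_def, norm_def, norm_def, map_add, ← ENNReal.toReal_add x.isTraceSA.2.ne
      y.isTraceSA.2.ne]
    exact ENNReal.toReal_mono (by simp [x.isTraceSA.2.ne, y.isTraceSA.2.ne])
      (traceNorm_add_le b x.isTraceSA.1 y.isTraceSA.1)
  norm_eq_zero_iff x := by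
    constructor
    · intro h
      rw [norm_def, ENNReal.toReal_eq_zero_iff, or_iff_left x.isTraceSA.2.ne] at h
      have h2 := enorm_le_traceNorm b (op x)
      rw [h, nonpos_iff_eq_zero, enorm_eq_zero] at h2
      exact op_injective (by rw [h2, map_zero])
    · rintro rfl
      rw [norm_def, map_zero, traceNorm_zero, ENNReal.toReal_zero]

instance : NormedAddCommGroup (TraceClass b) := NormedAddCommGroup.ofCore normedSpaceCore

instance : NormedSpace ℝ (TraceClass b) := NormedSpace.ofCore normedSpaceCore

theorem norm_op_le (x : TraceClass b) : ‖op x‖ ≤ ‖x‖ := by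
  have h := enorm_le_traceNorm b (op x)
  rw [traceNorm_op, ← ofReal_norm] at h
  exact (ENNReal.ofReal_le_ofReal_iff (norm_nonneg _)).1 h

/-- The inclusion in the bounded operators as a continuous linear map. -/
def opL : TraceClass b →L[ℝ] (F →L[ℂ] F) :=
  LinearMap.mkContinuous op 1 fun x => by rw [one_mul]; exact norm_op_le x

theorem isTraceSA_of_nonneg {p : F →L[ℂ] F} (hp : 0 ≤ p) (h : posTr b p < ∞) : IsTraceSA b p :=
  ⟨IsSelfAdjoint.of_nonneg hp, by rwa [traceNorm_of_nonneg b hp]⟩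

theorem posTr_lt_top (x : TraceClass b) : posTr b (op x)⁺ < ∞ ∧ posTr b (op x)⁻ < ∞ := by
  have h := x.isTraceSA.2
  rw [traceNorm_eq b x.isTraceSA.1] at h
  exact ENNReal.add_lt_top.1 h

/-- The positive part. -/
def pos (x : TraceClass b) : TraceClass b :=
  mk (op x)⁺ (isTraceSA_of_nonneg (CFC.posPart_nonneg _) x.posTr_lt_top.1)

/-- The negative part. -/
def neg (x : TraceClass b) : TraceClass b :=
  mk (op x)⁻ (isTraceSA_of_nonneg (CFC.negPart_nonneg _) x.posTr_lt_top.2)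

theorem op_pos_nonneg (x : TraceClass b) : 0 ≤ op (pos x) := CFC.posPart_nonneg _

theorem op_neg_nonneg (x : TraceClass b) : 0 ≤ op (neg x) := CFC.negPart_nonneg _

theorem pos_sub_neg (x : TraceClass b) : pos x - neg x = x :=
  op_injective (by rw [map_sub]; exact CFC.posPart_sub_negPart (op x) x.isTraceSA.1)

/-- The real part of a diagonal matrix coefficient. -/
def diag (x : TraceClass b) (n : ℕ) : ℝ := RCLike.re ⟪b n, op x (b n)⟫_ℂ

theorem diag_add (x y : TraceClass b) (n : ℕ) : diag (x + y) n = diag x n + diag y n := by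
  rw [diag, map_add, add_apply, inner_add_right, map_add, diag, diag]

theorem diag_smul (r : ℝ) (x : TraceClass b) (n : ℕ) : diag (r • x) n = r * diag x n := by
  rw [diag, map_smul, ← Complex.coe_smul, smul_apply, inner_smul_right]
  exact RCLike.re_ofReal_mul r _

theorem diag_sub (x y : TraceClass b) (n : ℕ) : diag (x - y) n = diag x n - diag y n := by
  rw [diag, map_sub, sub_apply, inner_sub_right, map_sub, diag, diag]

theorem diag_nonneg {x : TraceClass b} (hx : 0 ≤ op x) (n : ℕ) : 0 ≤ diag x n :=
  re_inner_nonneg hx _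

theorem hasSum_diag_of_nonneg {x : TraceClass b} (hx : 0 ≤ op x) : HasSum (diag x) ‖x‖ := by
  have h := x.isTraceSA.2
  rw [traceNorm_of_nonneg b hx] at h
  rw [norm_def, traceNorm_of_nonneg b hx]
  have e : ∀ n, (ENNReal.ofReal (diag x n)).toReal = diag x n := fun n =>
    ENNReal.toReal_ofReal (diag_nonneg hx n)
  have hs := ENNReal.hasSum_toReal (f := fun n => ENNReal.ofReal (diag x n)) h.ne
  rw [← ENNReal.tsum_toReal_eq fun n => ENNReal.ofReal_ne_top] at hs
  simp only [e] at hs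
  exact hs

theorem norm_eq_pos_add_neg (x : TraceClass b) : ‖x‖ = ‖pos x‖ + ‖neg x‖ := by
  rw [norm_def, norm_def, norm_def, traceNorm_of_nonneg b x.op_pos_nonneg,
    traceNorm_of_nonneg b x.op_neg_nonneg, traceNorm_eq b x.isTraceSA.1,
    ENNReal.toReal_add x.posTr_lt_top.1.ne x.posTr_lt_top.2.ne]
  rfl

theorem hasSum_diag (x : TraceClass b) : HasSum (diag x) (‖pos x‖ - ‖neg x‖) := by
  have h := (hasSum_diag_of_nonneg x.op_pos_nonneg).sub (hasSum_diag_of_nonneg x.op_neg_nonneg)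
  convert! h using 1
  ext n
  rw [← diag_sub, pos_sub_neg]

theorem summable_diag (x : TraceClass b) : Summable (diag x) := x.hasSum_diag.summable

/-- The trace. -/
def tr : TraceClass b →L[ℝ] ℝ :=
  LinearMap.mkContinuous
    { toFun := fun x => ∑' n, diag x n
      map_add' := fun x y => by
        rw [← x.summable_diag.tsum_add y.summable_diag]
        simp only [diag_add]
      map_smul' := fun r x => by
        simp only [diag_smul, tsum_mul_left, RingHom.id_apply, smul_eq_mul] }
    1 fun x => by
      change ‖∑' n, diag x n‖ ≤ _
      rw [x.hasSum_diag.tsum_eq, one_mul, norm_eq_pos_add_neg x, Real.norm_eq_abs, abs_le]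
      constructor <;> linarith [norm_nonneg (pos x), norm_nonneg (neg x)]

theorem hasSum_tr (x : TraceClass b) : HasSum (diag x) (tr x) := x.summable_diag.hasSum

theorem tr_eq_norm {x : TraceClass b} (hx : 0 ≤ op x) : tr x = ‖x‖ :=
  x.hasSum_tr.unique (hasSum_diag_of_nonneg hx)

theorem tr_nonneg {x : TraceClass b} (hx : 0 ≤ op x) : 0 ≤ tr x := by
  rw [tr_eq_norm hx]; exact norm_nonneg _

theorem sum_abs_diag_le (x : TraceClass b) (s : Finset ℕ) : ∑ n ∈ s, |diag x n| ≤ ‖x‖ := by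
  have h1 := hasSum_diag_of_nonneg x.op_pos_nonneg
  have h2 := hasSum_diag_of_nonneg x.op_neg_nonneg
  rw [norm_eq_pos_add_neg]
  refine le_trans ?_ (sum_le_hasSum s (fun n _ => ?_) (h1.add h2))
  · refine Finset.sum_le_sum fun n _ => ?_
    have e : diag x n = diag (pos x) n - diag (neg x) n := by rw [← diag_sub, pos_sub_neg]
    rw [e, abs_le]
    have := diag_nonneg x.op_pos_nonneg n
    have := diag_nonneg x.op_neg_nonneg n
    constructor <;> linarith
  · exact add_nonneg (diag_nonneg x.op_pos_nonneg n) (diag_nonneg x.op_neg_nonneg n)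

theorem norm_sub_le_tr {p q : TraceClass b} (hp : 0 ≤ op p) (hq : 0 ≤ op q) :
    ‖p - q‖ ≤ tr p + tr q := by
  have h := traceNorm_sub_le b hp hq
  rw [← traceNorm_of_nonneg b hp, ← traceNorm_of_nonneg b hq, ← map_sub, traceNorm_op,
    traceNorm_op, traceNorm_op, ← ENNReal.ofReal_add (norm_nonneg _) (norm_nonneg _)] at h
  rw [tr_eq_norm hp, tr_eq_norm hq]
  exact (ENNReal.ofReal_le_ofReal_iff (by positivity)).1 h

/-- An element between `-r` and `r` has norm at most the trace of `r`. -/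
theorem norm_le_tr_of_between {z r : TraceClass b} (h1 : 0 ≤ op (r + z)) (h2 : 0 ≤ op (r - z)) :
    ‖z‖ ≤ tr r := by
  have h := norm_sub_le_tr h1 h2
  have e : (r + z) - (r - z) = (2 : ℝ) • z := by rw [two_smul]; abel
  rw [e, norm_smul, map_add, map_sub] at h
  norm_num at h
  linarith

theorem isClosed_nonneg : IsClosed {x : TraceClass b | 0 ≤ op x} :=
  (isClosed_Ici (a := (0 : F →L[ℂ] F))).preimage opL.continuous

theorem op_smul_nonneg {r : ℝ} (hr : 0 ≤ r) {x : TraceClass b} (hx : 0 ≤ op x) :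
    0 ≤ op (r • x) := by
  rw [map_smul]; exact smul_nonneg hr hx

theorem op_add_nonneg {x y : TraceClass b} (hx : 0 ≤ op x) (hy : 0 ≤ op y) :
    0 ≤ op (x + y) := by
  rw [map_add]; exact add_nonneg hx hy

/-- The series converges in operator norm. The trace of a tail, computed on the diagonal, is at most
the tail of the series of trace norms, which upgrades the convergence to the trace norm. -/
theorem tendsto_of_nonneg_summable {p : ℕ → TraceClass b} (hp : ∀ j, 0 ≤ op (p j))
    (hs : Summable fun j => ‖p j‖) :
    ∃ s : TraceClass b, Tendsto (fun k => ∑ j ∈ Finset.range k, p j) atTop (𝓝 s) := by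
  have hs' : Summable fun j => op (p j) :=
    Summable.of_norm_bounded hs fun j => norm_op_le (p j)
  have htail : ∀ k, 0 ≤ (∑' j, op (p (j + k))) ∧
      posTr b (∑' j, op (p (j + k))) ≤ ENNReal.ofReal (∑' j, ‖p (j + k)‖) := by
    intro k
    have hk : Summable fun j => op (p (j + k)) := (summable_nat_add_iff k).2 hs'
    refine ⟨tsum_nonneg fun j => hp _, (posTr_tsum_le b (fun j => hp _) hk.hasSum).trans ?_⟩
    rw [ENNReal.ofReal_tsum_of_nonneg (fun _ => norm_nonneg _) ((summable_nat_add_iff k).2 hs)]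
    refine ENNReal.tsum_le_tsum fun j => ?_
    rw [← traceNorm_of_nonneg b (hp _), traceNorm_op]
  set t : ℕ → TraceClass b := fun k => mk (∑' j, op (p (j + k)))
    (isTraceSA_of_nonneg (htail k).1 ((htail k).2.trans_lt ENNReal.ofReal_lt_top)) with ht
  have hsplit : ∀ k, ∑ j ∈ Finset.range k, p j = t 0 - t k := by
    intro k
    refine op_injective ?_
    rw [map_sub, map_sum]
    simp only [ht, op_mk, add_zero]
    rw [← hs'.sum_add_tsum_nat_add k, add_sub_cancel_right]
  have hnorm : ∀ k, ‖t k‖ ≤ ∑' j, ‖p (j + k)‖ := by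
    intro k
    have h := (htail k).2
    rw [← traceNorm_of_nonneg b (htail k).1] at h
    exact ENNReal.toReal_le_of_le_ofReal (tsum_nonneg fun _ => norm_nonneg _) h
  refine ⟨t 0, ?_⟩
  have h0 : Tendsto t atTop (𝓝 0) :=
    squeeze_zero_norm hnorm (tendsto_sum_nat_add fun j => ‖p j‖)
  simpa [hsplit] using h0.const_sub (t 0)

/-- The norm is the sum of the norms of the positive and negative parts, so an absolutely convergent
series splits into two absolutely convergent series of positive elements. -/
instance : CompleteSpace (TraceClass b) := by
  rw [← NormedAddCommGroup.summable_imp_tendsto_iff_completeSpace]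
  intro u hu
  obtain ⟨s, hs⟩ := tendsto_of_nonneg_summable (p := fun j => pos (u j))
    (fun j => (u j).op_pos_nonneg) (hu.of_nonneg_of_le (fun _ => norm_nonneg _) fun j => by
      rw [norm_eq_pos_add_neg (u j)]; linarith [norm_nonneg (neg (u j))])
  obtain ⟨s', hs'⟩ := tendsto_of_nonneg_summable (p := fun j => neg (u j))
    (fun j => (u j).op_neg_nonneg) (hu.of_nonneg_of_le (fun _ => norm_nonneg _) fun j => by
      rw [norm_eq_pos_add_neg (u j)]; linarith [norm_nonneg (pos (u j))])
  refine ⟨s - s', ?_⟩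
  have h := hs.sub hs'
  simpa only [← Finset.sum_sub_distrib, pos_sub_neg] using h

theorem conj_nonneg {x : F →L[ℂ] F} (hx : 0 ≤ x) (A : F →L[ℂ] F) : 0 ≤ A * x * star A :=
  star_right_conjugate_nonneg hx A

theorem posTr_conj_le {x : F →L[ℂ] F} (hx : 0 ≤ x) (A : F →L[ℂ] F) :
    posTr b (A * x * star A) ≤ ‖A‖ₑ ^ 2 * posTr b x := by
  rw [posTr_conj b hx, posTr_eq_hsSq b hx]
  exact hsSq_mul_le b _ _

theorem traceNorm_conj_le (A : F →L[ℂ] F) (x : TraceClass b) :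
    traceNorm b (A * op x * star A) ≤ ENNReal.ofReal (‖A‖ ^ 2 * ‖x‖) := by
  have h1 := x.op_pos_nonneg
  have h2 := x.op_neg_nonneg
  have e : A * op x * star A = A * op (pos x) * star A - A * op (neg x) * star A := by
    conv_lhs => rw [← pos_sub_neg x]
    rw [map_sub, mul_sub, sub_mul]
  rw [e]
  refine (traceNorm_sub_le b (conj_nonneg h1 A) (conj_nonneg h2 A)).trans ?_
  refine (add_le_add (posTr_conj_le h1 A) (posTr_conj_le h2 A)).trans ?_
  rw [← mul_add, ← traceNorm_of_nonneg b h1, ← traceNorm_of_nonneg b h2, traceNorm_op,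
    traceNorm_op, ← ENNReal.ofReal_add (norm_nonneg _) (norm_nonneg _), ← norm_eq_pos_add_neg,
    ← ofReal_norm, ← ENNReal.ofReal_pow (norm_nonneg _), ← ENNReal.ofReal_mul (by positivity)]

/-- The map `x ↦ A x A†`. -/
def conj (A : F →L[ℂ] F) : TraceClass b →L[ℝ] TraceClass b :=
  LinearMap.mkContinuous
    { toFun := fun x => mk (A * op x * star A)
        ⟨by
          rw [isSelfAdjoint_iff, star_mul, star_mul, star_star, x.isTraceSA.1.star_eq, mul_assoc],
          (traceNorm_conj_le A x).trans_lt ENNReal.ofReal_lt_top⟩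
      map_add' := fun x y => op_injective (by
        change A * op (x + y) * star A = A * op x * star A + A * op y * star A
        rw [map_add, mul_add, add_mul])
      map_smul' := fun r x => op_injective (by
        change A * op (r • x) * star A = r • (A * op x * star A)
        rw [map_smul, mul_smul_comm, smul_mul_assoc]) }
    (‖A‖ ^ 2) fun x => ENNReal.toReal_le_of_le_ofReal (by positivity) (traceNorm_conj_le A x)

@[simp] theorem op_conj (A : F →L[ℂ] F) (x : TraceClass b) :
    op (conj A x) = A * op x * star A := rfl

theorem op_conj_nonneg (A : F →L[ℂ] F) {x : TraceClass b} (hx : 0 ≤ op x) : 0 ≤ op (conj A x) :=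
  conj_nonneg hx A

theorem conj_mul (A B : F →L[ℂ] F) : (conj (A * B) : TraceClass b →L[ℝ] _) = conj A * conj B := by
  ext1 x
  refine op_injective ?_
  change op (conj (A * B) x) = op (conj A (conj B x))
  simp only [op_conj, star_mul, mul_assoc]

@[simp] theorem conj_one : (conj 1 : TraceClass b →L[ℝ] TraceClass b) = 1 := by
  ext1 x
  refine op_injective ?_
  change op (conj 1 x) = op x
  simp

theorem conj_conj (A B : F →L[ℂ] F) (x : TraceClass b) : conj A (conj B x) = conj (A * B) x := by
  rw [conj_mul]; rfl

/-- A positive element is a sum of rank one projections onto multiples of vectors. -/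
theorem exists_hasSum_tr_conj {x : TraceClass b} (hx : 0 ≤ op x) :
    ∃ v : ℕ → F, ∀ A : F →L[ℂ] F, HasSum (fun n => ‖A (v n)‖ ^ 2) (tr (conj A x)) := by
  -- The same vectors serve every A, so inequalities between traces follow from inequalities between
  -- quadratic forms, vector by vector.
  refine ⟨fun n => CFC.sqrt (op x) (b n), fun A => ?_⟩
  have hA := op_conj_nonneg A hx
  have h := (conj A x).isTraceSA.2
  have e : (fun n => ‖A (CFC.sqrt (op x) (b n))‖ ^ 2) =
      fun n => (‖(A * CFC.sqrt (op x)) (b n)‖ₑ ^ 2).toReal := by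
    ext n
    rw [ENNReal.toReal_pow, toReal_enorm]
    rfl
  rw [traceNorm_of_nonneg b hA, op_conj, posTr_conj b hx] at h
  rw [e, tr_eq_norm hA, norm_def, traceNorm_of_nonneg b hA, op_conj, posTr_conj b hx]
  rw [hsSq, ENNReal.tsum_toReal_eq (ENNReal.ne_top_of_tsum_ne_top h.ne)]
  exact ENNReal.hasSum_toReal h.ne

theorem tr_conj_le {x : TraceClass b} (hx : 0 ≤ op x) {A B : F →L[ℂ] F} {c : ℝ}
    (h : ∀ v, ‖A v‖ ^ 2 ≤ c * ‖B v‖ ^ 2) : tr (conj A x) ≤ c * tr (conj B x) := by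
  obtain ⟨v, hv⟩ := exists_hasSum_tr_conj hx
  exact hasSum_le (fun n => h (v n)) (hv A) ((hv B).mul_left c)

/-- The symmetrised product `A x Y† + Y x A†`. -/
def cross (A Y : F →L[ℂ] F) : TraceClass b →L[ℝ] TraceClass b :=
  conj (A + Y) - conj A - conj Y

theorem op_cross (A Y : F →L[ℂ] F) (x : TraceClass b) :
    op (cross A Y x) = A * op x * star Y + Y * op x * star A := by
  change op (conj (A + Y) x - conj A x - conj Y x) = _
  simp only [map_sub, op_conj, star_add]
  noncomm_ring

/-- Completing the square: the two elements are x conjugated by √δ A ± Y/√δ. -/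
theorem cross_between {x : TraceClass b} (hx : 0 ≤ op x) (A Y : F →L[ℂ] F) {δ : ℝ} (hδ : 0 < δ) :
    0 ≤ op (δ • conj A x + δ⁻¹ • conj Y x + cross A Y x) ∧
      0 ≤ op (δ • conj A x + δ⁻¹ • conj Y x - cross A Y x) := by
  have hs : (√δ : ℂ) * √δ = δ := by
    rw [← Complex.ofReal_mul, Real.mul_self_sqrt hδ.le]
  have hs0 : (√δ : ℂ) ≠ 0 := by
    rw [Complex.ofReal_ne_zero]; exact (Real.sqrt_pos.2 hδ).ne'
  have hi : (√δ : ℂ)⁻¹ * (√δ : ℂ)⁻¹ = (δ : ℂ)⁻¹ := by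
    rw [← mul_inv, hs]
  have e1 : δ • conj A x + δ⁻¹ • conj Y x + cross A Y x =
      conj ((√δ : ℂ) • A + (√δ : ℂ)⁻¹ • Y) x := by
    refine op_injective ?_
    simp only [map_add, map_smul, op_conj, op_cross, star_add, star_smul, ← Complex.coe_smul,
      Complex.ofReal_inv, add_mul, mul_add, smul_mul_assoc, mul_smul_comm, smul_add, smul_smul,
      RCLike.star_def,
      Complex.conj_ofReal, map_inv₀, hs, hi, mul_inv_cancel₀ hs0, inv_mul_cancel₀ hs0, one_smul]
    abel
  have e2 : δ • conj A x + δ⁻¹ • conj Y x - cross A Y x =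
      conj ((√δ : ℂ) • A - (√δ : ℂ)⁻¹ • Y) x := by
    refine op_injective ?_
    simp only [map_add, map_sub, map_smul, op_conj, op_cross, star_sub, star_smul,
      ← Complex.coe_smul, Complex.ofReal_inv, sub_mul, mul_sub, smul_mul_assoc, mul_smul_comm,
      smul_sub, smul_smul, RCLike.star_def,
      Complex.conj_ofReal, map_inv₀, hs, hi, mul_inv_cancel₀ hs0, inv_mul_cancel₀ hs0, one_smul]
    abel
  rw [e1, e2]
  exact ⟨op_conj_nonneg _ hx, op_conj_nonneg _ hx⟩

theorem norm_cross_le {x : TraceClass b} (hx : 0 ≤ op x) (A Y : F →L[ℂ] F) {δ : ℝ} (hδ : 0 < δ) :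
    ‖cross A Y x‖ ≤ δ * tr (conj A x) + δ⁻¹ * tr (conj Y x) := by
  obtain ⟨h1, h2⟩ := cross_between hx A Y hδ
  simpa using norm_le_tr_of_between h1 h2

theorem norm_conj_add_sub_le {x : TraceClass b} (hx : 0 ≤ op x) (A Y : F →L[ℂ] F) {δ : ℝ}
    (hδ : 0 < δ) :
    ‖conj (A + Y) x - conj A x‖ ≤ δ * tr (conj A x) + (δ⁻¹ + 1) * tr (conj Y x) := by
  have e : conj (A + Y) x - conj A x = cross A Y x + conj Y x := by
    change _ = conj (A + Y) x - conj A x - conj Y x + conj Y x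
    abel
  rw [e]
  refine (norm_add_le _ _).trans ?_
  rw [← tr_eq_norm (op_conj_nonneg Y hx)]
  linarith [norm_cross_le hx A Y hδ]

end TraceClass

end TraceClass

/-! ### Exponentials of bounded operators -/

section Flow

variable {E : Type*} [NormedAddCommGroup E] [NormedSpace ℝ E]

/-- The exponential `exp (t A)` of a bounded operator. -/
def flow (A : E →L[ℝ] E) (t : ℝ) : E →L[ℝ] E := NormedSpace.exp (t • A)

theorem flow_zero (A : E →L[ℝ] E) : flow A 0 = 1 := by
  rw [flow, zero_smul, NormedSpace.exp_zero]

theorem exp_smul_one (c : ℝ) :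
    NormedSpace.exp (c • (1 : E →L[ℝ] E)) = Real.exp c • (1 : E →L[ℝ] E) := by
  rw [← Algebra.algebraMap_eq_smul_one, ← NormedSpace.algebraMap_exp_comm,
    ← Real.exp_eq_exp_ℝ, Algebra.algebraMap_eq_smul_one]

theorem commute_flow {A B : E →L[ℝ] E} (h : Commute A B) (t : ℝ) : Commute A (flow B t) :=
  (h.smul_right t).exp_right

theorem flow_apply_comm {A B : E →L[ℝ] E} (h : Commute A B) (t : ℝ) (x : E) :
    A (flow B t x) = flow B t (A x) := by
  change (A * flow B t) x = (flow B t * A) x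
  rw [(commute_flow h t).eq]

variable [CompleteSpace E]

theorem exp_add_of_commute' {A B : E →L[ℝ] E} (h : Commute A B) :
    NormedSpace.exp (A + B) = NormedSpace.exp A * NormedSpace.exp B := by
  let _ : NormedAlgebra ℚ (E →L[ℝ] E) := NormedAlgebra.restrictScalars ℚ ℝ _
  exact NormedSpace.exp_add_of_commute h

theorem flow_add (A : E →L[ℝ] E) (s t : ℝ) : flow A (s + t) = flow A s * flow A t := by
  rw [flow, add_smul, exp_add_of_commute' (((Commute.refl A).smul_left s).smul_right t)]
  rfl

theorem flow_add_apply (A : E →L[ℝ] E) (s t : ℝ) (x : E) :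
    flow A (s + t) x = flow A s (flow A t x) := by rw [flow_add]; rfl

theorem hasDerivAt_flow (A : E →L[ℝ] E) (x : E) (t : ℝ) :
    HasDerivAt (fun s => flow A s x) (A (flow A t x)) t := by
  have h := hasDerivAt_exp_smul_const' (𝕂 := ℝ) A t
  exact (ContinuousLinearMap.apply ℝ E x).hasFDerivAt.comp_hasDerivAt t h

theorem tendsto_exp {ι : Type*} {l : Filter ι} {f : ι → E →L[ℝ] E} {A : E →L[ℝ] E}
    (h : Tendsto f l (𝓝 A)) (x : E) :
    Tendsto (fun i => NormedSpace.exp (f i) x) l (𝓝 (NormedSpace.exp A x)) := by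
  let _ : NormedAlgebra ℚ (E →L[ℝ] E) := NormedAlgebra.restrictScalars ℚ ℝ _
  exact ((ContinuousLinearMap.apply ℝ E x).continuous.tendsto _).comp h.exp

/-- The exponential series has nonnegative coefficients, and every power of A preserves the closed
cone. -/
theorem exp_mem_cone {A : E →L[ℝ] E} {s : Set E} (hs : IsClosed s) (h0 : (0 : E) ∈ s)
    (hadd : ∀ x ∈ s, ∀ y ∈ s, x + y ∈ s) (hsmul : ∀ r : ℝ, 0 ≤ r → ∀ x ∈ s, r • x ∈ s)
    (hA : ∀ x ∈ s, A x ∈ s) {x : E} (hx : x ∈ s) : NormedSpace.exp A x ∈ s := by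
  have h := (NormedSpace.exp_series_hasSum_exp' (𝕂 := ℝ) A).mapL (ContinuousLinearMap.apply ℝ E x)
  refine hs.mem_of_tendsto h (Eventually.of_forall fun t => ?_)
  refine Finset.sum_induction _ (· ∈ s) (fun a c ha hc => hadd a ha c hc) h0 fun n hn => ?_
  refine hsmul _ (by positivity) _ ?_
  clear hn
  induction n with
  | zero => exact hx
  | succ n ih => rw [pow_succ']; exact hA _ ih

/-- Variation of constants, as a differential equation. -/
theorem hasDerivAt_flow_flow (A B : E →L[ℝ] E) (x : E) (t s : ℝ) :
    HasDerivAt (fun r => flow A (t - r) (flow B r x))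
      (flow A (t - s) ((B - A) (flow B s x))) s := by
  have h1 := hasDerivAt_exp_smul_const (𝕂 := ℝ) A (t - s)
  have h2 : HasDerivAt (fun r : ℝ => t - r) (-1) s := by
    simpa using (hasDerivAt_id s).const_sub t
  have h3 : HasDerivAt (fun r => flow A (t - r)) ((-1 : ℝ) • (flow A (t - s) * A)) s :=
    h1.scomp s h2
  have h4 := h3.clm_apply (hasDerivAt_flow B x s)
  convert! h4 using 1
  simp only [sub_apply, map_sub, mul_apply_eq_comp, neg_smul, one_smul, neg_apply]
  abel

end Flow

/-- Gronwall: the hypothesis says that e^(cs) (f - g/c) is nonincreasing. -/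
theorem le_of_deriv_le_neg_mul_add {f f' : ℝ → ℝ} {c g : ℝ} (hc : 0 < c)
    (hf : ∀ s, HasDerivAt f (f' s) s) (h : ∀ s, 0 ≤ s → f' s ≤ -c * f s + g) {t : ℝ}
    (ht : 0 ≤ t) :
    f t ≤ Real.exp (-(c * t)) * f 0 + g / c * (1 - Real.exp (-(c * t))) := by
  have hd : ∀ s, HasDerivAt (fun s => Real.exp (c * s) * (f s - g / c))
      (Real.exp (c * s) * (c * f s - g + f' s)) s := by
    intro s
    have h1 : HasDerivAt (fun s => Real.exp (c * s)) (Real.exp (c * s) * c) s := by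
      simpa using ((hasDerivAt_id s).const_mul c).exp
    convert! h1.mul ((hf s).sub_const (g / c)) using 1
    field_simp
  have hanti : AntitoneOn (fun s => Real.exp (c * s) * (f s - g / c)) (Set.Ici 0) := by
    refine antitoneOn_of_deriv_nonpos (convex_Ici 0)
      (fun s _ => (hd s).continuousAt.continuousWithinAt)
      (fun s _ => (hd s).differentiableAt.differentiableWithinAt) fun s hs => ?_
    rw [interior_Ici] at hs
    rw [(hd s).deriv]
    have := h s (le_of_lt hs)
    exact mul_nonpos_of_nonneg_of_nonpos (Real.exp_pos _).le (by linarith)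
  have h1 := hanti Set.self_mem_Ici ht ht
  simp only [mul_zero, Real.exp_zero, one_mul] at h1
  have e : Real.exp (-(c * t)) * Real.exp (c * t) = 1 := by
    rw [← Real.exp_add]; simp
  have h2 := mul_le_mul_of_nonneg_left h1 (Real.exp_pos (-(c * t))).le
  rw [← mul_assoc, e, one_mul] at h2
  linarith

/-! ### Bounded Lindblad operators: positivity, trace preservation, contraction -/

section Lindblad

variable {F : Type*} [NormedAddCommGroup F] [InnerProductSpace ℂ F] [CompleteSpace F]
  {b : HilbertBasis ℕ ℂ F}

open TraceClass

/-- The bounded operator `x ↦ L x L† + K x + x K†`. -/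
def lindblad (b : HilbertBasis ℕ ℂ F) (L K : F →L[ℂ] F) : TraceClass b →L[ℝ] TraceClass b :=
  conj L + cross K 1

theorem op_lindblad (L K : F →L[ℂ] F) (x : TraceClass b) :
    op (lindblad b L K x) = L * op x * star L + K * op x + op x * star K := by
  change op (conj L x + cross K 1 x) = _
  rw [map_add, op_conj, op_cross]
  simp [add_assoc]

/-- Adding the second order term s K x K† completes the square, so up to a multiple of the identity
the operator is a sum of maps x ↦ A x A†, which are positive. -/
theorem lindblad_eq (L K : F →L[ℂ] F) {s : ℝ} (hs : s ≠ 0) :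
    lindblad b L K + s • conj K =
      s⁻¹ • (conj (1 + (s : ℂ) • K) + s • conj L) - s⁻¹ • 1 := by
  ext1 x
  refine op_injective ?_
  change op (lindblad b L K x + s • conj K x) =
    op (s⁻¹ • (conj (1 + (s : ℂ) • K) x + s • conj L x) - s⁻¹ • x)
  have hsC : (s : ℂ) ≠ 0 := Complex.ofReal_ne_zero.2 hs
  rw [map_add, op_lindblad, map_sub, map_smul, map_smul, map_smul, map_add, map_smul]
  simp only [op_conj, ← Complex.coe_smul, star_add, star_one, star_smul, RCLike.star_def,
    Complex.conj_ofReal, add_mul, mul_add, one_mul, mul_one, smul_mul_assoc, mul_smul_comm,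
    smul_add, smul_smul, Complex.ofReal_inv, inv_mul_cancel₀ hsC, one_smul, ← mul_assoc]
  abel

/-- By `lindblad_eq` the corrected operator is a positive map minus a scalar, so its exponential is
positive. Letting the correction s tend to 0 keeps positivity because the cone is closed. -/
theorem lindblad_exp_nonneg (L K : F →L[ℂ] F) {t : ℝ} (ht : 0 ≤ t) {x : TraceClass b}
    (hx : 0 ≤ op x) : 0 ≤ op (flow (lindblad b L K) t x) := by
  have hlim : Tendsto (fun s : ℝ => t • (lindblad b L K + s • conj K)) (𝓝[>] 0)
      (𝓝 (t • lindblad b L K)) := by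
    have : Continuous fun s : ℝ => t • (lindblad b L K + s • conj K) := by fun_prop
    have h := this.tendsto 0
    rw [zero_smul, add_zero] at h
    exact h.mono_left nhdsWithin_le_nhds
  refine isClosed_nonneg.mem_of_tendsto (tendsto_exp hlim x)
    (eventually_of_mem self_mem_nhdsWithin fun s hs => ?_)
  have hs : 0 < s := hs
  rw [lindblad_eq L K hs.ne', smul_sub, sub_eq_add_neg, smul_smul, smul_smul, ← neg_smul,
    exp_add_of_commute' ((Commute.one_right _).smul_right _), exp_smul_one]
  change 0 ≤ op ((NormedSpace.exp ((t * s⁻¹) • (conj (1 + (s : ℂ) • K) + s • conj L)) :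
    TraceClass b →L[ℝ] TraceClass b) (Real.exp (-(t * s⁻¹)) • x))
  refine exp_mem_cone (s := {x : TraceClass b | 0 ≤ op x}) isClosed_nonneg ?_
    (fun x hx y hy => op_add_nonneg hx hy) (fun r hr x hx => op_smul_nonneg hr hx)
    (fun x hx => ?_) (op_smul_nonneg (Real.exp_pos _).le hx)
  · change 0 ≤ op 0
    rw [map_zero]
  · change 0 ≤ op ((t * s⁻¹) • (conj (1 + (s : ℂ) • K) x + s • conj L x))
    exact op_smul_nonneg (by positivity)
      (op_add_nonneg (op_conj_nonneg _ hx) (op_smul_nonneg hs.le (op_conj_nonneg _ hx)))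

/-- Trace functionals of a Lindblad operator at a positive element, through quadratic forms. -/
theorem tr_conj_lindblad {x : TraceClass b} {v : ℕ → F}
    (hv : ∀ A : F →L[ℂ] F, HasSum (fun n => ‖A (v n)‖ ^ 2) (tr (conj A x))) (W L K : F →L[ℂ] F) :
    HasSum (fun n => ‖W (L (v n))‖ ^ 2 + 2 * RCLike.re ⟪W (v n), W (K (v n))⟫_ℂ)
      (tr (conj W (lindblad b L K x))) := by
  -- Polarisation writes the terms K x + x K† through conjugations only, to which the representation
  -- by the vectors v applies.
  have e : tr (conj W (lindblad b L K x)) = tr (conj (W * L) x) +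
      (tr (conj (W * (K + 1)) x) - tr (conj (W * K) x) - tr (conj W x)) := by
    simp only [← conj_conj]
    rw [← map_sub, ← map_sub, ← map_add, ← map_sub, ← map_sub, ← map_add]
    congr 2
    change conj L x + (conj (K + 1) x - conj K x - conj 1 x) = _
    rw [conj_one]
    rfl
  rw [e]
  convert! (hv (W * L)).add (((hv (W * (K + 1))).sub (hv (W * K))).sub (hv W)) using 1
  ext n
  have h1 : (W * (K + 1)) (v n) = W (v n) + W (K (v n)) := by
    change W (K (v n) + v n) = _
    rw [map_add, add_comm]
  rw [h1, @norm_add_sq ℂ]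
  simp only [mul_apply_eq_comp]
  ring

/-- The form identity that makes a Lindblad operator trace preserving. -/
def IsConservative (L K : F →L[ℂ] F) : Prop :=
  ∀ v, ‖L v‖ ^ 2 + 2 * RCLike.re ⟪v, K v⟫_ℂ = 0

variable {L K : F →L[ℂ] F}

theorem tr_lindblad_of_nonneg (h : IsConservative L K) {x : TraceClass b} (hx : 0 ≤ op x) :
    tr (lindblad b L K x) = 0 := by
  obtain ⟨v, hv⟩ := exists_hasSum_tr_conj hx
  have h1 := tr_conj_lindblad hv 1 L K
  rw [conj_one] at h1
  have e : (fun n => ‖(1 : F →L[ℂ] F) (L (v n))‖ ^ 2 +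
      2 * RCLike.re ⟪(1 : F →L[ℂ] F) (v n), (1 : F →L[ℂ] F) (K (v n))⟫_ℂ) = fun _ => (0 : ℝ) := by
    ext n; exact h (v n)
  rw [e] at h1
  exact h1.unique hasSum_zero

theorem tr_lindblad (h : IsConservative L K) (x : TraceClass b) : tr (lindblad b L K x) = 0 := by
  rw [← pos_sub_neg x, map_sub, map_sub, tr_lindblad_of_nonneg h x.op_pos_nonneg,
    tr_lindblad_of_nonneg h x.op_neg_nonneg, sub_zero]

theorem tr_flow_lindblad (h : IsConservative L K) (x : TraceClass b) (t : ℝ) :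
    tr (flow (lindblad b L K) t x) = tr x := by
  have hd : ∀ s, HasDerivAt (fun s => tr (flow (lindblad b L K) s x)) 0 s := fun s => by
    have := tr.hasFDerivAt.comp_hasDerivAt s (hasDerivAt_flow (lindblad b L K) x s)
    rw [tr_lindblad h] at this
    exact this
  have := is_const_of_deriv_eq_zero (fun s => (hd s).differentiableAt) (fun s => (hd s).deriv) t 0
  rw [this, flow_zero]
  rfl

/-- On positive elements the norm is the trace, which is preserved; the general case follows by
splitting x into its positive and negative parts. -/
theorem norm_flow_lindblad_le (h : IsConservative L K) (x : TraceClass b) {t : ℝ} (ht : 0 ≤ t) :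
    ‖flow (lindblad b L K) t x‖ ≤ ‖x‖ := by
  have h1 := lindblad_exp_nonneg L K ht x.op_pos_nonneg
  have h2 := lindblad_exp_nonneg L K ht x.op_neg_nonneg
  conv_lhs => rw [← pos_sub_neg x, map_sub]
  refine (norm_sub_le_tr h1 h2).trans ?_
  rw [tr_flow_lindblad h, tr_flow_lindblad h, tr_eq_norm x.op_pos_nonneg,
    tr_eq_norm x.op_neg_nonneg, norm_eq_pos_add_neg x]

end Lindblad

/-! ### C₀-semigroups and their determination by the generator -/

section Semigroups

variable {E : Type*} [NormedAddCommGroup E] [NormedSpace ℝ E]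

/-- A strongly continuous one-parameter semigroup of bounded operators on a Banach space. -/
structure IsSemigroup (T : ℝ≥0 → E →L[ℝ] E) : Prop where
  zero : T 0 = 1
  add : ∀ s t x, T (s + t) x = T s (T t x)
  tendsto : ∀ x, Tendsto (fun t => T t x) (𝓝 0) (𝓝 x)

/-- `y` is the value at `x` of the generator of `T`. -/
def IsGenerator (T : ℝ≥0 → E →L[ℝ] E) (x y : E) : Prop :=
  Tendsto (fun t : ℝ≥0 => (t : ℝ)⁻¹ • (T t x - x)) (𝓝[>] 0) (𝓝 y)

namespace IsSemigroup

variable {T P : ℝ≥0 → E →L[ℝ] E}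

/-- Otherwise there would be times tending to 0 along which the norms are unbounded while every
orbit converges, against Banach–Steinhaus. -/
theorem exists_norm_le_near_zero [CompleteSpace E] (hT : IsSemigroup T) :
    ∃ δ : ℝ≥0, 0 < δ ∧ ∃ C : ℝ, 1 ≤ C ∧ ∀ t ≤ δ, ‖T t‖ ≤ C := by
  by_contra! hcon
  have h : ∀ n : ℕ, ∃ t : ℝ≥0, t ≤ ((n : ℝ≥0) + 1)⁻¹ ∧ (n : ℝ) + 1 < ‖T t‖ := fun n =>
    hcon _ (by positivity) _ (by linarith [(Nat.cast_nonneg n : (0 : ℝ) ≤ n)])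
  choose t ht1 ht2 using h
  have ht0 : Tendsto t atTop (𝓝 0) := by
    rw [← NNReal.tendsto_coe]
    refine squeeze_zero (fun n => (t n).2) (fun n => ?_)
      (tendsto_one_div_add_atTop_nhds_zero_nat (𝕜 := ℝ))
    rw [one_div]
    exact_mod_cast ht1 n
  obtain ⟨C, hC⟩ := banach_steinhaus (g := fun n => T (t n)) fun x => by
    have h1 := ((hT.tendsto x).comp ht0).norm
    obtain ⟨C, hC⟩ := h1.bddAbove_range
    exact ⟨C, fun n => hC ⟨n, rfl⟩⟩
  obtain ⟨n, hn⟩ := exists_nat_gt C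
  linarith [hC n, ht2 n]

theorem exists_norm_le [CompleteSpace E] (hT : IsSemigroup T) (t₀ : ℝ≥0) :
    ∃ C : ℝ, ∀ t ≤ t₀, ‖T t‖ ≤ C := by
  obtain ⟨δ, hδ, C, hC1, hC⟩ := hT.exists_norm_le_near_zero
  have h : ∀ n : ℕ, ∀ t ≤ n * δ, ‖T t‖ ≤ C ^ (n + 1) := by
    intro n
    induction n with
    | zero =>
      intro t ht
      rw [pow_succ, pow_zero, one_mul]
      exact hC t (ht.trans (by simp))
    | succ n ih =>
      intro t ht
      rcases le_total t δ with h | h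
      · exact (hC t h).trans (le_self_pow₀ hC1 (by omega))
      · have e : t = δ + (t - δ) := (add_tsub_cancel_of_le h).symm
        have h2 := ih (t - δ) (by
          rw [tsub_le_iff_right]; push_cast at ht; linarith)
        refine ContinuousLinearMap.opNorm_le_bound _ (by positivity) fun x => ?_
        rw [e, hT.add, pow_succ', mul_assoc]
        refine ((T δ).le_of_opNorm_le (hC δ le_rfl) _).trans ?_
        gcongr
        exact (T (t - δ)).le_of_opNorm_le h2 x
  obtain ⟨n, hn⟩ := exists_nat_ge (t₀ / δ)
  refine ⟨C ^ (n + 1), fun t ht => h n t (ht.trans ?_)⟩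
  rwa [div_le_iff₀ hδ] at hn

/-- Two times differ by applying the semigroup at the smaller one, where its norm is bounded, to an
increment that starts at time 0. -/
theorem continuous_apply [CompleteSpace E] (hT : IsSemigroup T) (x : E) :
    Continuous fun t => T t x := by
  rw [continuous_iff_continuousAt]
  intro s
  obtain ⟨C, hC⟩ := hT.exists_norm_le (s + 1)
  have hb : ∀ t ≤ s + 1, ‖T t x - T s x‖ ≤ C * ‖T (max t s - min t s) x - x‖ := by
    intro t ht
    have e : ∀ u v : ℝ≥0, u ≤ v → u ≤ s + 1 → ‖T v x - T u x‖ ≤ C * ‖T (v - u) x - x‖ := by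
      intro u v huv hu
      have : T v x = T u (T (v - u) x) := by rw [← hT.add, add_tsub_cancel_of_le huv]
      rw [this, ← map_sub]
      exact (T u).le_of_opNorm_le (hC u hu) _
    rcases le_total t s with h | h
    · rw [max_eq_right h, min_eq_left h, norm_sub_rev]; exact e t s h ht
    · rw [max_eq_left h, min_eq_right h]; exact e s t h (by simp)
  rw [ContinuousAt, tendsto_iff_norm_sub_tendsto_zero]
  have hd : Tendsto (fun t : ℝ≥0 => max t s - min t s) (𝓝 s) (𝓝 0) := by
    have : Continuous fun t : ℝ≥0 => max t s - min t s := by fun_prop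
    simpa using this.tendsto s
  have h1 : Tendsto (fun t : ℝ≥0 => C * ‖T (max t s - min t s) x - x‖) (𝓝 s) (𝓝 0) := by
    have := (((hT.tendsto x).comp hd).sub_const x).norm.const_mul C
    simpa using this
  refine squeeze_zero' (Eventually.of_forall fun _ => norm_nonneg _) ?_ h1
  filter_upwards [Iic_mem_nhds (show s < s + 1 by simp)] with t ht using hb t ht

theorem isGenerator_apply (hT : IsSemigroup T) {x y : E} (h : IsGenerator T x y) (s : ℝ≥0) :
    IsGenerator T (T s x) (T s y) := by
  have h1 := ((T s).continuous.tendsto y).comp h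
  refine h1.congr fun t => ?_
  simp only [Function.comp, map_smul, map_sub]
  rw [← hT.add, ← hT.add, add_comm]

theorem hasDerivWithinAt (hT : IsSemigroup T) {x y : E} (h : IsGenerator T x y) {s : ℝ}
    (hs : 0 ≤ s) :
    HasDerivWithinAt (fun r : ℝ => T r.toNNReal x) (T s.toNNReal y) (Set.Ici s) s := by
  rw [← hasDerivWithinAt_Ioi_iff_Ici, hasDerivWithinAt_iff_tendsto_slope' Set.self_notMem_Ioi]
  have h1 : Tendsto (fun r : ℝ => (r - s).toNNReal) (𝓝[>] s) (𝓝[>] 0) := by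
    refine tendsto_nhdsWithin_iff.2 ⟨?_, ?_⟩
    · have : Continuous fun r : ℝ => (r - s).toNNReal := by fun_prop
      have h2 := this.tendsto s
      simp only [sub_self, Real.toNNReal_zero] at h2
      exact h2.mono_left nhdsWithin_le_nhds
    · filter_upwards [self_mem_nhdsWithin] with r hr
      exact Real.toNNReal_pos.2 (sub_pos.2 hr)
  refine (((T s.toNNReal).continuous.tendsto y).comp (h.comp h1)).congr' ?_
  filter_upwards [self_mem_nhdsWithin] with r hr
  have hr : s < r := hr
  have e : r.toNNReal = s.toNNReal + (r - s).toNNReal := by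
    rw [← Real.toNNReal_add hs (sub_nonneg.2 hr.le)]; congr 1; ring
  simp only [Function.comp, map_smul, map_sub, slope, vsub_eq_sub]
  rw [e, hT.add, Real.coe_toNNReal _ (sub_nonneg.2 hr.le)]

/-- A semigroup is determined by its generator. -/
theorem eq_of_isGenerator [CompleteSpace E] (hP : IsSemigroup P) (hT : IsSemigroup T)
    (hc : ∀ t x, ‖T t x‖ ≤ ‖x‖) (hgen : ∀ x y, IsGenerator P x y → IsGenerator T x y)
    (hdense : Dense {x | ∃ y, IsGenerator P x y}) (t : ℝ≥0) (x : E) : P t x = T t x := by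
  have key : ∀ x ∈ {x | ∃ y, IsGenerator P x y}, P t x = T t x := by
    rintro x ⟨y, hy⟩
    set w : ℝ → E := fun r => P r.toNNReal x - T r.toNNReal x with hw
    have hwc : Continuous w := ((hP.continuous_apply x).comp continuous_real_toNNReal).sub
      ((hT.continuous_apply x).comp continuous_real_toNNReal)
    -- The difference w at time s + h is (P_h - T_h) u plus T_h w(s), with u = P_s x. As T_h is a
    -- contraction and both semigroups have the same derivative at u, the right slope of the norm of
    -- w is at most 0 in the limit. Only T needs to be contractive.
    have hslope : ∀ s ∈ Set.Ico (0 : ℝ) t, ∀ r, (0 : ℝ) < r →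
        ∃ᶠ z in 𝓝[>] s, slope (fun r => ‖w r‖) s z < r := by
      intro s hs r hr
      set u := P s.toNNReal x with hu
      have h1 := hP.isGenerator_apply hy s.toNNReal
      have h2 := hgen _ _ h1
      have h3 : Tendsto (fun h : ℝ≥0 => ‖(h : ℝ)⁻¹ • (P h u - T h u)‖) (𝓝[>] 0) (𝓝 0) := by
        have h4 := (Tendsto.sub h1 h2).norm
        rw [sub_self, norm_zero] at h4
        refine h4.congr fun h => ?_
        rw [← smul_sub, sub_sub_sub_cancel_right]
      have hshift : Tendsto (fun r : ℝ => (r - s).toNNReal) (𝓝[>] s) (𝓝[>] 0) := by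
        refine tendsto_nhdsWithin_iff.2 ⟨?_, ?_⟩
        · have : Continuous fun r : ℝ => (r - s).toNNReal := by fun_prop
          have h2 := this.tendsto s
          simp only [sub_self, Real.toNNReal_zero] at h2
          exact h2.mono_left nhdsWithin_le_nhds
        · filter_upwards [self_mem_nhdsWithin] with r hr
          exact Real.toNNReal_pos.2 (sub_pos.2 hr)
      have h5 := (h3.comp hshift).eventually (Iio_mem_nhds hr)
      refine Eventually.frequently ?_
      filter_upwards [h5, self_mem_nhdsWithin] with z hz hz1
      have hz1 : s < z := hz1
      have hzs := sub_pos.2 hz1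
      have e : z.toNNReal = (z - s).toNNReal + s.toNNReal := by
        rw [← Real.toNNReal_add hzs.le hs.1]; congr 1; ring
      refine lt_of_le_of_lt ?_ hz
      simp only [Function.comp, slope, vsub_eq_sub, smul_eq_mul, norm_smul, norm_inv]
      rw [Real.coe_toNNReal _ hzs.le, Real.norm_of_nonneg hzs.le]
      refine mul_le_mul_of_nonneg_left ?_ (by positivity)
      have e2 : w z = (P (z - s).toNNReal u - T (z - s).toNNReal u) +
          T (z - s).toNNReal (w s) := by
        simp only [hw, e, hP.add, hT.add, map_sub, ← hu]
        abel
      rw [e2]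
      have := norm_add_le (P (z - s).toNNReal u - T (z - s).toNNReal u)
        (T (z - s).toNNReal (w s))
      linarith [hc (z - s).toNNReal (w s)]
    -- The comparison principle needs a strict inequality between slopes; the slack η is removed
    -- afterwards.
    have hbound : ∀ η : ℝ, 0 < η → ‖w t‖ ≤ η * t := by
      intro η hη
      refine image_le_of_liminf_slope_right_lt_deriv_boundary' (f := fun r => ‖w r‖)
        (f' := fun _ => 0) (a := 0) (b := t) (B := fun r => η * r) (B' := fun _ => η)
        hwc.norm.continuousOn hslope ?_ (by fun_prop) (fun s _ => ?_) (fun _ _ _ => hη)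
        ⟨t.2, le_rfl⟩
      · simp [hw, hP.zero, hT.zero]
      · simpa using ((hasDerivAt_id s).const_mul η).hasDerivWithinAt
    have h0 : ‖w t‖ ≤ 0 := by
      have h1 : Tendsto (fun η : ℝ => η * t) (𝓝[>] 0) (𝓝 0) := by
        have : Continuous fun η : ℝ => η * (t : ℝ) := by fun_prop
        have h2 := this.tendsto 0
        rw [zero_mul] at h2
        exact h2.mono_left nhdsWithin_le_nhds
      exact ge_of_tendsto h1 (eventually_of_mem self_mem_nhdsWithin fun η hη => hbound η hη)
    have h2 := norm_le_zero_iff.1 h0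
    simp only [hw, Real.toNNReal_coe] at h2
    exact sub_eq_zero.1 h2
  exact congrFun ((P t).continuous.ext_on hdense (T t).continuous key) x

end IsSemigroup

/-- Bounded approximations of an operator given on a subspace that generate contraction
semigroups and approximate the operator along their own orbits. -/
structure Approximates (A : ℕ → E →L[ℝ] E) (S : Submodule ℝ E) (𝓛 : E → E) : Prop where
  contraction : ∀ M t x, 0 ≤ t → ‖flow (A M) t x‖ ≤ ‖x‖
  dense : Dense (S : Set E)
  eventually_eq : ∀ x ∈ S, ∀ᶠ M in atTop, A M x = 𝓛 x
  mem : ∀ x ∈ S, 𝓛 x ∈ S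
  error : ∀ x ∈ S, ∃ e : ℕ → ℝ, Tendsto e atTop (𝓝 0) ∧ ∀ᶠ M in atTop, ∀ t, 0 ≤ t →
    flow (A M) t x ∈ S ∧ ∀ M' ≥ M, ‖(A M' - A M) (flow (A M) t x)‖ ≤ e M

/-! ### Limits of contraction semigroups and the closure of their common core -/

namespace Approximates

variable {A : ℕ → E →L[ℝ] E} {S : Submodule ℝ E} {𝓛 : E → E}

theorem eventually_eq_eq (h : Approximates A S 𝓛) {x : E} (hx : x ∈ S) :
    ∀ᶠ M in atTop, A M x = 𝓛 x ∧ A M (A M x) = 𝓛 (𝓛 x) := by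
  filter_upwards [h.eventually_eq x hx, h.eventually_eq (𝓛 x) (h.mem x hx)] with M h1 h2
  exact ⟨h1, by rw [h1, h2]⟩

variable [CompleteSpace E]

/-- Variation of constants: only the approximation M' has to be contractive, while the difference of
generators is evaluated along the orbit of approximation M. -/
theorem norm_flow_sub_flow_le (h : Approximates A S 𝓛) {M M' : ℕ} {x : E} {e t : ℝ} (ht : 0 ≤ t)
    (he : ∀ s, 0 ≤ s → ‖(A M' - A M) (flow (A M) s x)‖ ≤ e) :
    ‖flow (A M) t x - flow (A M') t x‖ ≤ e * t := by
  have h1 := norm_image_sub_le_of_norm_deriv_le_segment'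
    (f := fun r => flow (A M') (t - r) (flow (A M) r x)) (a := 0) (b := t) (C := e)
    (fun s _ => (hasDerivAt_flow_flow (A M') (A M) x t s).hasDerivWithinAt) (fun s hs => ?_)
    t ⟨ht, le_rfl⟩
  · simpa [flow_zero] using h1
  · refine (h.contraction _ _ _ (sub_nonneg.2 hs.2.le)).trans ?_
    rw [← neg_sub, neg_apply, norm_neg]
    exact he s hs.1

/-- Density reduces to a core element z. There one late index N controls all larger M at once,
because the error bound is uniform in M' ≥ M. -/
theorem cauchySeq (h : Approximates A S 𝓛) {t : ℝ} (ht : 0 ≤ t) (x : E) :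
    CauchySeq fun M => flow (A M) t x := by
  rw [Metric.cauchySeq_iff']
  intro ε hε
  obtain ⟨z, hzS, hz⟩ := Metric.mem_closure_iff.1 (h.dense x) (ε / 4) (by positivity)
  obtain ⟨e, he, hev⟩ := h.error z hzS
  have h1 : Tendsto (fun M => e M * t) atTop (𝓝 0) := by simpa using he.mul_const t
  obtain ⟨N, hN1, hN2⟩ := (hev.and (h1.eventually (Iio_mem_nhds (show 0 < ε / 4 by positivity)))).exists
  refine ⟨N, fun M hM => ?_⟩
  have h2 := h.norm_flow_sub_flow_le ht (x := z) (M := N) (M' := M) fun s hs => (hN1 s hs).2 M hM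
  have hN2 : e N * t < ε / 4 := hN2
  have h3 := h.contraction M t (x - z) ht
  have h4 := h.contraction N t (x - z) ht
  rw [map_sub] at h3 h4
  rw [dist_eq_norm] at hz ⊢
  have e1 : flow (A M) t x - flow (A N) t x = (flow (A M) t x - flow (A M) t z) -
      (flow (A N) t z - flow (A M) t z) - (flow (A N) t x - flow (A N) t z) := by abel
  rw [e1]
  refine (norm_sub_le _ _).trans_lt ?_
  have h5 := norm_sub_le (flow (A M) t x - flow (A M) t z) (flow (A N) t z - flow (A M) t z)
  linarith

/-- The limit of the approximating semigroups. -/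
def limit (h : Approximates A S 𝓛) (t : ℝ≥0) : E →L[ℝ] E :=
  LinearMap.mkContinuous
    { toFun := fun x => (cauchySeq_tendsto_of_complete (h.cauchySeq t.2 x)).choose
      map_add' := fun x y => by
        refine tendsto_nhds_unique
          (cauchySeq_tendsto_of_complete (h.cauchySeq t.2 (x + y))).choose_spec ?_
        simp only [map_add]
        exact (cauchySeq_tendsto_of_complete (h.cauchySeq t.2 x)).choose_spec.add
          (cauchySeq_tendsto_of_complete (h.cauchySeq t.2 y)).choose_spec
      map_smul' := fun r x => by
        refine tendsto_nhds_unique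
          (cauchySeq_tendsto_of_complete (h.cauchySeq t.2 (r • x))).choose_spec ?_
        simp only [map_smul]
        exact (cauchySeq_tendsto_of_complete (h.cauchySeq t.2 x)).choose_spec.const_smul r }
    1 fun x => by
      rw [one_mul]
      exact le_of_tendsto (cauchySeq_tendsto_of_complete (h.cauchySeq t.2 x)).choose_spec.norm
        (Eventually.of_forall fun M => h.contraction M t x t.2)

theorem tendsto_limit (h : Approximates A S 𝓛) (t : ℝ≥0) (x : E) :
    Tendsto (fun M => flow (A M) t x) atTop (𝓝 (h.limit t x)) :=
  (cauchySeq_tendsto_of_complete (h.cauchySeq t.2 x)).choose_spec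

theorem norm_limit_le (h : Approximates A S 𝓛) (t : ℝ≥0) (x : E) : ‖h.limit t x‖ ≤ ‖x‖ :=
  le_of_tendsto (h.tendsto_limit t x).norm
    (Eventually.of_forall fun M => h.contraction M t x t.2)

theorem tendsto_flow_of_tendsto (h : Approximates A S 𝓛) (t : ℝ≥0) {x : E} {u : ℕ → E}
    (hu : Tendsto u atTop (𝓝 x)) :
    Tendsto (fun M => flow (A M) t (u M)) atTop (𝓝 (h.limit t x)) := by
  have h1 : Tendsto (fun M => flow (A M) t (u M - x)) atTop (𝓝 0) := by
    refine squeeze_zero_norm (fun M => h.contraction M t _ t.2) ?_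
    simpa using (hu.sub_const x).norm
  simpa using h1.add (h.tendsto_limit t x)

theorem norm_flow_sub_self_le (h : Approximates A S 𝓛) (M : ℕ) (x : E) {t : ℝ} (ht : 0 ≤ t) :
    ‖flow (A M) t x - x‖ ≤ ‖A M x‖ * t := by
  have h1 := norm_image_sub_le_of_norm_deriv_le_segment'
    (f := fun r => flow (A M) r x) (a := 0) (b := t) (C := ‖A M x‖)
    (fun s _ => (hasDerivAt_flow (A M) x s).hasDerivWithinAt) (fun s hs => ?_) t ⟨ht, le_rfl⟩
  · simpa [flow_zero] using h1
  · rw [flow_apply_comm (Commute.refl _)]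
    exact h.contraction _ _ _ hs.1

/-- A second order Taylor bound. It is uniform in M on the core, where A M and its square eventually
agree with 𝓛 and its square, and so identifies the generator of the limit there. -/
theorem norm_flow_sub_self_sub_le (h : Approximates A S 𝓛) (M : ℕ) (x : E) {t : ℝ} (ht : 0 ≤ t) :
    ‖flow (A M) t x - x - t • A M x‖ ≤ ‖A M (A M x)‖ * t * t := by
  have h1 := norm_image_sub_le_of_norm_deriv_le_segment'
    (f := fun r => flow (A M) r x - r • A M x) (a := 0) (b := t) (C := ‖A M (A M x)‖ * t)
    (f' := fun r => A M (flow (A M) r x) - (1 : ℝ) • A M x)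
    (fun s _ => ((hasDerivAt_flow (A M) x s).sub
      ((hasDerivAt_id s).smul_const (A M x))).hasDerivWithinAt) (fun s hs => ?_) t ⟨ht, le_rfl⟩
  · rw [flow_zero, zero_smul, sub_zero, sub_zero] at h1
    rw [sub_right_comm]
    exact h1
  · rw [flow_apply_comm (Commute.refl _), one_smul]
    refine (h.norm_flow_sub_self_le M (A M x) hs.1).trans ?_
    have := hs.2.le
    gcongr

theorem norm_limit_sub_le (h : Approximates A S 𝓛) {x : E} (hx : x ∈ S) (t : ℝ≥0) :
    ‖h.limit t x - x‖ ≤ ‖𝓛 x‖ * t := by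
  refine le_of_tendsto ((h.tendsto_limit t x).sub_const x).norm ?_
  filter_upwards [h.eventually_eq x hx] with M hM
  rw [← hM]
  exact h.norm_flow_sub_self_le M x t.2

theorem norm_limit_sub_sub_le (h : Approximates A S 𝓛) {x : E} (hx : x ∈ S) (t : ℝ≥0) :
    ‖h.limit t x - x - (t : ℝ) • 𝓛 x‖ ≤ ‖𝓛 (𝓛 x)‖ * t * t := by
  refine le_of_tendsto (((h.tendsto_limit t x).sub_const x).sub_const _).norm ?_
  filter_upwards [h.eventually_eq_eq hx] with M hM
  have h1 := h.norm_flow_sub_self_sub_le M x t.2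
  rwa [hM.2, hM.1] at h1

theorem isSemigroup (h : Approximates A S 𝓛) : IsSemigroup h.limit where
  zero := by
    ext1 x
    refine tendsto_nhds_unique (h.tendsto_limit 0 x) ?_
    simp [flow_zero]
  add s t x := by
    refine tendsto_nhds_unique (h.tendsto_limit (s + t) x) ?_
    have := h.tendsto_flow_of_tendsto s (h.tendsto_limit t x)
    simpa only [NNReal.coe_add, flow_add_apply] using this
  tendsto x := by
    rw [Metric.tendsto_nhds]
    intro ε hε
    obtain ⟨z, hzS, hz⟩ := Metric.mem_closure_iff.1 (h.dense x) (ε / 3) (by positivity)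
    have h1 : Tendsto (fun t : ℝ≥0 => ‖𝓛 z‖ * t) (𝓝 0) (𝓝 0) := by
      have : Continuous fun t : ℝ≥0 => ‖𝓛 z‖ * t := by fun_prop
      simpa using this.tendsto 0
    filter_upwards [h1.eventually (Iio_mem_nhds (show 0 < ε / 3 by positivity))] with t ht
    have ht : ‖𝓛 z‖ * t < ε / 3 := ht
    rw [dist_eq_norm] at hz ⊢
    have h2 := h.norm_limit_sub_le hzS t
    have h3 := h.norm_limit_le t (x - z)
    rw [map_sub] at h3
    have e1 : h.limit t x - x = (h.limit t x - h.limit t z) + (h.limit t z - z) - (x - z) := by abel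
    rw [e1]
    have h4 := norm_sub_le ((h.limit t x - h.limit t z) + (h.limit t z - z)) (x - z)
    have h5 := norm_add_le (h.limit t x - h.limit t z) (h.limit t z - z)
    linarith

theorem isGenerator (h : Approximates A S 𝓛) {x : E} (hx : x ∈ S) :
    IsGenerator h.limit x (𝓛 x) := by
  rw [IsGenerator, tendsto_iff_norm_sub_tendsto_zero]
  have h1 : Tendsto (fun t : ℝ≥0 => ‖𝓛 (𝓛 x)‖ * t) (𝓝[>] 0) (𝓝 0) := by
    have : Continuous fun t : ℝ≥0 => ‖𝓛 (𝓛 x)‖ * t := by fun_prop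
    have h2 := this.tendsto 0
    simp only [NNReal.coe_zero, mul_zero] at h2
    exact h2.mono_left nhdsWithin_le_nhds
  refine squeeze_zero' (Eventually.of_forall fun _ => norm_nonneg _) ?_ h1
  filter_upwards [self_mem_nhdsWithin] with t ht
  have ht : (0 : ℝ) < t := NNReal.coe_pos.2 ht
  have e : (t : ℝ)⁻¹ • (h.limit t x - x) - 𝓛 x =
      (t : ℝ)⁻¹ • (h.limit t x - x - (t : ℝ) • 𝓛 x) := by
    rw [smul_sub _ (h.limit t x - x), inv_smul_smul₀ ht.ne']
  rw [e, norm_smul, norm_inv, Real.norm_of_nonneg ht.le, inv_mul_le_iff₀ ht]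
  linarith [h.norm_limit_sub_sub_le hx t]

/-- The graph of the operator on the subspace. -/
def graph (h : Approximates A S 𝓛) : Submodule ℝ (E × E) where
  carrier := {p | p.1 ∈ S ∧ p.2 = 𝓛 p.1}
  add_mem' := by
    rintro ⟨x, z⟩ ⟨x', z'⟩ ⟨hx, hz⟩ ⟨hx', hz'⟩
    obtain rfl : z = 𝓛 x := hz
    obtain rfl : z' = 𝓛 x' := hz'
    refine ⟨S.add_mem hx hx', ?_⟩
    obtain ⟨M, h1, h2, h3⟩ := ((h.eventually_eq x hx).and ((h.eventually_eq x' hx').and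
      (h.eventually_eq (x + x') (S.add_mem hx hx')))).exists
    change 𝓛 x + 𝓛 x' = 𝓛 (x + x')
    rw [← h1, ← h2, ← h3, map_add]
  zero_mem' := by
    refine ⟨S.zero_mem, ?_⟩
    obtain ⟨M, h1⟩ := (h.eventually_eq 0 S.zero_mem).exists
    change 0 = 𝓛 0
    rw [← h1, map_zero]
  smul_mem' := by
    rintro r ⟨x, z⟩ ⟨hx, hz⟩
    obtain rfl : z = 𝓛 x := hz
    refine ⟨S.smul_mem r hx, ?_⟩
    obtain ⟨M, h1, h2⟩ := ((h.eventually_eq x hx).and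
      (h.eventually_eq (r • x) (S.smul_mem r hx))).exists
    change r • 𝓛 x = 𝓛 (r • x)
    rw [← h1, ← h2, map_smul]

theorem limit_mem_closure (h : Approximates A S 𝓛) {x : E} (hx : x ∈ S) (t : ℝ≥0) :
    (h.limit t x, h.limit t (𝓛 x)) ∈ h.graph.topologicalClosure := by
  obtain ⟨e, he, hev⟩ := h.error x hx
  have h1 : Tendsto (fun M => 𝓛 (flow (A M) t x)) atTop (𝓝 (h.limit t (𝓛 x))) := by
    have h2 : Tendsto (fun M => 𝓛 (flow (A M) t x) - flow (A M) t (𝓛 x)) atTop (𝓝 0) := by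
      refine squeeze_zero_norm' ?_ he
      filter_upwards [hev, h.eventually_eq x hx] with M hM hM2
      obtain ⟨hS, hb⟩ := hM t t.2
      -- The orbit point is again in the core, so a later A M' computes 𝓛 at it; the error bound
      -- compares A M' with A M, and A M commutes with its own flow.
      obtain ⟨M', hM', hge⟩ := ((h.eventually_eq _ hS).and (eventually_ge_atTop M)).exists
      have := hb M' hge
      rwa [sub_apply, hM', flow_apply_comm (Commute.refl _), hM2] at this
    simpa using h2.add (h.tendsto_limit t (𝓛 x))
  refine mem_closure_of_tendsto ((h.tendsto_limit t x).prodMk_nhds h1) ?_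
  filter_upwards [hev] with M hM
  exact ⟨(hM t t.2).1, rfl⟩

theorem mem_closure_of_isGenerator (h : Approximates A S 𝓛) {x y : E}
    (hxy : IsGenerator h.limit x y) : (x, y) ∈ h.graph.topologicalClosure := by
  set T : ℝ → E → E := fun s x => h.limit s.toNNReal x with hT
  have hcont : ∀ x, Continuous fun s => T s x := fun x =>
    (h.isSemigroup.continuous_apply x).comp continuous_real_toNNReal
  set I : ℝ → E → E := fun a x => a⁻¹ • ∫ s in (0 : ℝ)..a, T s x with hI
  have hclosed : IsClosed (h.graph.topologicalClosure : Set (E × E)) :=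
    h.graph.isClosed_topologicalClosure
  -- Over [0, a] the pairs (T_s z, T_s 𝓛 z) lie in the closed graph. So does their average, and the
  -- fundamental theorem of calculus evaluates its second component.
  have hcore : ∀ z ∈ S, ∀ a : ℝ, 0 < a →
      (I a z, a⁻¹ • (T a z - z)) ∈ h.graph.topologicalClosure := by
    intro z hz a ha
    have hc : Continuous fun s => (T s z, T s (𝓛 z)) := (hcont z).prodMk (hcont _)
    have h1 := (h.graph.topologicalClosure.restrictScalars ℝ).convex.set_average_mem
      (μ := MeasureTheory.volume) (t := Set.Ioc 0 a) (f := fun s => (T s z, T s (𝓛 z))) hclosed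
      (by simp [ha]) (by simp) (Eventually.of_forall fun s => h.limit_mem_closure hz _)
      (hc.integrableOn_Ioc)
    have e : ⨍ s in Set.Ioc 0 a, (T s z, T s (𝓛 z)) = (I a z, a⁻¹ • (T a z - z)) := by
      rw [MeasureTheory.average_pair (hcont z).integrableOn_Ioc (hcont _).integrableOn_Ioc]
      have e1 : ∀ w, ⨍ s in Set.Ioc 0 a, T s w = a⁻¹ • ∫ s in (0 : ℝ)..a, T s w := by
        intro w
        rw [MeasureTheory.setAverage_eq, intervalIntegral.integral_of_le ha.le]
        simp [ha.le]
      rw [e1, e1]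
      congr 2
      rw [intervalIntegral.integral_eq_sub_of_hasDeriv_right (f := fun s => T s z)
        (hcont z).continuousOn (fun s hs => ?_) ((hcont _).intervalIntegrable _ _)]
      · simp [hT, h.isSemigroup.zero]
      · rw [min_eq_left ha.le] at hs
        exact (h.isSemigroup.hasDerivWithinAt (h.isGenerator hz) hs.1.le).mono
          Set.Ioi_subset_Ici_self
    rw [← e]
    exact h1
  -- For fixed a > 0 both components depend continuously on the starting point, so the density of
  -- the core removes the restriction to it.
  have hall : ∀ a : ℝ, 0 < a → (I a x, a⁻¹ • (T a x - x)) ∈ h.graph.topologicalClosure := by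
    intro a ha
    have hIlip : ∀ z, ‖I a z - I a x‖ ≤ ‖z - x‖ := by
      intro z
      simp only [hI]
      rw [← smul_sub, ← intervalIntegral.integral_sub ((hcont z).intervalIntegrable _ _)
        ((hcont x).intervalIntegrable _ _), norm_smul, norm_inv, Real.norm_of_nonneg ha.le,
        inv_mul_le_iff₀ ha]
      have := intervalIntegral.norm_integral_le_of_norm_le_const (a := 0) (b := a)
        (f := fun s => T s z - T s x) (C := ‖z - x‖) fun s _ => by
          simp only [hT]; rw [← map_sub]; exact h.norm_limit_le _ _
      rw [sub_zero, abs_of_pos ha] at this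
      linarith
    obtain ⟨u, huS, hu⟩ := mem_closure_iff_seq_limit.1 (h.dense x)
    have t1 : Tendsto (fun n => I a (u n)) atTop (𝓝 (I a x)) := by
      rw [tendsto_iff_norm_sub_tendsto_zero]
      exact squeeze_zero (fun _ => norm_nonneg _) (fun n => hIlip (u n))
        (tendsto_iff_norm_sub_tendsto_zero.1 hu)
    have t2 : Tendsto (fun n => a⁻¹ • (T a (u n) - u n)) atTop (𝓝 (a⁻¹ • (T a x - x))) :=
      ((((h.limit a.toNNReal).continuous.tendsto x).comp hu).sub hu).const_smul _
    exact hclosed.mem_of_tendsto (t1.prodMk_nhds t2)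
      (Eventually.of_forall fun n => hcore (u n) (huS n) a ha)
  have t0 : Tendsto (fun t : ℝ≥0 => (t : ℝ)) (𝓝[>] 0) (𝓝[>] 0) := by
    refine tendsto_nhdsWithin_iff.2 ⟨?_, ?_⟩
    · exact (NNReal.continuous_coe.tendsto 0).mono_left nhdsWithin_le_nhds
    · filter_upwards [self_mem_nhdsWithin] with r hr
      exact NNReal.coe_pos.2 hr
  have tI : Tendsto (fun a : ℝ => I a x) (𝓝[>] 0) (𝓝 x) := by
    have hd : HasDerivAt (fun a => ∫ s in (0 : ℝ)..a, T s x) (T 0 x) 0 :=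
      intervalIntegral.integral_hasDerivAt_right ((hcont x).intervalIntegrable _ _)
        ((hcont x).stronglyMeasurableAtFilter _ _) (hcont x).continuousAt
    have h1 := (hasDerivAt_iff_tendsto_slope.1 hd).mono_left
      (nhdsWithin_mono 0 (fun a (ha : 0 < a) => ha.ne') : 𝓝[>] (0 : ℝ) ≤ 𝓝[≠] 0)
    have e0 : T 0 x = x := by simp [hT, h.isSemigroup.zero]
    rw [e0] at h1
    refine h1.congr fun a => ?_
    simp [slope, hI]
  refine hclosed.mem_of_tendsto ((tI.comp t0).prodMk_nhds hxy) ?_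
  filter_upwards [self_mem_nhdsWithin] with t ht
  have := hall t (NNReal.coe_pos.2 ht)
  simp only [hT, Real.toNNReal_coe] at this
  exact this

theorem isGenerator_of_mem_closure (h : Approximates A S 𝓛) {x y : E}
    (hxy : (x, y) ∈ h.graph.topologicalClosure) : IsGenerator h.limit x y := by
  -- For core elements z the orbit minus its affine approximation has derivative T_s(𝓛 z - y) + (T_s
  -- y - y). The resulting inequality is a closed condition on the pair (z, 𝓛 z), hence survives in
  -- the closure, where the term with 𝓛 z - y drops out.
  have key : ∀ (t : ℝ≥0) (η : ℝ), (∀ s ≤ t, ‖h.limit s y - y‖ ≤ η) →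
      ‖h.limit t x - x - (t : ℝ) • y‖ ≤ η * t := by
    intro t η hη
    have hcore : ∀ p ∈ h.graph, ‖h.limit t p.1 - p.1 - (t : ℝ) • y‖ ≤ (‖p.2 - y‖ + η) * t := by
      rintro ⟨z, z'⟩ ⟨hz, hz'⟩
      obtain rfl : z' = 𝓛 z := hz'
      have h1 := norm_image_sub_le_of_norm_deriv_right_le_segment
        (f := fun r : ℝ => h.limit r.toNNReal z - r • y) (a := 0) (b := t)
        (C := ‖𝓛 z - y‖ + η) (f' := fun r => h.limit r.toNNReal (𝓛 z) - (1 : ℝ) • y)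
        (((h.isSemigroup.continuous_apply z).comp continuous_real_toNNReal).sub
          (continuous_id.smul continuous_const)).continuousOn
        (fun s hs => (h.isSemigroup.hasDerivWithinAt (h.isGenerator hz) hs.1).sub
          ((hasDerivAt_id s).smul_const y).hasDerivWithinAt) (fun s hs => ?_) t ⟨t.2, le_rfl⟩
      · simp only [Real.toNNReal_coe, Real.toNNReal_zero, h.isSemigroup.zero, zero_smul,
          sub_zero] at h1
        rw [sub_right_comm]
        exact h1
      · have e : h.limit s.toNNReal (𝓛 z) - (1 : ℝ) • y =
            h.limit s.toNNReal (𝓛 z - y) + (h.limit s.toNNReal y - y) := by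
          rw [map_sub, one_smul]; abel
        rw [e]
        refine (norm_add_le _ _).trans (add_le_add (h.norm_limit_le _ _) (hη _ ?_))
        rw [Real.toNNReal_le_iff_le_coe]
        exact hs.2.le
    have hcl : IsClosed {p : E × E |
        ‖h.limit t p.1 - p.1 - (t : ℝ) • y‖ ≤ (‖p.2 - y‖ + η) * t} := by
      refine isClosed_le ?_ ?_
      · exact (((h.limit t).continuous.comp continuous_fst).sub continuous_fst).sub
          continuous_const |>.norm
      · fun_prop
    have hsub : (h.graph : Set (E × E)) ⊆ {p : E × E |
        ‖h.limit t p.1 - p.1 - (t : ℝ) • y‖ ≤ (‖p.2 - y‖ + η) * t} := fun p hp => hcore p hp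
    have h9 := Set.mem_ofPred.1 (closure_minimal hsub hcl hxy)
    simpa only [sub_self, norm_zero, zero_add] using h9
  rw [IsGenerator, tendsto_iff_norm_sub_tendsto_zero, Metric.tendsto_nhds]
  intro ε hε
  have h1 := (Metric.tendsto_nhds.1 (h.isSemigroup.tendsto y)) (ε / 2) (by positivity)
  obtain ⟨δ, hδ, hball⟩ := Metric.eventually_nhds_iff.1 h1
  filter_upwards [self_mem_nhdsWithin, mem_nhdsWithin_of_mem_nhds (Metric.ball_mem_nhds 0 hδ)]
    with t ht htδ
  have ht : (0 : ℝ) < t := NNReal.coe_pos.2 ht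
  have h2 := key t (ε / 2) fun s hs => by
    rw [← dist_eq_norm]
    refine (hball ?_).le
    refine lt_of_le_of_lt ?_ htδ
    simp only [NNReal.dist_eq, NNReal.coe_zero, sub_zero, NNReal.abs_eq]
    exact_mod_cast hs
  have e : (t : ℝ)⁻¹ • (h.limit t x - x) - y =
      (t : ℝ)⁻¹ • (h.limit t x - x - (t : ℝ) • y) := by
    rw [smul_sub _ (h.limit t x - x), inv_smul_smul₀ ht.ne']
  rw [dist_zero_right, norm_norm, e, norm_smul, norm_inv, Real.norm_of_nonneg ht.le]
  calc (t : ℝ)⁻¹ * ‖h.limit t x - x - (t : ℝ) • y‖ ≤ (t : ℝ)⁻¹ * (ε / 2 * t) := by gcongr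
    _ = ε / 2 := by field_simp
    _ < ε := by linarith

theorem isGenerator_iff (h : Approximates A S 𝓛) (x y : E) :
    IsGenerator h.limit x y ↔ (x, y) ∈ h.graph.topologicalClosure :=
  ⟨h.mem_closure_of_isGenerator, h.isGenerator_of_mem_closure⟩

end Approximates

end Semigroups

/-! ### Finite matrices, diagonal weights and finite projections -/

section FiniteMatrices

variable {F : Type*} [NormedAddCommGroup F] [InnerProductSpace ℂ F] (b : HilbertBasis ℕ ℂ F)

/-- The operator with the matrix `g` cut off to indices below `M`. -/
def matOp (M : ℕ) (g : ℕ → ℕ → ℂ) : F →L[ℂ] F :=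
  ∑ n ∈ Finset.range M, ∑ k ∈ Finset.range M, g n k • (innerSL ℂ (b k)).smulRight (b n)

theorem matOp_apply (M : ℕ) (g : ℕ → ℕ → ℂ) (v : F) :
    matOp b M g v = ∑ n ∈ Finset.range M, (∑ k ∈ Finset.range M, g n k * ⟪b k, v⟫_ℂ) • b n := by
  rw [matOp, sum_apply]
  refine Finset.sum_congr rfl fun n _ => ?_
  rw [sum_apply, Finset.sum_smul]
  refine Finset.sum_congr rfl fun k _ => ?_
  rw [smul_apply, ContinuousLinearMap.smulRight_apply, innerSL_apply_apply, smul_smul]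

theorem inner_basis (n k : ℕ) : ⟪b n, b k⟫_ℂ = if n = k then 1 else 0 :=
  (orthonormal_iff_ite.1 b.orthonormal) n k

theorem inner_sum_basis (s : Finset ℕ) (c : ℕ → ℂ) (n : ℕ) :
    ⟪b n, ∑ k ∈ s, c k • b k⟫_ℂ = if n ∈ s then c n else 0 := by
  simp [inner_basis]

theorem inner_matOp (M : ℕ) (g : ℕ → ℕ → ℂ) (v : F) (n : ℕ) :
    ⟪b n, matOp b M g v⟫_ℂ =
      if n < M then ∑ k ∈ Finset.range M, g n k * ⟪b k, v⟫_ℂ else 0 := by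
  rw [matOp_apply, inner_sum_basis]
  simp

theorem inner_matOp_basis (M : ℕ) (g : ℕ → ℕ → ℂ) (n k : ℕ) :
    ⟪b n, matOp b M g (b k)⟫_ℂ = if n < M ∧ k < M then g n k else 0 := by
  rw [inner_matOp]
  by_cases hn : n < M <;> simp [hn, inner_basis]

variable {b} in
theorem vec_ext {u v : F} (h : ∀ n, ⟪b n, u⟫_ℂ = ⟪b n, v⟫_ℂ) : u = v := by
  apply b.repr.injective
  ext n
  rw [b.repr_apply_apply, b.repr_apply_apply, h]

variable {b} in
theorem op_ext {X Y : F →L[ℂ] F} (h : ∀ n k, ⟪b n, X (b k)⟫_ℂ = ⟪b n, Y (b k)⟫_ℂ) : X = Y := by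
  have h1 : ∀ k, X (b k) = Y (b k) := fun k => vec_ext fun n => h n k
  refine ContinuousLinearMap.ext fun v => ?_
  have hv := b.hasSum_repr v
  refine (hv.mapL X).unique ?_
  convert! hv.mapL Y using 1
  ext k
  rw [map_smul, map_smul, h1]

theorem matOp_congr {M : ℕ} {g h : ℕ → ℕ → ℂ} (hgh : ∀ n < M, ∀ k < M, g n k = h n k) :
    matOp b M g = matOp b M h := by
  refine op_ext (b := b) fun n k => ?_
  rw [inner_matOp_basis, inner_matOp_basis]
  split_ifs with hnk
  · exact hgh n hnk.1 k hnk.2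
  · rfl

/-- Inner products with a vector with finitely many coordinates. -/
theorem inner_eq_sum {M : ℕ} {v : F} (hv : ∀ n, M ≤ n → ⟪b n, v⟫_ℂ = 0) (u : F) :
    ⟪u, v⟫_ℂ = ∑ n ∈ Finset.range M, (starRingEnd ℂ) ⟪b n, u⟫_ℂ * ⟪b n, v⟫_ℂ := by
  rw [← b.tsum_inner_mul_inner u v, tsum_eq_sum (s := Finset.range M)]
  · simp only [inner_conj_symm]
  · intro n hn
    rw [hv n (by simpa using hn), mul_zero]

theorem norm_sq_eq_sum {M : ℕ} {v : F} (hv : ∀ n, M ≤ n → ⟪b n, v⟫_ℂ = 0) :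
    ‖v‖ ^ 2 = ∑ n ∈ Finset.range M, ‖⟪b n, v⟫_ℂ‖ ^ 2 := by
  rw [← (hasSum_norm_inner_sq b v).tsum_eq, tsum_eq_sum (s := Finset.range M)]
  intro n hn
  rw [hv n (by simpa using hn), norm_zero]
  simp

theorem norm_matOp_sq (M : ℕ) (g : ℕ → ℕ → ℂ) (v : F) :
    ‖matOp b M g v‖ ^ 2 =
      ∑ n ∈ Finset.range M, ‖∑ k ∈ Finset.range M, g n k * ⟪b k, v⟫_ℂ‖ ^ 2 := by
  rw [norm_sq_eq_sum b (M := M) fun n hn => by rw [inner_matOp, if_neg (not_lt.2 hn)]]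
  refine Finset.sum_congr rfl fun n hn => ?_
  rw [inner_matOp, if_pos (Finset.mem_range.1 hn)]

/-- The diagonal operator with entries `√(w n)`, cut off to indices below `M`. -/
def diagOp (M : ℕ) (w : ℕ → ℝ) : F →L[ℂ] F :=
  matOp b M fun n k => if n = k then ((√(w n) : ℝ) : ℂ) else 0

theorem inner_diagOp (M : ℕ) (w : ℕ → ℝ) (v : F) (n : ℕ) :
    ⟪b n, diagOp b M w v⟫_ℂ = if n < M then ((√(w n) : ℝ) : ℂ) * ⟪b n, v⟫_ℂ else 0 := by
  rw [diagOp, inner_matOp]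
  split_ifs with h
  · simp [h]
  · rfl

theorem norm_diagOp_sq (M : ℕ) {w : ℕ → ℝ} (hw : ∀ n, 0 ≤ w n) (v : F) :
    ‖diagOp b M w v‖ ^ 2 = ∑ n ∈ Finset.range M, w n * ‖⟪b n, v⟫_ℂ‖ ^ 2 := by
  rw [norm_sq_eq_sum b (M := M) fun n hn => by rw [inner_diagOp, if_neg (not_lt.2 hn)]]
  refine Finset.sum_congr rfl fun n hn => ?_
  rw [inner_diagOp, if_pos (Finset.mem_range.1 hn), norm_mul, mul_pow, Complex.norm_real,
    Real.norm_of_nonneg (Real.sqrt_nonneg _), Real.sq_sqrt (hw n)]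

/-- The projection onto the first `M` basis vectors. -/
def proj (M : ℕ) : F →L[ℂ] F := diagOp b M fun _ => 1

theorem inner_proj (M : ℕ) (v : F) (n : ℕ) :
    ⟪b n, proj b M v⟫_ℂ = if n < M then ⟪b n, v⟫_ℂ else 0 := by
  rw [proj, inner_diagOp]; simp

theorem proj_eq_self_iff {M : ℕ} {v : F} :
    proj b M v = v ↔ ∀ n, M ≤ n → ⟪b n, v⟫_ℂ = 0 := by
  constructor
  · intro h n hn
    rw [← h, inner_proj, if_neg (not_lt.2 hn)]
  · intro h
    refine vec_ext (b := b) fun n => ?_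
    rw [inner_proj]
    split_ifs with hn
    · rfl
    · rw [h n (not_lt.1 hn)]

theorem proj_mul_proj {M M' : ℕ} (h : M ≤ M') : proj b M' * proj b M = proj b M := by
  refine ContinuousLinearMap.ext fun v => vec_ext (b := b) fun n => ?_
  rw [mul_apply_eq_comp, inner_proj, inner_proj]
  split_ifs <;> first | rfl | omega

theorem proj_mul_matOp {M M' : ℕ} (h : M ≤ M') (g : ℕ → ℕ → ℂ) :
    proj b M' * matOp b M g = matOp b M g := by
  refine ContinuousLinearMap.ext fun v => vec_ext (b := b) fun n => ?_
  rw [mul_apply_eq_comp, inner_proj, inner_matOp]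
  split_ifs <;> first | rfl | omega

theorem proj_basis (M k : ℕ) : proj b M (b k) = if k < M then b k else 0 := by
  refine vec_ext (b := b) fun n => ?_
  rw [inner_proj]
  by_cases hk : k < M <;> by_cases hn : n < M <;> simp [hk, hn, inner_basis] <;> omega

theorem matOp_mul_proj {M M' : ℕ} (h : M ≤ M') (g : ℕ → ℕ → ℂ) :
    matOp b M g * proj b M' = matOp b M g := by
  refine op_ext (b := b) fun n k => ?_
  rw [mul_apply_eq_comp, proj_basis]
  split_ifs with hk
  · rfl
  · rw [map_zero, inner_zero_right, inner_matOp_basis, if_neg (by omega)]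

variable [CompleteSpace F]

theorem star_matOp (M : ℕ) (g : ℕ → ℕ → ℂ) :
    star (matOp b M g) = matOp b M fun n k => (starRingEnd ℂ) (g k n) := by
  refine op_ext (b := b) fun n k => ?_
  rw [ContinuousLinearMap.star_eq_adjoint, ContinuousLinearMap.adjoint_inner_right,
    ← inner_conj_symm, inner_matOp_basis, inner_matOp_basis]
  by_cases hn : n < M <;> by_cases hk : k < M <;> simp [hn, hk]

theorem star_diagOp (M : ℕ) (w : ℕ → ℝ) : star (diagOp b M w) = diagOp b M w := by
  rw [diagOp, star_matOp]
  refine matOp_congr b fun n _ k _ => ?_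
  by_cases h : n = k
  · subst h; simp
  · simp [h, Ne.symm h]

theorem star_proj (M : ℕ) : star (proj b M) = proj b M := star_diagOp b M _

open TraceClass

variable {b}

theorem diag_conj_diagOp (M : ℕ) {w : ℕ → ℝ} (hw : ∀ n, 0 ≤ w n) (x : TraceClass b) (n : ℕ) :
    diag (conj (diagOp b M w) x) n = if n < M then w n * diag x n else 0 := by
  have e : diagOp b M w (b n) = if n < M then ((√(w n) : ℝ) : ℂ) • b n else 0 := by
    refine vec_ext (b := b) fun k => ?_
    rw [inner_diagOp]
    by_cases hk : k < M <;> by_cases hn : n < M <;> by_cases h : k = n <;>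
      simp [hk, hn, h, inner_basis]
  rw [diag, op_conj, star_diagOp, mul_apply_eq_comp, mul_apply_eq_comp,
    ← ContinuousLinearMap.adjoint_inner_left, ← ContinuousLinearMap.star_eq_adjoint, star_diagOp, e]
  split_ifs with hn
  · rw [map_smul, inner_smul_left, inner_smul_right, ← mul_assoc, Complex.conj_ofReal,
      ← Complex.ofReal_mul, Real.mul_self_sqrt (hw n), diag]
    exact RCLike.re_ofReal_mul _ _
  · simp

theorem tr_conj_diagOp (M : ℕ) {w : ℕ → ℝ} (hw : ∀ n, 0 ≤ w n) (x : TraceClass b) :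
    tr (conj (diagOp b M w) x) = ∑ n ∈ Finset.range M, w n * diag x n := by
  have h := (conj (diagOp b M w) x).hasSum_tr
  have e : diag (conj (diagOp b M w) x) = fun n => if n < M then w n * diag x n else 0 := by
    ext n; exact diag_conj_diagOp M hw x n
  rw [e] at h
  have h2 : HasSum (fun n => if n < M then w n * diag x n else 0)
      (∑ n ∈ Finset.range M, if n < M then w n * diag x n else 0) :=
    hasSum_sum_of_ne_finset_zero fun n hn => if_neg (by simpa using hn)
  rw [h.unique h2]
  exact Finset.sum_congr rfl fun n hn => if_pos (Finset.mem_range.1 hn)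

/-- Positive elements cut off by a projection are sums over vectors in its range. -/
theorem exists_hasSum_tr_conj_block {M : ℕ} {x : TraceClass b} (hx : 0 ≤ op x)
    (hM : conj (proj b M) x = x) :
    ∃ v : ℕ → F, (∀ n, proj b M (v n) = v n) ∧
      ∀ A : F →L[ℂ] F, HasSum (fun n => ‖A (v n)‖ ^ 2) (tr (conj A x)) := by
  obtain ⟨v, hv⟩ := exists_hasSum_tr_conj hx
  refine ⟨fun n => proj b M (v n), fun n => ?_, fun A => ?_⟩
  · rw [← mul_apply_eq_comp, proj_mul_proj b le_rfl]
  · have h := hv (A * proj b M)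
    rw [← conj_conj, hM] at h
    exact h

/-- Compressing x by 1 - P gives an element whose trace is the tail τ of the diagonal series. The
cross terms cost δ tr x + τ/δ: choose δ first, then M. -/
theorem tendsto_conj_proj_of_nonneg {x : TraceClass b} (hx : 0 ≤ op x) :
    Tendsto (fun M => conj (proj b M) x) atTop (𝓝 x) := by
  set τ : ℕ → ℝ := fun M => tr x - ∑ n ∈ Finset.range M, diag x n with hτ
  have hτ0 : Tendsto τ atTop (𝓝 0) := by
    simpa [hτ] using (x.hasSum_tr.tendsto_sum_nat).const_sub (tr x)
  have hY : ∀ M, tr (conj (1 - proj b M) x) = τ M := by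
    intro M
    obtain ⟨v, hv⟩ := exists_hasSum_tr_conj hx
    have h1 := hv (1 - proj b M)
    have h2 := (hv 1).sub (hv (proj b M))
    have e : (fun n => ‖(1 - proj b M) (v n)‖ ^ 2) =
        fun n => ‖(1 : F →L[ℂ] F) (v n)‖ ^ 2 - ‖proj b M (v n)‖ ^ 2 := by
      ext n
      have hp : star (proj b M) * proj b M = proj b M := by
        rw [star_proj, proj_mul_proj b le_rfl]
      have h3 : RCLike.re ⟪v n, proj b M (v n)⟫_ℂ = ‖proj b M (v n)‖ ^ 2 := by
        rw [← re_inner_star_mul, hp]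
      rw [sub_apply, one_apply_eq_self, @norm_sub_sq ℂ, h3]
      ring
    rw [e] at h1
    rw [h1.unique h2, conj_one, proj, tr_conj_diagOp M (fun _ => zero_le_one)]
    simp [hτ]
  have hb : ∀ M (δ : ℝ), 0 < δ →
      ‖conj (proj b M) x - x‖ ≤ δ * tr x + (δ⁻¹ + 1) * τ M := by
    intro M δ hδ
    have h1 := norm_conj_add_sub_le hx (proj b M) (1 - proj b M) hδ
    rw [add_sub_cancel, conj_one, hY] at h1
    rw [norm_sub_rev]
    refine h1.trans ?_
    have h2 : tr (conj (proj b M) x) ≤ tr x := by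
      have := tr_nonneg (op_conj_nonneg (1 - proj b M) hx)
      rw [hY] at this
      rw [proj, tr_conj_diagOp M (fun _ => zero_le_one)]
      simp only [one_mul]
      linarith [this]
    gcongr
  rw [Metric.tendsto_atTop']
  intro ε hε
  have htr := tr_nonneg hx
  set δ : ℝ := ε / (2 * (tr x + 1)) with hδ
  have hδ0 : 0 < δ := by positivity
  have h1 : Tendsto (fun M => (δ⁻¹ + 1) * τ M) atTop (𝓝 0) := by
    simpa using hτ0.const_mul (δ⁻¹ + 1)
  obtain ⟨N, hN⟩ := eventually_atTop.1 (h1.eventually (Iio_mem_nhds (half_pos hε)))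
  refine ⟨N, fun M hM => ?_⟩
  rw [dist_eq_norm]
  refine (hb M δ hδ0).trans_lt ?_
  have h2 : δ * tr x ≤ ε / 2 := by
    rw [hδ, div_mul_eq_mul_div, div_le_div_iff₀ (by positivity) (by positivity)]
    nlinarith
  have h3 : (δ⁻¹ + 1) * τ M < ε / 2 := hN M hM.le
  linarith

theorem tendsto_conj_proj (x : TraceClass b) :
    Tendsto (fun M => conj (proj b M) x) atTop (𝓝 x) := by
  have h := (tendsto_conj_proj_of_nonneg x.op_pos_nonneg).sub
    (tendsto_conj_proj_of_nonneg x.op_neg_nonneg)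
  simpa only [← map_sub, pos_sub_neg] using h

end FiniteMatrices

/-! ### Quadratic forms of the truncated generator and band estimates -/

section Forms

/-- The matrix of the `l`-th power of the annihilation operator. -/
def lowering (l : ℕ) (n k : ℕ) : ℂ :=
  if n + l = k then ((√(k.descFactorial l : ℝ) : ℝ) : ℂ) else 0

/-- The matrix of `-i G - ½ a†^l a^l`. -/
def drift (l : ℕ) (G : ℕ → ℕ → ℂ) (n k : ℕ) : ℂ :=
  -Complex.I * G n k - if n = k then ((n.descFactorial l / 2 : ℝ) : ℂ) else 0

/-- Hermitian band matrices of width `D` with entries growing like the power `r`. -/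
structure IsCoupling (D r : ℕ) (Γ : ℝ) (G : ℕ → ℕ → ℂ) : Prop where
  herm : ∀ n k, (starRingEnd ℂ) (G n k) = G k n
  band : ∀ n k, n + D < k ∨ k + D < n → G n k = 0
  bound : ∀ n k, ‖G n k‖ ≤ Γ * ((n : ℝ) + 1) ^ r

theorem IsCoupling.nonneg {D r : ℕ} {Γ : ℝ} {G : ℕ → ℕ → ℂ} (h : IsCoupling D r Γ G) : 0 ≤ Γ := by
  have h1 := (norm_nonneg _).trans (h.bound 0 0)
  simpa using h1

theorem IsCoupling.norm_symm {D r : ℕ} {Γ : ℝ} {G : ℕ → ℕ → ℂ} (h : IsCoupling D r Γ G) (n k : ℕ) :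
    ‖G n k‖ = ‖G k n‖ := by
  rw [← h.herm n k, RCLike.norm_conj]

theorem sum_range_shift {β : Type*} [AddCommMonoid β] (l M : ℕ) {f : ℕ → β}
    (hf : ∀ k < l, f k = 0) :
    ∑ n ∈ Finset.range M, (if n + l < M then f (n + l) else 0) = ∑ k ∈ Finset.range M, f k := by
  rcases le_total M l with h | h
  · rw [Finset.sum_eq_zero, Finset.sum_eq_zero]
    · intro k hk; exact hf k ((Finset.mem_range.1 hk).trans_le h)
    · intro n _; exact if_neg (by omega)
  · obtain ⟨m, rfl⟩ := Nat.exists_eq_add_of_le h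
    rw [Finset.sum_range_add f l m, Finset.sum_eq_zero (s := Finset.range l)
      (fun k hk => hf k (Finset.mem_range.1 hk)), zero_add, add_comm l m, Finset.sum_range_add,
      Finset.sum_eq_zero (s := Finset.range l) (fun k _ => if_neg (by omega)), add_zero]
    refine Finset.sum_congr rfl fun n hn => ?_
    rw [if_pos (by have := Finset.mem_range.1 hn; omega), add_comm]

theorem sum_lowering (l M n : ℕ) (c : ℕ → ℂ) :
    ∑ k ∈ Finset.range M, lowering l n k * c k =
      if n + l < M then ((√((n + l).descFactorial l : ℝ) : ℝ) : ℂ) * c (n + l) else 0 := by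
  simp only [lowering, ite_mul, zero_mul, Finset.sum_ite_eq, Finset.mem_range]

variable {F : Type*} [NormedAddCommGroup F] [InnerProductSpace ℂ F] (b : HilbertBasis ℕ ℂ F)

/-- The power of the annihilation operator sends the coordinate k to k - l, so the weight is read
there. Where k < l the subtraction truncates, but the descending factorial is 0. -/
theorem norm_diagOp_lowering_sq (l M : ℕ) {w : ℕ → ℝ} (hw : ∀ n, 0 ≤ w n) (v : F) :
    ‖diagOp b M w (matOp b M (lowering l) v)‖ ^ 2 =
      ∑ k ∈ Finset.range M, w (k - l) * k.descFactorial l * ‖⟪b k, v⟫_ℂ‖ ^ 2 := by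
  rw [norm_diagOp_sq b M hw, ← sum_range_shift l M
    (f := fun k => w (k - l) * k.descFactorial l * ‖⟪b k, v⟫_ℂ‖ ^ 2) fun k hk => by
      rw [Nat.descFactorial_of_lt hk]; simp]
  refine Finset.sum_congr rfl fun n hn => ?_
  rw [inner_matOp, if_pos (Finset.mem_range.1 hn), sum_lowering]
  split_ifs
  · rw [norm_mul, mul_pow, Complex.norm_real, Real.norm_of_nonneg (Real.sqrt_nonneg _),
      Real.sq_sqrt (Nat.cast_nonneg _), Nat.add_sub_cancel, mul_assoc]
  · simp

theorem re_inner_diagOp_drift (l M : ℕ) (G : ℕ → ℕ → ℂ) {w : ℕ → ℝ} (hw : ∀ n, 0 ≤ w n) (v : F) :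
    RCLike.re ⟪diagOp b M w v, diagOp b M w (matOp b M (drift l G) v)⟫_ℂ =
      ∑ n ∈ Finset.range M, w n * (∑ k ∈ Finset.range M,
        ((starRingEnd ℂ) ⟪b n, v⟫_ℂ * G n k * ⟪b k, v⟫_ℂ).im
          - n.descFactorial l / 2 * ‖⟪b n, v⟫_ℂ‖ ^ 2) := by
  rw [inner_eq_sum b (M := M) fun n hn => by rw [inner_diagOp, if_neg (not_lt.2 hn)], map_sum]
  refine Finset.sum_congr rfl fun n hn => ?_
  have hn' := Finset.mem_range.1 hn
  rw [inner_diagOp, inner_diagOp, if_pos hn', if_pos hn', inner_matOp, if_pos hn',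
    map_mul (starRingEnd ℂ), Complex.conj_ofReal]
  have e : ∀ x y : ℂ, ((√(w n) : ℝ) : ℂ) * x * (((√(w n) : ℝ) : ℂ) * y) = ((w n : ℝ) : ℂ) * (x * y) := by
    intro x y
    have h1 : ((√(w n) : ℝ) : ℂ) * ((√(w n) : ℝ) : ℂ) = ((w n : ℝ) : ℂ) := by
      rw [← Complex.ofReal_mul, Real.mul_self_sqrt (hw n)]
    linear_combination (x * y) * h1
  rw [e]
  change (((w n : ℝ) : ℂ) * _).re = _
  rw [Complex.re_ofReal_mul]
  congr 1
  simp only [drift, sub_mul, Finset.sum_sub_distrib, mul_sub, ite_mul, zero_mul,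
    Finset.sum_ite_eq, hn, if_true, Complex.sub_re]
  congr 1
  · rw [Finset.mul_sum, Complex.re_sum]
    refine Finset.sum_congr rfl fun k _ => ?_
    have : (starRingEnd ℂ) ⟪b n, v⟫_ℂ * (-Complex.I * G n k * ⟪b k, v⟫_ℂ) =
      -(((starRingEnd ℂ) ⟪b n, v⟫_ℂ * G n k * ⟪b k, v⟫_ℂ) * Complex.I) := by ring
    rw [this, Complex.neg_re, Complex.mul_I_re, neg_neg]
  · have : (starRingEnd ℂ) ⟪b n, v⟫_ℂ * (((n.descFactorial l / 2 : ℝ) : ℂ) * ⟪b n, v⟫_ℂ) =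
        (((n.descFactorial l / 2 : ℝ) : ℂ)) * (⟪b n, v⟫_ℂ * (starRingEnd ℂ) ⟪b n, v⟫_ℂ) := by ring
    rw [this, Complex.mul_conj, ← Complex.ofReal_mul, Complex.ofReal_re, Complex.normSq_eq_norm_sq]

/-- The quadratic form of the truncated generator in the weighted norm. -/
theorem weighted_form_eq (l M : ℕ) {G : ℕ → ℕ → ℂ}
    (hG : ∀ n k, (starRingEnd ℂ) (G n k) = G k n) {w : ℕ → ℝ} (hw : ∀ n, 0 ≤ w n) (v : F) :
    ‖diagOp b M w (matOp b M (lowering l) v)‖ ^ 2 +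
        2 * RCLike.re ⟪diagOp b M w v, diagOp b M w (matOp b M (drift l G) v)⟫_ℂ =
      ∑ k ∈ Finset.range M, (w (k - l) - w k) * k.descFactorial l * ‖⟪b k, v⟫_ℂ‖ ^ 2 +
      ∑ n ∈ Finset.range M, ∑ k ∈ Finset.range M,
        (w n - w k) * ((starRingEnd ℂ) ⟪b n, v⟫_ℂ * G n k * ⟪b k, v⟫_ℂ).im := by
  rw [norm_diagOp_lowering_sq b l M hw, re_inner_diagOp_drift b l M G hw]
  set z : ℕ → ℕ → ℝ := fun n k => ((starRingEnd ℂ) ⟪b n, v⟫_ℂ * G n k * ⟪b k, v⟫_ℂ).im with hz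
  -- Since G is Hermitian, z is antisymmetric. Symmetrising the double sum leaves only differences
  -- of weights, which lowers the order of the Hamiltonian contribution by one.
  have hanti : ∀ n k, z k n = - z n k := by
    intro n k
    simp only [hz]
    rw [← Complex.conj_im]
    congr 1
    rw [map_mul, map_mul, hG, Complex.conj_conj]
    ring
  have h1 : ∑ n ∈ Finset.range M, ∑ k ∈ Finset.range M, (w n - w k) * z n k =
      2 * ∑ n ∈ Finset.range M, w n * ∑ k ∈ Finset.range M, z n k := by
    have h2 : ∑ n ∈ Finset.range M, ∑ k ∈ Finset.range M, w k * z n k =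
        - ∑ n ∈ Finset.range M, ∑ k ∈ Finset.range M, w n * z n k := by
      rw [Finset.sum_comm, ← Finset.sum_neg_distrib]
      refine Finset.sum_congr rfl fun n _ => ?_
      rw [← Finset.sum_neg_distrib]
      refine Finset.sum_congr rfl fun k _ => ?_
      rw [hanti]; ring
    simp only [sub_mul, Finset.sum_sub_distrib, Finset.mul_sum] at h2 ⊢
    rw [h2]
    simp only [← Finset.sum_neg_distrib, ← Finset.sum_sub_distrib]
    exact Finset.sum_congr rfl fun n _ => Finset.sum_congr rfl fun k _ => by ring
  rw [h1, Finset.mul_sum, Finset.mul_sum, ← Finset.sum_add_distrib, ← Finset.sum_add_distrib]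
  refine Finset.sum_congr rfl fun n _ => ?_
  ring

theorem card_near_le (D n : ℕ) (s : Finset ℕ) :
    ((s.filter fun k => n ≤ k + D ∧ k ≤ n + D).card : ℝ) ≤ 2 * D + 1 := by
  have h : (s.filter fun k => n ≤ k + D ∧ k ≤ n + D) ⊆ Finset.Icc (n - D) (n + D) := by
    intro k hk
    have := (Finset.mem_filter.1 hk).2
    rw [Finset.mem_Icc]; omega
  have h1 := Finset.card_le_card h
  rw [Nat.card_Icc] at h1
  have h2 : (s.filter fun k => n ≤ k + D ∧ k ≤ n + D).card ≤ 2 * D + 1 := by omega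
  exact_mod_cast h2

theorem sum_near_le (D n : ℕ) (s : Finset ℕ) {f : ℕ → ℝ} {C : ℝ} (hC : 0 ≤ C)
    (hf : ∀ k ∈ s, n ≤ k + D → k ≤ n + D → f k ≤ C)
    (h0 : ∀ k, n + D < k ∨ k + D < n → f k = 0) : ∑ k ∈ s, f k ≤ (2 * D + 1) * C := by
  rw [← Finset.sum_filter_of_ne (p := fun k => n ≤ k + D ∧ k ≤ n + D)]
  · refine (Finset.sum_le_card_nsmul _ _ C fun k hk => ?_).trans ?_
    · rw [Finset.mem_filter] at hk; exact hf k hk.1 hk.2.1 hk.2.2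
    · rw [nsmul_eq_mul]; exact mul_le_mul_of_nonneg_right (card_near_le D n s) hC
  · intro k _ hk
    by_contra h
    exact hk (h0 k (by omega))

/-- Schur test: the kernel |w n - w k| ‖G n k‖ is symmetric, so 2 c c' ≤ c² + c'² turns the
off-diagonal sum into a diagonal one. -/
theorem weighted_form_le (l M : ℕ) {D r : ℕ} {Γ : ℝ} {G : ℕ → ℕ → ℂ} (hG : IsCoupling D r Γ G)
    {w : ℕ → ℝ} (hw : ∀ n, 0 ≤ w n) (v : F) :
    ‖diagOp b M w (matOp b M (lowering l) v)‖ ^ 2 +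
        2 * RCLike.re ⟪diagOp b M w v, diagOp b M w (matOp b M (drift l G) v)⟫_ℂ ≤
      ∑ k ∈ Finset.range M, ((w (k - l) - w k) * k.descFactorial l +
        ∑ n ∈ Finset.range M, |w k - w n| * ‖G k n‖) * ‖⟪b k, v⟫_ℂ‖ ^ 2 := by
  rw [weighted_form_eq b l M hG.herm hw]
  simp only [add_mul, Finset.sum_add_distrib]
  refine add_le_add le_rfl ?_
  set c : ℕ → ℝ := fun n => ‖⟪b n, v⟫_ℂ‖ with hc
  set q : ℕ → ℕ → ℝ := fun n k => |w n - w k| * ‖G n k‖ with hq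
  have hqs : ∀ n k, q n k = q k n := fun n k => by
    simp only [hq]; rw [abs_sub_comm, hG.norm_symm]
  have h1 : ∀ n k, (w n - w k) * ((starRingEnd ℂ) ⟪b n, v⟫_ℂ * G n k * ⟪b k, v⟫_ℂ).im ≤
      q n k * c n ^ 2 / 2 + q k n * c k ^ 2 / 2 := by
    intro n k
    have h2 : |((starRingEnd ℂ) ⟪b n, v⟫_ℂ * G n k * ⟪b k, v⟫_ℂ).im| ≤ c n * ‖G n k‖ * c k := by
      refine (Complex.abs_im_le_norm _).trans ?_
      rw [norm_mul, norm_mul, RCLike.norm_conj]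
    have h3 : (w n - w k) * ((starRingEnd ℂ) ⟪b n, v⟫_ℂ * G n k * ⟪b k, v⟫_ℂ).im ≤
        |w n - w k| * (c n * ‖G n k‖ * c k) := by
      refine (le_abs_self _).trans ?_
      rw [abs_mul]; gcongr
    have h4 : 0 ≤ q n k := by simp only [hq]; positivity
    refine h3.trans ?_
    rw [hqs k n]
    have h5 : |w n - w k| * (c n * ‖G n k‖ * c k) = q n k * (c n * c k) := by simp only [hq]; ring
    rw [h5]
    nlinarith [mul_nonneg h4 (sq_nonneg (c n - c k))]
  refine (Finset.sum_le_sum fun n _ => Finset.sum_le_sum fun k _ => h1 n k).trans (le_of_eq ?_)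
  simp only [Finset.sum_add_distrib]
  rw [Finset.sum_comm (f := fun n k => q k n * c k ^ 2 / 2), ← Finset.sum_add_distrib]
  refine Finset.sum_congr rfl fun n _ => ?_
  rw [← Finset.sum_add_distrib, Finset.sum_mul]
  refine Finset.sum_congr rfl fun k _ => ?_
  ring

/-- With the constant weight 1 all differences of weights vanish. The cut destroys nothing here,
because lowering never leaves the block of indices below M. -/
theorem conservative_truncation (l M : ℕ) {G : ℕ → ℕ → ℂ}
    (hG : ∀ n k, (starRingEnd ℂ) (G n k) = G k n) :
    IsConservative (matOp b M (lowering l)) (matOp b M (drift l G)) := by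
  intro v
  have h := weighted_form_eq b l M hG (w := fun _ => 1) (fun _ => zero_le_one) v
  simp only [sub_self, zero_mul, Finset.sum_const_zero, add_zero] at h
  change ‖proj b M _‖ ^ 2 + 2 * RCLike.re ⟪proj b M v, proj b M _⟫_ℂ = 0 at h
  rw [← mul_apply_eq_comp (proj b M), ← mul_apply_eq_comp (proj b M), proj_mul_matOp b le_rfl,
    proj_mul_matOp b le_rfl] at h
  rw [← h]
  congr 3
  rw [inner_eq_sum b (M := M) (fun n hn => by rw [inner_matOp, if_neg (not_lt.2 hn)]),
    inner_eq_sum b (M := M) (fun n hn => by rw [inner_matOp, if_neg (not_lt.2 hn)])]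
  refine Finset.sum_congr rfl fun n hn => ?_
  rw [inner_proj, if_pos (Finset.mem_range.1 hn)]

/-- Cauchy–Schwarz for band matrices. -/
theorem band_sum_le {D M : ℕ} (s : Finset ℕ) {h : ℕ → ℕ → ℂ} {a B : ℕ → ℝ} (c : ℕ → ℂ)
    (hband : ∀ n k, n + D < k ∨ k + D < n → h n k = 0) (ha : ∀ n, 0 ≤ a n) (hB : ∀ k, 0 ≤ B k)
    (hle : ∀ n ∈ s, ∀ k < M, n ≤ k + D → k ≤ n + D → a n * ‖h n k‖ ^ 2 ≤ B k) :
    ∑ n ∈ s, a n * ‖∑ k ∈ Finset.range M, h n k * c k‖ ^ 2 ≤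
      (2 * D + 1) ^ 2 * ∑ k ∈ Finset.range M, B k * ‖c k‖ ^ 2 := by
  have h1 : ∀ n, ‖∑ k ∈ Finset.range M, h n k * c k‖ ^ 2 ≤
      (2 * D + 1) * ∑ k ∈ Finset.range M, ‖h n k‖ ^ 2 * ‖c k‖ ^ 2 := by
    intro n
    have e : ∑ k ∈ Finset.range M, h n k * c k =
        ∑ k ∈ (Finset.range M).filter (fun k => n ≤ k + D ∧ k ≤ n + D), h n k * c k := by
      refine (Finset.sum_filter_of_ne fun k _ hk => ?_).symm
      by_contra h0
      exact hk (by rw [hband n k (by omega), zero_mul])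
    rw [e]
    calc _ ≤ (∑ k ∈ (Finset.range M).filter (fun k => n ≤ k + D ∧ k ≤ n + D),
          ‖h n k‖ * ‖c k‖) ^ 2 := by
          refine pow_le_pow_left₀ (norm_nonneg _) ((norm_sum_le _ _).trans ?_) 2
          exact Finset.sum_le_sum fun k _ => (norm_mul _ _).le
      _ ≤ _ := sq_sum_le_card_mul_sum_sq
      _ ≤ (2 * D + 1) * ∑ k ∈ Finset.range M, (‖h n k‖ * ‖c k‖) ^ 2 := by
          refine mul_le_mul (card_near_le D n _) ?_ (Finset.sum_nonneg fun _ _ => sq_nonneg _)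
            (by positivity)
          exact Finset.sum_le_sum_of_subset_of_nonneg (Finset.filter_subset _ _)
            fun _ _ _ => sq_nonneg _
      _ = _ := by simp only [mul_pow]
  calc _ ≤ ∑ n ∈ s, a n * ((2 * D + 1) * ∑ k ∈ Finset.range M, ‖h n k‖ ^ 2 * ‖c k‖ ^ 2) :=
        Finset.sum_le_sum fun n _ => mul_le_mul_of_nonneg_left (h1 n) (ha n)
    _ = (2 * D + 1) * ∑ k ∈ Finset.range M, (∑ n ∈ s, a n * ‖h n k‖ ^ 2) * ‖c k‖ ^ 2 := by
        simp only [Finset.mul_sum, Finset.sum_mul]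
        rw [Finset.sum_comm]
        exact Finset.sum_congr rfl fun k _ => Finset.sum_congr rfl fun n _ => by ring
    _ ≤ (2 * D + 1) * ∑ k ∈ Finset.range M, ((2 * D + 1) * B k) * ‖c k‖ ^ 2 := by
        refine mul_le_mul_of_nonneg_left (Finset.sum_le_sum fun k hk => ?_) (by positivity)
        refine mul_le_mul_of_nonneg_right ?_ (sq_nonneg _)
        refine sum_near_le D k s (hB k) (fun n hn h2 h3 => ?_) fun n hn => ?_
        · exact hle n hn k (Finset.mem_range.1 hk) h3 h2
        · rw [hband n k (by omega)]; simp
    _ = _ := by rw [Finset.mul_sum, Finset.mul_sum]; exact Finset.sum_congr rfl fun k _ => by ring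

end Forms

/-! ### Dissipation against growth for polynomial weights -/

section Moments

/-- Either A ≤ c x and the first term suffices, or x ≤ A/c and the second one does, with A ≤ A/c
from c ≤ 1. -/
theorem mul_pow_le_add {A c x : ℝ} (q : ℕ) (hc : 0 < c) (hc1 : c ≤ 1) (hA : 0 ≤ A) (hx : 0 ≤ x) :
    A * x ^ q ≤ c * x ^ (q + 1) + (A / c) ^ (q + 1) := by
  have hAc : A ≤ A / c := by rw [le_div_iff₀ hc]; nlinarith
  have h0 : 0 ≤ A / c := by positivity
  rcases le_total A (c * x) with h | h
  · have h1 : A * x ^ q ≤ (c * x) * x ^ q := by gcongr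
    have h2 : (0 : ℝ) ≤ (A / c) ^ (q + 1) := by positivity
    rw [pow_succ x q]
    nlinarith
  · have h1 : x ≤ A / c := by rw [le_div_iff₀ hc]; linarith
    have h2 : A * x ^ q ≤ (A / c) * (A / c) ^ q := by gcongr
    have h3 : 0 ≤ c * x ^ (q + 1) := by positivity
    rw [pow_succ (A / c) q]
    linarith

/-- The weights of the moments. -/
def pw (m : ℕ) (n : ℕ) : ℝ := ((n : ℝ) + 1) ^ m

theorem pw_nonneg (m n : ℕ) : 0 ≤ pw m n := by unfold pw; positivity

theorem pw_mono {m m' : ℕ} (h : m ≤ m') (n : ℕ) : pw m n ≤ pw m' n :=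
  pow_le_pow_right₀ (by linarith [Nat.cast_nonneg (α := ℝ) n]) h

theorem near_cast_le {D n k : ℕ} (h : n ≤ k + D) :
    (n : ℝ) + 1 ≤ ((D : ℝ) + 1) * ((k : ℝ) + 1) := by
  have h1 : (n : ℝ) ≤ k + D := by exact_mod_cast h
  have h2 : (0 : ℝ) ≤ (D : ℝ) * k := by positivity
  nlinarith

/-- With x = k + 1 ≥ l + 1, the difference of (m+1)-st powers at x and x - l is at least x^m, and
the descending factorial is at least (x/(l+1))^l. For k < l nothing is dissipated, and the additive
constant covers the finitely many indices. -/
theorem dissipation_le (l m k : ℕ) (hl : 1 ≤ l) :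
    (pw (m + 1) (k - l) - pw (m + 1) k) * k.descFactorial l ≤
      -((1 / ((l : ℝ) + 1) ^ l) * ((k : ℝ) + 1) ^ (m + l)) + (l : ℝ) ^ (m + l) := by
  have hc : (1 / ((l : ℝ) + 1) ^ l) ≤ 1 := by
    rw [div_le_one (by positivity)]
    exact one_le_pow₀ (by linarith [Nat.cast_nonneg (α := ℝ) l])
  rcases lt_or_ge k l with h | h
  · rw [Nat.descFactorial_of_lt h, Nat.cast_zero, mul_zero]
    have h1 : ((k : ℝ) + 1) ^ (m + l) ≤ (l : ℝ) ^ (m + l) := by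
      refine pow_le_pow_left₀ (by positivity) ?_ _
      exact_mod_cast h
    have h2 : (1 / ((l : ℝ) + 1) ^ l) * ((k : ℝ) + 1) ^ (m + l) ≤ ((k : ℝ) + 1) ^ (m + l) :=
      mul_le_of_le_one_left (by positivity) hc
    linarith
  · have hk : ((k - l : ℕ) : ℝ) = k - l := Nat.cast_sub h
    set x : ℝ := (k : ℝ) + 1 with hx
    have hlx : (l : ℝ) ≤ x - 1 := by rw [hx]; simpa using (Nat.cast_le (α := ℝ)).2 h
    have hl1 : (1 : ℝ) ≤ l := by exact_mod_cast hl
    have hx0 : 0 < x := by rw [hx]; positivity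
    have e1 : pw (m + 1) k - pw (m + 1) (k - l) ≥ x ^ m := by
      unfold pw
      rw [hk, ← hx]
      have h1 : ((k : ℝ) - l + 1) = x - l := by rw [hx]; ring
      rw [h1, pow_succ, pow_succ]
      have h2 : (x - l) ^ m * (x - l) ≤ x ^ m * (x - l) :=
        mul_le_mul_of_nonneg_right (pow_le_pow_left₀ (by linarith) (by linarith) m) (by linarith)
      nlinarith [pow_pos hx0 m]
    have e2 : (1 / ((l : ℝ) + 1) ^ l) * x ^ l ≤ k.descFactorial l := by
      have h1 : ((k + 1 - l : ℕ) : ℝ) ^ l ≤ k.descFactorial l := by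
        exact_mod_cast Nat.pow_sub_le_descFactorial k l
      refine le_trans ?_ h1
      have h2 : ((k + 1 - l : ℕ) : ℝ) = x - l := by
        rw [Nat.cast_sub (by omega)]; push_cast; rw [hx]
      rw [h2, div_mul_eq_mul_div, one_mul, ← div_pow]
      refine pow_le_pow_left₀ (by positivity) ?_ l
      rw [div_le_iff₀ (by positivity)]
      nlinarith
    have e3 : x ^ m * ((1 / ((l : ℝ) + 1) ^ l) * x ^ l) ≤
        (pw (m + 1) k - pw (m + 1) (k - l)) * k.descFactorial l :=
      mul_le_mul e1 e2 (by positivity) (le_trans (by positivity) e1)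
    have e4 : x ^ m * ((1 / ((l : ℝ) + 1) ^ l) * x ^ l) =
        (1 / ((l : ℝ) + 1) ^ l) * x ^ (m + l) := by rw [pow_add]; ring
    have e5 : (0 : ℝ) ≤ (l : ℝ) ^ (m + l) := by positivity
    linarith

/-- The constant in the moment estimates. -/
def momentConst (r D m : ℕ) : ℝ :=
  ((r + 1 : ℕ) : ℝ) ^ (m + (r + 1)) +
    (((2 * D + 1) * (D * ((m + 1 : ℕ) : ℝ) * ((D : ℝ) + 1) ^ m) + 1) /
      (1 / (((r + 1 : ℕ) : ℝ) + 1) ^ (r + 1))) ^ (m + r + 1)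

theorem momentConst_pos (r D m : ℕ) : 0 < momentConst r D m := by
  unfold momentConst; positivity

/-- The mean value bound on a band makes the Hamiltonian term of degree m + r in k + 1, one less
than the dissipation, which absorbs it at the price of a constant. -/
theorem moment_weight_le {r D m : ℕ} (hr : 1 ≤ r) {Γ : ℝ} {G : ℕ → ℕ → ℂ} (hG : IsCoupling D r Γ G)
    (M k : ℕ) :
    (pw (m + 1) (k - (r + 1)) - pw (m + 1) k) * k.descFactorial (r + 1) +
        ∑ n ∈ Finset.range M, |pw (m + 1) k - pw (m + 1) n| * ‖G k n‖ ≤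
      -pw (m + 1) k + momentConst r D m * (1 + Γ) ^ (m + r + 1) := by
  have hΓ := hG.nonneg
  set x : ℝ := (k : ℝ) + 1 with hx
  have hx1 : 1 ≤ x := by rw [hx]; linarith [Nat.cast_nonneg (α := ℝ) k]
  set c₂ : ℝ := (2 * D + 1) * (D * ((m + 1 : ℕ) : ℝ) * ((D : ℝ) + 1) ^ m) with hc₂
  set c₁ : ℝ := 1 / (((r + 1 : ℕ) : ℝ) + 1) ^ (r + 1) with hc₁
  have hc₁0 : 0 < c₁ := by positivity
  have hc₁1 : c₁ ≤ 1 := by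
    rw [hc₁, div_le_one (by positivity)]
    exact one_le_pow₀ (by linarith [Nat.cast_nonneg (α := ℝ) (r + 1)])
  have hc₂0 : 0 ≤ c₂ := by positivity
  have h1 := dissipation_le (r + 1) m k (by omega)
  have h2 : ∑ n ∈ Finset.range M, |pw (m + 1) k - pw (m + 1) n| * ‖G k n‖ ≤
      (2 * D + 1) * ((D * ((m + 1 : ℕ) : ℝ) * (((D : ℝ) + 1) * x) ^ m) * (Γ * x ^ r)) := by
    refine sum_near_le D k _ (by positivity) (fun n _ h3 h4 => ?_) fun n hn => ?_
    · refine mul_le_mul ?_ (hG.bound k n) (norm_nonneg _) (by positivity)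
      refine (abs_pow_sub_pow_le _ _ _).trans ?_
      rw [Nat.add_sub_cancel]
      gcongr
      · rw [abs_le]
        have h5 : (k : ℝ) ≤ n + D := by exact_mod_cast h3
        have h6 : (n : ℝ) ≤ k + D := by exact_mod_cast h4
        constructor <;> linarith
      · rw [abs_of_nonneg (by positivity), abs_of_nonneg (by positivity)]
        refine max_le ?_ (near_cast_le h4)
        nlinarith [Nat.cast_nonneg (α := ℝ) D]
    · rw [hG.band k n hn, norm_zero, mul_zero]
  have h3 : (2 * D + 1 : ℝ) * ((D * ((m + 1 : ℕ) : ℝ) * (((D : ℝ) + 1) * x) ^ m) * (Γ * x ^ r)) =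
      Γ * c₂ * x ^ (m + r) := by
    rw [hc₂, mul_pow, pow_add]; ring
  -- The extra 1 in A pays for the term `-pw (m + 1) k`, whose degree m + 1 is at most m + r because
  -- r ≥ 1.
  have h4 := mul_pow_le_add (m + r) hc₁0 hc₁1 (A := Γ * c₂ + 1) (by positivity)
    (x := x) (by linarith)
  have h5 : pw (m + 1) k ≤ x ^ (m + r) := pow_le_pow_right₀ hx1 (by omega)
  have h6 : ((Γ * c₂ + 1) / c₁) ^ (m + r + 1) ≤
      ((c₂ + 1) / c₁) ^ (m + r + 1) * (1 + Γ) ^ (m + r + 1) := by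
    rw [← mul_pow]
    refine pow_le_pow_left₀ (by positivity) ?_ _
    rw [div_mul_eq_mul_div]
    gcongr
    nlinarith
  have h7 : ((r + 1 : ℕ) : ℝ) ^ (m + (r + 1)) ≤
      ((r + 1 : ℕ) : ℝ) ^ (m + (r + 1)) * (1 + Γ) ^ (m + r + 1) :=
    le_mul_of_one_le_right (by positivity) (one_le_pow₀ (by linarith))
  rw [momentConst, ← hc₂, ← hc₁, add_mul]
  rw [h3] at h2
  have h8 : x ^ (m + (r + 1)) = x ^ (m + r + 1) := rfl
  rw [h8, ← hc₁] at h1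
  rw [add_mul, one_mul] at h4
  linarith

end Moments

/-! ### The truncated generators and uniform bounds on moments -/

section Generator

variable {F : Type*} [NormedAddCommGroup F] [InnerProductSpace ℂ F]
  {b : HilbertBasis ℕ ℂ F}

theorem diagOp_mul_proj {M M' : ℕ} (h : M ≤ M') (w : ℕ → ℝ) :
    diagOp b M' w * proj b M = diagOp b M w := by
  refine ContinuousLinearMap.ext fun v => vec_ext (b := b) fun n => ?_
  rw [mul_apply_eq_comp, inner_diagOp, inner_diagOp, inner_proj]
  split_ifs <;> first | rfl | omega | simp

theorem isConservative_gen (l M : ℕ) {D r : ℕ} {Γ : ℝ} {G : ℕ → ℕ → ℂ} (hG : IsCoupling D r Γ G) :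
    IsConservative (matOp b M (lowering l)) (matOp b M (drift l G)) :=
  conservative_truncation b l M hG.herm

variable [CompleteSpace F]

open TraceClass

variable (b) in
/-- The truncated generator. -/
def gen (l : ℕ) (G : ℕ → ℕ → ℂ) (M : ℕ) : TraceClass b →L[ℝ] TraceClass b :=
  lindblad b (matOp b M (lowering l)) (matOp b M (drift l G))

variable (b) in
/-- The expectation of `(1 + N) ^ m`, cut off to indices below `M`. -/
def moment (m M : ℕ) : TraceClass b →L[ℝ] ℝ :=
  tr.comp (conj (diagOp b M (pw m)))

theorem moment_apply (m M : ℕ) (x : TraceClass b) :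
    moment b m M x = tr (conj (diagOp b M (pw m)) x) := rfl

theorem moment_eq_sum (m M : ℕ) (x : TraceClass b) :
    moment b m M x = ∑ n ∈ Finset.range M, pw m n * diag x n :=
  tr_conj_diagOp M (pw_nonneg m) x

theorem moment_nonneg (m M : ℕ) {x : TraceClass b} (hx : 0 ≤ op x) : 0 ≤ moment b m M x :=
  tr_nonneg (op_conj_nonneg _ hx)

theorem moment_mono {m m' : ℕ} (h : m ≤ m') (M : ℕ) {x : TraceClass b} (hx : 0 ≤ op x) :
    moment b m M x ≤ moment b m' M x := by
  rw [moment_eq_sum, moment_eq_sum]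
  exact Finset.sum_le_sum fun n _ => mul_le_mul_of_nonneg_right (pw_mono h n) (diag_nonneg hx n)

theorem moment_of_block (m : ℕ) {M M' : ℕ} (h : M ≤ M') {x : TraceClass b}
    (hx : conj (proj b M) x = x) : moment b m M' x = moment b m M x := by
  rw [moment_apply, ← hx, conj_conj, diagOp_mul_proj h, hx, moment_apply]

theorem moment_zero_of_block {M : ℕ} {x : TraceClass b} (hx : conj (proj b M) x = x) :
    moment b 0 M x = tr x := by
  conv_rhs => rw [← hx]
  rw [moment_apply]
  have : pw 0 = fun _ => 1 := by ext n; simp [pw]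
  rw [this]; rfl

theorem block_mono {M M' : ℕ} (h : M ≤ M') {x : TraceClass b} (hx : conj (proj b M) x = x) :
    conj (proj b M') x = x := by
  conv_lhs => rw [← hx, conj_conj, proj_mul_proj b h, hx]

theorem flow_gen_nonneg (l : ℕ) (G : ℕ → ℕ → ℂ) (M : ℕ) {t : ℝ} (ht : 0 ≤ t) {x : TraceClass b}
    (hx : 0 ≤ op x) : 0 ≤ op (flow (gen b l G M) t x) :=
  lindblad_exp_nonneg _ _ ht hx

theorem tr_flow_gen (l M : ℕ) {D r : ℕ} {Γ : ℝ} {G : ℕ → ℕ → ℂ} (hG : IsCoupling D r Γ G)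
    (x : TraceClass b) (t : ℝ) : tr (flow (gen b l G M) t x) = tr x :=
  tr_flow_lindblad (isConservative_gen l M hG) x t

theorem commute_conj_lindblad {P A K : F →L[ℂ] F} (hP : star P = P) (h1 : P * A = A)
    (h2 : A * P = A) (h3 : P * K = K) (h4 : K * P = K) :
    Commute (conj P) (lindblad b A K) := by
  have h5 : P * star A = star A := by simpa [hP] using congrArg star h2
  have h6 : star A * P = star A := by simpa [hP] using congrArg star h1
  have h7 : P * star K = star K := by simpa [hP] using congrArg star h4
  have h8 : star K * P = star K := by simpa [hP] using congrArg star h3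
  refine ContinuousLinearMap.ext fun x => op_injective ?_
  rw [mul_apply_eq_comp, mul_apply_eq_comp, op_conj, op_lindblad, op_lindblad, op_conj, hP]
  have e1 : P * (A * op x * star A + K * op x + op x * star K) * P =
      (P * A) * op x * (star A * P) + (P * K) * op x * P + P * op x * (star K * P) := by
    noncomm_ring
  have e2 : A * (P * op x * P) * star A + K * (P * op x * P) + P * op x * P * star K =
      (A * P) * op x * (P * star A) + (K * P) * op x * P + P * op x * (P * star K) := by
    noncomm_ring
  rw [e1, e2, h1, h2, h3, h4, h5, h6, h7, h8]

theorem commute_conj_gen (l : ℕ) (G : ℕ → ℕ → ℂ) (M : ℕ) :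
    Commute (conj (proj b M)) (gen b l G M) :=
  commute_conj_lindblad (star_proj b M) (proj_mul_matOp b le_rfl _) (matOp_mul_proj b le_rfl _)
    (proj_mul_matOp b le_rfl _) (matOp_mul_proj b le_rfl _)

theorem gen_block (l : ℕ) (G : ℕ → ℕ → ℂ) {M : ℕ} {x : TraceClass b}
    (hx : conj (proj b M) x = x) : conj (proj b M) (gen b l G M x) = gen b l G M x := by
  have h := DFunLike.congr_fun (commute_conj_gen (b := b) l G M).eq x
  rw [mul_apply_eq_comp, mul_apply_eq_comp, hx] at h
  exact h

theorem flow_gen_block (l : ℕ) (G : ℕ → ℕ → ℂ) {M : ℕ} {x : TraceClass b}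
    (hx : conj (proj b M) x = x) (t : ℝ) :
    conj (proj b M) (flow (gen b l G M) t x) = flow (gen b l G M) t x := by
  rw [flow_apply_comm (commute_conj_gen l G M), hx]

/-- Summing the pointwise bound `moment_weight_le` over vectors representing x; by Parseval the
additive constant is multiplied by at most tr x. -/
theorem moment_gen_le {r D m : ℕ} (hr : 1 ≤ r) {Γ : ℝ} {G : ℕ → ℕ → ℂ} (hG : IsCoupling D r Γ G)
    (M : ℕ) {x : TraceClass b} (hx : 0 ≤ op x) :
    moment b (m + 1) M (gen b (r + 1) G M x) ≤
      -moment b (m + 1) M x + momentConst r D m * (1 + Γ) ^ (m + r + 1) * tr x := by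
  obtain ⟨v, hv⟩ := exists_hasSum_tr_conj hx
  have h1 := tr_conj_lindblad hv (diagOp b M (pw (m + 1))) (matOp b M (lowering (r + 1)))
    (matOp b M (drift (r + 1) G))
  have h2 := (hv (diagOp b M (pw (m + 1)))).neg.add
    ((hv 1).mul_left (momentConst r D m * (1 + Γ) ^ (m + r + 1)))
  rw [conj_one] at h2
  refine hasSum_le (fun n => ?_) h1 h2
  refine (weighted_form_le b (r + 1) M hG (pw_nonneg _) (v n)).trans ?_
  have h3 : (0 : ℝ) ≤ momentConst r D m * (1 + Γ) ^ (m + r + 1) := by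
    have := momentConst_pos r D m
    have := hG.nonneg
    positivity
  calc _ ≤ ∑ k ∈ Finset.range M, (-pw (m + 1) k + momentConst r D m * (1 + Γ) ^ (m + r + 1)) *
        ‖⟪b k, v n⟫_ℂ‖ ^ 2 := by
        refine Finset.sum_le_sum fun k _ => ?_
        exact mul_le_mul_of_nonneg_right (moment_weight_le hr hG M k) (sq_nonneg _)
    _ = -‖diagOp b M (pw (m + 1)) (v n)‖ ^ 2 + momentConst r D m * (1 + Γ) ^ (m + r + 1) *
          ∑ k ∈ Finset.range M, ‖⟪b k, v n⟫_ℂ‖ ^ 2 := by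
        rw [norm_diagOp_sq b M (pw_nonneg _), ← Finset.sum_neg_distrib, Finset.mul_sum,
          ← Finset.sum_add_distrib]
        exact Finset.sum_congr rfl fun k _ => by ring
    _ ≤ _ := by
        gcongr
        rw [one_apply_eq_self]
        exact sum_le_hasSum _ (fun _ _ => sq_nonneg _) (hasSum_norm_inner_sq b (v n))

/-- Gronwall with rate 1 bounds the moment by a convex combination of its initial value and the
constant, uniformly in the time and in M. -/
theorem moment_flow_le {r D m : ℕ} (hr : 1 ≤ r) {Γ : ℝ} {G : ℕ → ℕ → ℂ} (hG : IsCoupling D r Γ G)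
    (M : ℕ) {x : TraceClass b} (hx : 0 ≤ op x) {t : ℝ} (ht : 0 ≤ t) :
    moment b (m + 1) M (flow (gen b (r + 1) G M) t x) ≤
      max (moment b (m + 1) M x) (momentConst r D m * (1 + Γ) ^ (m + r + 1) * tr x) := by
  set κ := momentConst r D m * (1 + Γ) ^ (m + r + 1) * tr x
  have h := le_of_deriv_le_neg_mul_add (c := 1) (g := κ) one_pos
    (f := fun s => moment b (m + 1) M (flow (gen b (r + 1) G M) s x))
    (f' := fun s => moment b (m + 1) M (gen b (r + 1) G M (flow (gen b (r + 1) G M) s x)))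
    (fun s => (moment b (m + 1) M).hasFDerivAt.comp_hasDerivAt s (hasDerivAt_flow _ x s))
    (fun s hs => ?_) ht
  · refine h.trans ?_
    simp only [flow_zero, one_apply_eq_self]
    have h1 : Real.exp (-(1 * t)) ≤ 1 := Real.exp_le_one_iff.2 (by linarith)
    have h2 := Real.exp_pos (-(1 * t))
    have h3 := le_max_left (moment b (m + 1) M x) κ
    have h4 := le_max_right (moment b (m + 1) M x) κ
    rw [div_one]
    nlinarith
  · have h1 := moment_gen_le (m := m) hr hG M (flow_gen_nonneg (r + 1) G M hs hx)
    rw [tr_flow_gen (r + 1) M hG] at h1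
    linarith

end Generator

/-! ### Comparison of truncations and existence of the semigroups -/

section Truncation

variable {F : Type*} [NormedAddCommGroup F] [InnerProductSpace ℂ F]
  (b : HilbertBasis ℕ ℂ F)

/-- The part of the drift leading from indices below `M` to indices between `M` and `M'`. -/
def leak (G : ℕ → ℕ → ℂ) (M M' : ℕ) : F →L[ℂ] F :=
  matOp b M' fun n k => if k < M ∧ M ≤ n then -Complex.I * G n k else 0

theorem lowering_mul_proj (l : ℕ) {M M' : ℕ} (h : M ≤ M') :
    matOp b M' (lowering l) * proj b M = matOp b M (lowering l) := by
  refine op_ext (b := b) fun n k => ?_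
  rw [mul_apply_eq_comp, proj_basis, inner_matOp_basis]
  split_ifs with hk hnk hnk
  · rw [inner_matOp_basis, if_pos (by omega)]
  · rw [inner_matOp_basis]
    split_ifs
    · rw [lowering, if_neg (by omega)]
    · rfl
  · omega
  · rw [map_zero, inner_zero_right]

theorem drift_mul_proj (l : ℕ) (G : ℕ → ℕ → ℂ) {M M' : ℕ} (h : M ≤ M') :
    matOp b M' (drift l G) * proj b M = matOp b M (drift l G) + leak b G M M' := by
  refine op_ext (b := b) fun n k => ?_
  rw [mul_apply_eq_comp, proj_basis, add_apply, inner_add_right, leak, inner_matOp_basis,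
    inner_matOp_basis]
  by_cases hk : k < M
  · rw [if_pos hk, inner_matOp_basis]
    by_cases hn : n < M
    · rw [if_pos (by omega), if_pos (by omega), if_pos (by omega), if_neg (by omega), add_zero]
    · by_cases hn' : n < M'
      · rw [if_pos (by omega), if_neg (by omega), if_pos (by omega), if_pos (by omega), zero_add,
          drift, if_neg (by omega), sub_zero]
      · rw [if_neg (by omega), if_neg (by omega), if_neg (by omega), zero_add]
  · rw [if_neg hk, map_zero, inner_zero_right, if_neg (by omega), zero_add]
    split_ifs <;> first | rfl | omega

/-- An entry that crosses the index M within a band of width D has column index at least M - D, so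
one additional power of the weight k + 1 buys the factor 1/(M + 1). -/
theorem norm_leak_sq_le {D r : ℕ} {Γ : ℝ} {G : ℕ → ℕ → ℂ} (hG : IsCoupling D r Γ G) {M M' : ℕ}
    (h : M ≤ M') (v : F) :
    ‖leak b G M M' v‖ ^ 2 ≤ ((M : ℝ) + 1)⁻¹ *
      ((2 * D + 1) ^ 2 * Γ ^ 2 * ((D : ℝ) + 1) ^ (2 * r + 1)) *
        ‖diagOp b M (pw (2 * r + 1)) v‖ ^ 2 := by
  rw [leak, norm_matOp_sq, norm_diagOp_sq b M (pw_nonneg _)]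
  set B : ℕ → ℝ := fun k => if k < M then
    ((M : ℝ) + 1)⁻¹ * (Γ ^ 2 * ((D : ℝ) + 1) ^ (2 * r + 1)) * pw (2 * r + 1) k else 0 with hB
  have h1 := band_sum_le (D := D) (M := M') (Finset.range M') (a := fun _ => 1) (B := B)
    (h := fun n k => if k < M ∧ M ≤ n then -Complex.I * G n k else 0) (fun k => ⟪b k, v⟫_ℂ)
    (fun n k hnk => by rw [hG.band n k hnk]; simp) (fun _ => zero_le_one)
    (fun k => by
      simp only [hB]
      split_ifs
      · have := pw_nonneg (2 * r + 1) k; positivity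
      · exact le_rfl)
    (fun n _ k _ h3 h4 => by
      simp only [hB, one_mul]
      by_cases hk : k < M
      · rw [if_pos hk]
        by_cases hn : M ≤ n
        · rw [if_pos ⟨hk, hn⟩, norm_mul, norm_neg, Complex.norm_I, one_mul]
          have h5 := near_cast_le h3
          have h6 : (M : ℝ) + 1 ≤ ((D : ℝ) + 1) * ((k : ℝ) + 1) :=
            near_cast_le (by omega)
          rw [mul_assoc, ← div_eq_inv_mul, le_div_iff₀ (by positivity)]
          calc ‖G n k‖ ^ 2 * ((M : ℝ) + 1) ≤ (Γ * ((n : ℝ) + 1) ^ r) ^ 2 * ((M : ℝ) + 1) := by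
                gcongr; exact hG.bound n k
            _ ≤ (Γ * (((D : ℝ) + 1) * ((k : ℝ) + 1)) ^ r) ^ 2 *
                  (((D : ℝ) + 1) * ((k : ℝ) + 1)) := by
                have := hG.nonneg
                gcongr
            _ = Γ ^ 2 * ((D : ℝ) + 1) ^ (2 * r + 1) * pw (2 * r + 1) k := by
                unfold pw; simp only [mul_pow]; ring
        · rw [if_neg (by omega), norm_zero, zero_pow two_ne_zero]
          have := pw_nonneg (2 * r + 1) k
          positivity
      · rw [if_neg hk, if_neg (by omega)]; simp)
  simp only [one_mul] at h1
  refine h1.trans (le_of_eq ?_)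
  have h2 : ∑ k ∈ Finset.range M', B k * ‖⟪b k, v⟫_ℂ‖ ^ 2 =
      ∑ k ∈ Finset.range M, B k * ‖⟪b k, v⟫_ℂ‖ ^ 2 := by
    refine (Finset.sum_subset (Finset.range_mono h) fun k _ hk => ?_).symm
    simp only [hB]
    rw [if_neg (by simpa using hk), zero_mul]
  rw [h2, Finset.mul_sum, Finset.mul_sum]
  refine Finset.sum_congr rfl fun k hk => ?_
  simp only [hB]
  rw [if_pos (Finset.mem_range.1 hk)]
  ring

/-- Band matrices with entries of order `d / 2` are bounded relative to weights. -/
theorem norm_weighted_band_sq_le {D d q : ℕ} {B : ℝ} {h : ℕ → ℕ → ℂ} (hB : 0 ≤ B)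
    (hband : ∀ n k, n + D < k ∨ k + D < n → h n k = 0)
    (hle : ∀ n k, ‖h n k‖ ^ 2 ≤ B * ((n : ℝ) + 1) ^ d) (M : ℕ) (v : F) :
    ‖diagOp b M (pw q) (matOp b M h v)‖ ^ 2 ≤
      ((2 * D + 1) ^ 2 * (B * ((D : ℝ) + 1) ^ (q + d))) *
        ‖diagOp b M (pw (q + d)) v‖ ^ 2 := by
  rw [norm_diagOp_sq b M (pw_nonneg _), norm_diagOp_sq b M (pw_nonneg _)]
  have h1 := band_sum_le (D := D) (M := M) (Finset.range M) (a := pw q)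
    (B := fun k => B * ((D : ℝ) + 1) ^ (q + d) * pw (q + d) k)
    (h := h) (fun k => ⟪b k, v⟫_ℂ) hband (pw_nonneg q)
    (fun k => by have := pw_nonneg (q + d) k; positivity)
    (fun n _ k _ h3 h4 => by
      have h5 := near_cast_le h3
      calc pw q n * ‖h n k‖ ^ 2 ≤ pw q n * (B * ((n : ℝ) + 1) ^ d) :=
            mul_le_mul_of_nonneg_left (hle n k) (pw_nonneg q n)
        _ = B * ((n : ℝ) + 1) ^ (q + d) := by unfold pw; ring
        _ ≤ B * (((D : ℝ) + 1) * ((k : ℝ) + 1)) ^ (q + d) := by gcongr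
        _ = _ := by unfold pw; rw [mul_pow]; ring)
  have h2 : ∀ n ∈ Finset.range M, pw q n * ‖⟪b n, matOp b M h v⟫_ℂ‖ ^ 2 =
      pw q n * ‖∑ k ∈ Finset.range M, h n k * ⟪b k, v⟫_ℂ‖ ^ 2 := fun n hn => by
    rw [inner_matOp, if_pos (Finset.mem_range.1 hn)]
  rw [Finset.sum_congr rfl h2]
  refine h1.trans (le_of_eq ?_)
  rw [Finset.mul_sum, Finset.mul_sum]
  exact Finset.sum_congr rfl fun k _ => by ring

variable [CompleteSpace F] {b}

open TraceClass

/-- On a block below M the lowering operators of both cuts coincide, so only the leak of the drift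
remains. -/
theorem gen_sub_gen (l : ℕ) (G : ℕ → ℕ → ℂ) {M M' : ℕ} (h : M ≤ M') {x : TraceClass b}
    (hx : conj (proj b M) x = x) :
    (gen b l G M' - gen b l G M) x = cross (leak b G M M') 1 x := by
  refine op_injective ?_
  change op (gen b l G M' x - gen b l G M x) = _
  rw [map_sub, gen, gen, op_lindblad, op_lindblad, op_cross, star_one, one_mul, mul_one]
  have h1 : proj b M * op x * proj b M = op x := by
    have := congrArg op hx
    rwa [op_conj, star_proj] at this
  have hA := lowering_mul_proj b l h
  have hK := drift_mul_proj b l G h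
  have hA' : matOp b M' (lowering l) * op x * star (matOp b M' (lowering l)) =
      matOp b M (lowering l) * op x * star (matOp b M (lowering l)) := by
    conv_rhs => rw [← hA, star_mul, star_proj]
    conv_lhs => rw [← h1]
    noncomm_ring
  have hp : proj b M * op x = op x := by
    rw [← h1, ← mul_assoc, ← mul_assoc, proj_mul_proj b le_rfl]
  have hp' : op x * proj b M = op x := by
    rw [← h1, mul_assoc, proj_mul_proj b le_rfl]
  have hK' : matOp b M' (drift l G) * op x =
      matOp b M (drift l G) * op x + leak b G M M' * op x := by
    rw [← add_mul, ← hK, mul_assoc, hp]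
  have hK'' : op x * star (matOp b M' (drift l G)) =
      op x * star (matOp b M (drift l G)) + op x * star (leak b G M M') := by
    rw [← mul_add, ← star_add, ← hK, star_mul, star_proj, ← mul_assoc, hp']
  rw [hA', hK', hK'']
  abel

/-- The parameter √(M+1) in `norm_cross_le` balances the leak, which is O(1/(M+1)) relative to the
moment, against the trace. -/
theorem norm_gen_sub_gen_le (l : ℕ) {D r : ℕ} {Γ : ℝ} {G : ℕ → ℕ → ℂ} (hG : IsCoupling D r Γ G)
    {M M' : ℕ} (h : M ≤ M') {x : TraceClass b} (hx0 : 0 ≤ op x) (hx : conj (proj b M) x = x) :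
    ‖(gen b l G M' - gen b l G M) x‖ ≤ (√((M : ℝ) + 1))⁻¹ *
      (((2 * D + 1) ^ 2 * Γ ^ 2 * ((D : ℝ) + 1) ^ (2 * r + 1)) * moment b (2 * r + 1) M x + tr x) := by
  rw [gen_sub_gen l G h hx]
  have hs : 0 < √((M : ℝ) + 1) := Real.sqrt_pos.2 (by positivity)
  refine (norm_cross_le hx0 _ _ hs).trans ?_
  rw [conj_one, mul_add]
  refine add_le_add ?_ le_rfl
  have h1 := tr_conj_le hx0 (norm_leak_sq_le b hG h)
  refine (mul_le_mul_of_nonneg_left h1 hs.le).trans (le_of_eq ?_)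
  have h2 : √((M : ℝ) + 1) * ((M : ℝ) + 1)⁻¹ = (√((M : ℝ) + 1))⁻¹ := by
    rw [← div_eq_mul_inv, Real.sqrt_div_self]
  rw [moment_apply, ← h2]
  ring

/-- The generator on elements with finitely many matrix coefficients is given by every
sufficiently late truncation. -/
theorem gen_eq_gen (l : ℕ) {D : ℕ} {G : ℕ → ℕ → ℂ}
    (hband : ∀ n k, n + D < k ∨ k + D < n → G n k = 0)
    {M₀ M M' : ℕ} (h0 : M₀ + D ≤ M) (h : M ≤ M') {x : TraceClass b}
    (hx : conj (proj b M₀) x = x) : gen b l G M' x = gen b l G M x := by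
  rw [← sub_eq_zero, ← sub_apply, gen_sub_gen l G h (block_mono (by omega) hx)]
  refine op_injective ?_
  have h1 : leak b G M M' * proj b M₀ = 0 := by
    refine op_ext (b := b) fun n k => ?_
    rw [mul_apply_eq_comp, proj_basis]
    split_ifs with hk
    · rw [leak, inner_matOp_basis, hband n k |> fun h => if_congr Iff.rfl
        (show (if k < M ∧ M ≤ n then -Complex.I * G n k else 0) = 0 from ?_) rfl]
      · simp
      · split_ifs with hn
        · rw [hband n k (by omega), mul_zero]
        · rfl
    · simp
  have h2 : op x = proj b M₀ * op x * proj b M₀ := by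
    have := congrArg op hx
    rw [op_conj, star_proj] at this
    exact this.symm
  have h3 : leak b G M M' * op x = 0 := by
    rw [h2, ← mul_assoc, ← mul_assoc, h1, zero_mul, zero_mul]
  have h4 : op x * star (leak b G M M') = 0 := by
    have := congrArg star h3
    rwa [star_mul, star_zero, x.isTraceSA.1.star_eq] at this
  rw [op_cross, star_one, mul_one, one_mul, h3, h4, map_zero, add_zero]

variable (b) in
/-- The elements with finitely many matrix coefficients. -/
def finiteBlocks : Submodule ℝ (TraceClass b) where
  carrier := {x | ∃ M, conj (proj b M) x = x}
  zero_mem' := ⟨0, map_zero _⟩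
  add_mem' := by
    rintro x y ⟨M, hM⟩ ⟨M', hM'⟩
    exact ⟨max M M', by rw [map_add, block_mono (le_max_left _ _) hM,
      block_mono (le_max_right _ _) hM']⟩
  smul_mem' := by
    rintro c x ⟨M, hM⟩
    exact ⟨M, by rw [map_smul, hM]⟩

open Classical in
variable (b) in
/-- The generator on elements with finitely many matrix coefficients. -/
def coreGen (l D : ℕ) (G : ℕ → ℕ → ℂ) (x : TraceClass b) : TraceClass b :=
  if h : ∃ M, conj (proj b M) x = x then gen b l G (h.choose + D) x else 0

theorem gen_eq_coreGen (l : ℕ) {D : ℕ} {G : ℕ → ℕ → ℂ}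
    (hband : ∀ n k, n + D < k ∨ k + D < n → G n k = 0)
    {M₀ M : ℕ} (h0 : M₀ + D ≤ M) {x : TraceClass b}
    (hx : conj (proj b M₀) x = x) : gen b l G M x = coreGen b l D G x := by
  have h : ∃ M, conj (proj b M) x = x := ⟨M₀, hx⟩
  rw [coreGen, dif_pos h]
  rw [← gen_eq_gen l hband h0 (le_max_left M (h.choose + D)) hx,
    gen_eq_gen l hband le_rfl (le_max_right M (h.choose + D)) h.choose_spec]

/-- Along an orbit of the cut generator that starts in a finite block, the moment of order 2r + 1 is
bounded uniformly in time and in M, so the discrepancy from later cuts is O(M^(-1/2)). -/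
theorem approximates_gen {r D : ℕ} (hr : 1 ≤ r) {Γ : ℝ} {G : ℕ → ℕ → ℂ}
    (hG : IsCoupling D r Γ G) :
    Approximates (gen b (r + 1) G) (finiteBlocks b) (coreGen b (r + 1) D G) where
  contraction M t x ht := norm_flow_lindblad_le (isConservative_gen (r + 1) M hG) x ht
  dense := fun x => mem_closure_of_tendsto (tendsto_conj_proj x)
    (Eventually.of_forall fun M => ⟨M, by rw [conj_conj, proj_mul_proj b le_rfl]⟩)
  eventually_eq := by
    rintro x ⟨M₀, hx⟩
    filter_upwards [eventually_ge_atTop (M₀ + D)] with M hM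
    exact gen_eq_coreGen (r + 1) hG.band hM hx
  mem := by
    rintro x ⟨M₀, hx⟩
    refine ⟨M₀ + D, ?_⟩
    rw [← gen_eq_coreGen (r + 1) hG.band le_rfl hx]
    exact gen_block _ _ (block_mono (by omega) hx)
  error := by
    rintro x ⟨M₀, hx⟩
    set C : ℝ := (2 * D + 1) ^ 2 * Γ ^ 2 * ((D : ℝ) + 1) ^ (2 * r + 1)
    have hC : 0 ≤ C := by positivity
    set κ : TraceClass b → ℝ := fun y => C * max (moment b (2 * r + 1) M₀ y)
      (momentConst r D (2 * r) * (1 + Γ) ^ (2 * r + r + 1) * tr y) + tr y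
    have key : ∀ y : TraceClass b, 0 ≤ op y → conj (proj b M₀) y = y → ∀ M ≥ M₀, ∀ t, 0 ≤ t →
        ∀ M' ≥ M, ‖(gen b (r + 1) G M' - gen b (r + 1) G M) (flow (gen b (r + 1) G M) t y)‖ ≤
          (√((M : ℝ) + 1))⁻¹ * κ y := by
      intro y hy0 hy M hM t ht M' hM'
      have hyM := block_mono hM hy
      refine (norm_gen_sub_gen_le (r + 1) hG hM' (flow_gen_nonneg _ _ _ ht hy0)
        (flow_gen_block _ _ hyM t)).trans ?_
      rw [tr_flow_gen (r + 1) M hG]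
      have h1 := moment_flow_le (m := 2 * r) hr hG M hy0 ht
      rw [moment_of_block (2 * r + 1) hM hy] at h1
      gcongr
      exact add_le_add (mul_le_mul_of_nonneg_left h1 hC) le_rfl
    -- Compressing the positive and negative parts makes them finite blocks at once; their
    -- difference is still x because x equals its own compression.
    set x₁ := conj (proj b M₀) x.pos
    set x₂ := conj (proj b M₀) x.neg
    have hb : ∀ y : TraceClass b, conj (proj b M₀) (conj (proj b M₀) y) = conj (proj b M₀) y :=
      fun y => by rw [conj_conj, proj_mul_proj b le_rfl]
    have e : x = x₁ - x₂ := by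
      rw [← map_sub, pos_sub_neg, hx]
    refine ⟨fun M => (√((M : ℝ) + 1))⁻¹ * (κ x₁ + κ x₂), ?_, ?_⟩
    · have h1 : Tendsto (fun M : ℕ => √((M : ℝ) + 1)) atTop atTop :=
        Real.tendsto_sqrt_atTop.comp
          (tendsto_atTop_add_const_right _ 1 tendsto_natCast_atTop_atTop)
      simpa using h1.inv_tendsto_atTop.mul_const (κ x₁ + κ x₂)
    · filter_upwards [eventually_ge_atTop M₀] with M hM t ht
      refine ⟨⟨M, flow_gen_block _ _ (block_mono hM hx) t⟩, fun M' hM' => ?_⟩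
      rw [e, map_sub, map_sub, mul_add]
      refine (norm_sub_le _ _).trans (add_le_add ?_ ?_)
      · exact key x₁ (op_conj_nonneg _ x.op_pos_nonneg) (hb _) M hM t ht M' hM'
      · exact key x₂ (op_conj_nonneg _ x.op_neg_nonneg) (hb _) M hM t ht M' hM'

end Truncation

/-! ### Exponential decay of the expectation of L† L -/

section Decay

/-- The matrix of `(i / 2) (β a†^l - conj β a^l)`. -/
def drive (l : ℕ) (β : ℂ) (n k : ℕ) : ℂ :=
  Complex.I / 2 * (β * lowering l k n - (starRingEnd ℂ) β * lowering l n k)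

theorem conj_lowering (l n k : ℕ) : (starRingEnd ℂ) (lowering l n k) = lowering l n k := by
  rw [lowering]
  split_ifs
  · exact Complex.conj_ofReal _
  · exact map_zero _

/-- After division by l! this says that the binomial coefficients (k choose l) and (k + l choose l)
differ by at least 1, which is Pascal's rule. It is the lower bound l! for the commutator of a^l and
a†^l, and the source of the decay rate. -/
theorem descFactorial_add_factorial_le (l k : ℕ) (hl : 1 ≤ l) :
    k.descFactorial l + l.factorial ≤ (k + l).descFactorial l := by
  rw [Nat.descFactorial_eq_factorial_mul_choose, Nat.descFactorial_eq_factorial_mul_choose,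
    ← Nat.mul_succ]
  refine Nat.mul_le_mul_left _ ?_
  rcases lt_or_ge k l with h | h
  · rw [Nat.choose_eq_zero_of_lt h]
    exact Nat.choose_pos (Nat.le_add_left l k)
  · obtain ⟨m, rfl⟩ := Nat.exists_eq_add_of_le' hl
    calc k.choose (m + 1) + 1 ≤ k.choose m + k.choose (m + 1) := by
          have := Nat.choose_pos (show m ≤ k by omega); omega
      _ = (k + 1).choose (m + 1) := (Nat.choose_succ_succ k m).symm
      _ ≤ _ := Nat.choose_le_choose _ (by omega)

variable {F : Type*} [NormedAddCommGroup F] [InnerProductSpace ℂ F]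
  (b : HilbertBasis ℕ ℂ F)

theorem norm_lowering_sq (l M : ℕ) (v : F) :
    ‖matOp b M (lowering l) v‖ ^ 2 =
      ∑ k ∈ Finset.range M, k.descFactorial l * ‖⟪b k, v⟫_ℂ‖ ^ 2 := by
  have h := norm_diagOp_lowering_sq b l M (w := fun _ => 1) (fun _ => zero_le_one) v
  change ‖proj b M _‖ ^ 2 = _ at h
  rw [← mul_apply_eq_comp, proj_mul_matOp b le_rfl] at h
  simpa using h

theorem sum_raising (l M : ℕ) {n : ℕ} (hn : n < M) (c : ℕ → ℂ) :
    ∑ k ∈ Finset.range M, (starRingEnd ℂ) (lowering l k n) * c k =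
      if l ≤ n then ((√(n.descFactorial l : ℝ) : ℝ) : ℂ) * c (n - l) else 0 := by
  simp only [conj_lowering]
  split_ifs with h
  · rw [Finset.sum_eq_single (n - l)]
    · rw [lowering, if_pos (by omega)]
    · intro k _ hk
      rw [lowering, if_neg (by omega), zero_mul]
    · intro h0
      exact absurd (Finset.mem_range.2 (by omega)) h0
  · refine Finset.sum_eq_zero fun k _ => ?_
    rw [lowering, if_neg (by omega), zero_mul]

/-- The truncated jump operator. -/
def jumpOp (l : ℕ) (β : ℂ) (M : ℕ) : F →L[ℂ] F := matOp b M (lowering l) - β • 1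

theorem inner_jumpOp (l : ℕ) (β : ℂ) (M : ℕ) (v : F) (k : ℕ) :
    ⟪b k, jumpOp b l β M v⟫_ℂ = (if k + l < M then
      ((√((k + l).descFactorial l : ℝ) : ℝ) : ℂ) * ⟪b (k + l), v⟫_ℂ else 0) -
        β * ⟪b k, v⟫_ℂ := by
  rw [jumpOp, sub_apply, smul_apply, one_apply_eq_self, inner_sub_right, inner_smul_right,
    inner_matOp]
  congr 1
  split_ifs with h1 h2 h2
  · rw [sum_lowering, if_pos h2]
  · rw [sum_lowering, if_neg h2]
  · omega
  · rfl

variable [CompleteSpace F]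

theorem star_lowering_mul_lowering (l M : ℕ) :
    star (matOp b M (lowering l)) * matOp b M (lowering l) =
      matOp b M fun n k => if n = k then ((n.descFactorial l : ℝ) : ℂ) else 0 := by
  refine op_ext (b := b) fun n k => ?_
  rw [mul_apply_eq_comp, star_matOp, inner_matOp, inner_matOp_basis]
  by_cases hn : n < M
  · rw [if_pos hn, sum_raising l M hn]
    by_cases hl : l ≤ n
    · rw [if_pos hl, inner_matOp_basis]
      by_cases hk : k < M
      · rw [if_pos (by omega), if_pos (by omega), lowering]
        by_cases e : n = k
        · subst e
          rw [if_pos (by omega), if_pos rfl, ← Complex.ofReal_mul,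
            Real.mul_self_sqrt (Nat.cast_nonneg _)]
        · rw [if_neg (by omega), if_neg e, mul_zero]
      · rw [if_neg (by omega), if_neg (by omega), mul_zero]
    · rw [if_neg hl, Nat.descFactorial_of_lt (by omega)]; simp
  · rw [if_neg hn, if_neg (by omega)]

theorem norm_star_lowering_sq (l M : ℕ) (v : F) :
    ‖star (matOp b M (lowering l)) v‖ ^ 2 =
      ∑ k ∈ Finset.range M, if k + l < M then
        (k + l).descFactorial l * ‖⟪b k, v⟫_ℂ‖ ^ 2 else 0 := by
  rw [star_matOp, norm_matOp_sq]
  have h := sum_range_shift l M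
    (f := fun n => if l ≤ n then (n.descFactorial l : ℝ) * ‖⟪b (n - l), v⟫_ℂ‖ ^ 2 else 0)
    (fun k hk => if_neg (not_le.2 hk))
  have h1 : ∀ k ∈ Finset.range M, (if k + l < M then
        ((k + l).descFactorial l : ℝ) * ‖⟪b k, v⟫_ℂ‖ ^ 2 else 0) =
      if k + l < M then (if l ≤ k + l then ((k + l).descFactorial l : ℝ) *
        ‖⟪b (k + l - l), v⟫_ℂ‖ ^ 2 else 0) else 0 := fun k _ => by
    rw [if_pos (Nat.le_add_left l k), Nat.add_sub_cancel]
  rw [Finset.sum_congr rfl h1, h]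
  refine Finset.sum_congr rfl fun n hn => ?_
  rw [sum_raising l M (Finset.mem_range.1 hn)]
  split_ifs
  · rw [norm_mul, mul_pow, Complex.norm_real, Real.norm_of_nonneg (Real.sqrt_nonneg _),
      Real.sq_sqrt (Nat.cast_nonneg _)]
  · simp

theorem drift_drive (l : ℕ) (β : ℂ) (M : ℕ) :
    matOp b M (drift l (drive l β)) =
      (β / 2) • star (matOp b M (lowering l)) - ((starRingEnd ℂ) β / 2) • matOp b M (lowering l)
        - (1 / 2 : ℂ) • (star (matOp b M (lowering l)) * matOp b M (lowering l)) := by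
  rw [star_lowering_mul_lowering, star_matOp]
  refine op_ext (b := b) fun n k => ?_
  simp only [sub_apply, smul_apply, inner_sub_right, inner_smul_right, inner_matOp_basis]
  by_cases h : n < M ∧ k < M
  · have hI : Complex.I * Complex.I = -1 := Complex.I_mul_I
    simp only [if_pos h, drift, drive, conj_lowering]
    by_cases e : n = k
    · rw [if_pos e, if_pos e]
      push_cast
      linear_combination (-(1 / 2 : ℂ)) * (β * lowering l k n -
        (starRingEnd ℂ) β * lowering l n k) * hI
    · rw [if_neg e, if_neg e]
      linear_combination (-(1 / 2 : ℂ)) * (β * lowering l k n -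
        (starRingEnd ℂ) β * lowering l n k) * hI
  · simp only [if_neg h, mul_zero, sub_zero]

open TraceClass

/-- Expanding the dissipator of A - β, the terms linear in β form a commutator and those with |β|²
cancel. The shift of the jump operator is thus a Hamiltonian drive, exactly so even after the cut.
-/
theorem gen_drive (l : ℕ) (β : ℂ) (M : ℕ) :
    gen b l (drive l β) M = lindblad b (jumpOp b l β M)
      (-((1 / 2 : ℂ) • (star (jumpOp b l β M) * jumpOp b l β M))) := by
  refine ContinuousLinearMap.ext fun x => op_injective ?_
  rw [gen, op_lindblad, op_lindblad, drift_drive, jumpOp]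
  set A := matOp b M (lowering l)
  simp only [star_sub, star_smul, star_mul, star_neg, star_star, star_one, RCLike.star_def,
    map_div₀, map_one, map_ofNat, Complex.conj_conj, mul_sub, sub_mul, smul_mul_assoc,
    mul_smul_comm, mul_one, one_mul, smul_sub, smul_smul, neg_mul, mul_neg, mul_assoc]
  module

/-- With u = L v the form is ‖L u‖² - ‖L† u‖², the commutator of L and L† at u, in which the scalar
shift by β cancels. -/
theorem jump_form (l : ℕ) (β : ℂ) (M : ℕ) (v : F) :
    ‖jumpOp b l β M (jumpOp b l β M v)‖ ^ 2 + 2 * RCLike.re ⟪jumpOp b l β M v,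
      jumpOp b l β M ((-((1 / 2 : ℂ) • (star (jumpOp b l β M) * jumpOp b l β M))) v)⟫_ℂ =
    ‖matOp b M (lowering l) (jumpOp b l β M v)‖ ^ 2 -
      ‖star (matOp b M (lowering l)) (jumpOp b l β M v)‖ ^ 2 := by
  set L := jumpOp b l β M with hL
  set u := L v
  set A := matOp b M (lowering l) with hA
  have h1 : L ((-((1 / 2 : ℂ) • (star L * L))) v) = -((1 / 2 : ℂ) • L (star L u)) := by
    rw [neg_apply, smul_apply, mul_apply_eq_comp, map_neg, map_smul]
  have h2 : ⟪u, L (star L u)⟫_ℂ = ((‖star L u‖ ^ 2 : ℝ) : ℂ) := by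
    rw [ContinuousLinearMap.star_eq_adjoint, ← ContinuousLinearMap.adjoint_inner_left,
      inner_self_eq_norm_sq_to_K]
    push_cast; rfl
  have h3 : RCLike.re ⟪u, -((1 / 2 : ℂ) • L (star L u))⟫_ℂ = -(‖star L u‖ ^ 2 / 2) := by
    rw [inner_neg_right, inner_smul_right, h2]
    have : -((1 / 2 : ℂ) * ((‖star L u‖ ^ 2 : ℝ) : ℂ)) = ((-(‖star L u‖ ^ 2 / 2) : ℝ) : ℂ) := by
      push_cast; ring
    rw [this]; exact Complex.ofReal_re _
  rw [h1, h3]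
  have h4 : L u = A u - β • u := by
    rw [hL, jumpOp, sub_apply, smul_apply, one_apply_eq_self]
  have h5 : star L u = star A u - (starRingEnd ℂ) β • u := by
    rw [hL, jumpOp, star_sub, star_smul, star_one, sub_apply, smul_apply, one_apply_eq_self]
    rfl
  have h6 : RCLike.re ⟪star A u, (starRingEnd ℂ) β • u⟫_ℂ = RCLike.re ⟪A u, β • u⟫_ℂ := by
    rw [inner_smul_right, inner_smul_right, ContinuousLinearMap.star_eq_adjoint,
      ContinuousLinearMap.adjoint_inner_left, ← inner_conj_symm u, ← map_mul, RCLike.conj_re]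
  rw [h4, h5, @norm_sub_sq ℂ, @norm_sub_sq ℂ, h6, norm_smul, norm_smul, RCLike.norm_conj]
  ring

/-- The cut commutator is at least l! on coordinates k with k + l < M. On the remaining ones the
lowering part of L v vanishes, so the coordinate is -β v_k, and M + 1 ≤ (l+1)(k+1) trades one more
power of the weight for the factor 1/(M+1). -/
theorem jump_form_le (l : ℕ) (hl : 1 ≤ l) (β : ℂ) {M : ℕ} {v : F} (hv : proj b M v = v) :
    ‖matOp b M (lowering l) (jumpOp b l β M v)‖ ^ 2 -
      ‖star (matOp b M (lowering l)) (jumpOp b l β M v)‖ ^ 2 ≤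
    -(l.factorial : ℝ) * ‖jumpOp b l β M v‖ ^ 2 +
      ((1 + l.factorial) * (l + 1) * ‖β‖ ^ 2) * ((M : ℝ) + 1)⁻¹ *
        ‖diagOp b M (pw (l + 1)) v‖ ^ 2 := by
  have hv' := (proj_eq_self_iff b).1 hv
  rw [norm_lowering_sq, norm_star_lowering_sq, norm_diagOp_sq b M (pw_nonneg _),
    norm_sq_eq_sum b (M := M) (v := jumpOp b l β M v) (fun n hn => by
      rw [inner_jumpOp, if_neg (by omega), hv' n hn, mul_zero, sub_zero]),
    Finset.mul_sum, Finset.mul_sum, ← Finset.sum_sub_distrib, ← Finset.sum_add_distrib]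
  refine Finset.sum_le_sum fun k hk => ?_
  by_cases h : k + l < M
  · rw [if_pos h]
    have h1 : (k.descFactorial l : ℝ) + l.factorial ≤ (k + l).descFactorial l := by
      exact_mod_cast descFactorial_add_factorial_le l k hl
    have h2 : 0 ≤ ((1 + l.factorial) * (l + 1) * ‖β‖ ^ 2) * ((M : ℝ) + 1)⁻¹ *
        (pw (l + 1) k * ‖⟪b k, v⟫_ℂ‖ ^ 2) := by
      have := pw_nonneg (l + 1) k
      positivity
    nlinarith [sq_nonneg ‖⟪b k, jumpOp b l β M v⟫_ℂ‖]
  · rw [if_neg h, inner_jumpOp, if_neg h, zero_sub, norm_neg, norm_mul]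
    have h1 : (k.descFactorial l : ℝ) ≤ ((k : ℝ) + 1) ^ l := by
      have : k.descFactorial l ≤ (k + 1) ^ l :=
        (Nat.descFactorial_le_pow k l).trans (Nat.pow_le_pow_left (by omega) l)
      exact_mod_cast this
    have h2 : (l.factorial : ℝ) ≤ l.factorial * ((k : ℝ) + 1) ^ l :=
      le_mul_of_one_le_right (by positivity)
        (one_le_pow₀ (by linarith [Nat.cast_nonneg (α := ℝ) k]))
    have h3 : (M : ℝ) + 1 ≤ ((l : ℝ) + 1) * ((k : ℝ) + 1) := near_cast_le (by omega)
    have h4 : ((k.descFactorial l : ℝ) + l.factorial) ≤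
        (1 + l.factorial) * (l + 1) * ((M : ℝ) + 1)⁻¹ * pw (l + 1) k := by
      have h5 : (1 : ℝ) ≤ ((l : ℝ) + 1) * ((k : ℝ) + 1) * ((M : ℝ) + 1)⁻¹ := by
        rw [← div_eq_mul_inv, le_div_iff₀ (by positivity), one_mul]; exact h3
      have h6 : 0 ≤ (1 + l.factorial) * ((k : ℝ) + 1) ^ l := by positivity
      calc ((k.descFactorial l : ℝ) + l.factorial) ≤ (1 + l.factorial) * ((k : ℝ) + 1) ^ l := by
            linarith
        _ ≤ (1 + l.factorial) * ((k : ℝ) + 1) ^ l *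
              (((l : ℝ) + 1) * ((k : ℝ) + 1) * ((M : ℝ) + 1)⁻¹) := le_mul_of_one_le_right h6 h5
        _ = _ := by unfold pw; ring
    have h7 := mul_le_mul_of_nonneg_right h4
      (show 0 ≤ (‖β‖ * ‖⟪b k, v⟫_ℂ‖) ^ 2 from sq_nonneg _)
    nlinarith [h7]

variable {b}

theorem tr_jump_gen_le (l : ℕ) (hl : 1 ≤ l) (β : ℂ) {M : ℕ} {x : TraceClass b} (hx : 0 ≤ op x)
    (hM : conj (proj b M) x = x) :
    tr (conj (jumpOp b l β M) (gen b l (drive l β) M x)) ≤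
      -(l.factorial : ℝ) * tr (conj (jumpOp b l β M) x) +
        ((1 + l.factorial) * (l + 1) * ‖β‖ ^ 2) * ((M : ℝ) + 1)⁻¹ * moment b (l + 1) M x := by
  obtain ⟨v, hv, hs⟩ := exists_hasSum_tr_conj_block hx hM
  rw [gen_drive]
  refine hasSum_le (fun n => ?_) (tr_conj_lindblad hs (jumpOp b l β M) (jumpOp b l β M)
    (-((1 / 2 : ℂ) • (star (jumpOp b l β M) * jumpOp b l β M))))
    (((hs (jumpOp b l β M)).mul_left (-(l.factorial : ℝ))).add
      ((hs (diagOp b M (pw (l + 1)))).mul_left _))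
  rw [jump_form]
  exact jump_form_le b l hl β (hv n)

/-- Exponential decay of the expectation of `L† L`, up to an error from the truncation. -/
theorem tr_jump_flow_le (l : ℕ) (hl : 1 ≤ l) (β : ℂ) {M : ℕ} {x : TraceClass b} (hx : 0 ≤ op x)
    (hM : conj (proj b M) x = x) {R : ℝ}
    (hR : ∀ s, 0 ≤ s → moment b (l + 1) M (flow (gen b l (drive l β) M) s x) ≤ R) {t : ℝ}
    (ht : 0 ≤ t) :
    tr (conj (jumpOp b l β M) (flow (gen b l (drive l β) M) t x)) ≤
      Real.exp (-(l.factorial * t)) * tr (conj (jumpOp b l β M) x) +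
        ((1 + l.factorial) * (l + 1) * ‖β‖ ^ 2) * ((M : ℝ) + 1)⁻¹ * R := by
  set φ : TraceClass b →L[ℝ] ℝ := tr.comp (conj (jumpOp b l β M)) with hφ
  set A := gen b l (drive l β) M with hA
  set g : ℝ := ((1 + l.factorial) * (l + 1) * ‖β‖ ^ 2) * ((M : ℝ) + 1)⁻¹ * R with hg
  have hl0 : (0 : ℝ) < l.factorial := by exact_mod_cast l.factorial_pos
  have hl1 : (1 : ℝ) ≤ l.factorial := by exact_mod_cast l.factorial_pos
  have hR0 : 0 ≤ R := (moment_nonneg _ _ (flow_gen_nonneg l _ M le_rfl hx)).trans (hR 0 le_rfl)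
  have h := le_of_deriv_le_neg_mul_add (g := g) hl0 (f := fun s => φ (flow A s x))
    (f' := fun s => φ (A (flow A s x)))
    (fun s => φ.hasFDerivAt.comp_hasDerivAt s (hasDerivAt_flow A x s))
    (fun s hs => by
      refine (tr_jump_gen_le l hl β (flow_gen_nonneg l _ M hs hx)
        (flow_gen_block l _ hM s)).trans ?_
      rw [hg]
      have h0 : 0 ≤ ((1 + l.factorial) * (l + 1) * ‖β‖ ^ 2) * ((M : ℝ) + 1)⁻¹ := by positivity
      exact add_le_add le_rfl (mul_le_mul_of_nonneg_left (hR s hs) h0)) ht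
  refine h.trans ?_
  rw [flow_zero, one_apply_eq_self]
  have h1 : g / l.factorial * (1 - Real.exp (-(l.factorial * t))) ≤ g := by
    have hg0 : 0 ≤ g := by positivity
    have h2 : g / l.factorial ≤ g := div_le_self hg0 hl1
    have h3 := Real.exp_pos (-(l.factorial * t))
    have h4 : 0 ≤ g / l.factorial := by positivity
    nlinarith
  exact add_le_add le_rfl h1

end Decay

/-! ### Hamiltonian perturbations and the estimate for truncated flows -/

section Perturbation

/-- The entries grow like the power (r+1)/2, which is at most r exactly because r ≥ 1, that is l ≥
2. -/
theorem norm_lowering_le {r : ℕ} (hr : 1 ≤ r) (n k : ℕ) :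
    ‖lowering (r + 1) n k‖ ≤ ((r : ℝ) + 1) ^ r * ((n : ℝ) + 1) ^ r ∧
      ‖lowering (r + 1) k n‖ ≤ ((r : ℝ) + 1) ^ r * ((n : ℝ) + 1) ^ r := by
  have key : ∀ m : ℕ, (m : ℝ) ≤ ((r : ℝ) + 1) * ((n : ℝ) + 1) →
      √(m.descFactorial (r + 1) : ℝ) ≤ ((r : ℝ) + 1) ^ r * ((n : ℝ) + 1) ^ r := by
    intro m hm
    have h1 : (1 : ℝ) ≤ ((r : ℝ) + 1) * ((n : ℝ) + 1) := by
      have : (0 : ℝ) ≤ (r : ℝ) * n := by positivity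
      nlinarith [Nat.cast_nonneg (α := ℝ) r, Nat.cast_nonneg (α := ℝ) n]
    rw [← mul_pow, Real.sqrt_le_iff]
    refine ⟨by positivity, ?_⟩
    calc (m.descFactorial (r + 1) : ℝ) ≤ (m : ℝ) ^ (r + 1) := by
          exact_mod_cast Nat.descFactorial_le_pow m (r + 1)
      _ ≤ (((r : ℝ) + 1) * ((n : ℝ) + 1)) ^ (r + 1) := by gcongr
      _ ≤ (((r : ℝ) + 1) * ((n : ℝ) + 1)) ^ (r * 2) := pow_le_pow_right₀ h1 (by omega)
      _ = _ := pow_mul _ _ _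
  constructor
  · rw [lowering]
    split_ifs with h
    · rw [Complex.norm_real, Real.norm_of_nonneg (Real.sqrt_nonneg _)]
      refine key k ?_
      rw [← h]
      push_cast
      nlinarith [mul_nonneg (Nat.cast_nonneg (α := ℝ) r) (Nat.cast_nonneg (α := ℝ) n)]
    · rw [norm_zero]; positivity
  · rw [lowering]
    split_ifs with h
    · rw [Complex.norm_real, Real.norm_of_nonneg (Real.sqrt_nonneg _)]
      refine key n ?_
      nlinarith [mul_nonneg (Nat.cast_nonneg (α := ℝ) r) (Nat.cast_nonneg (α := ℝ) n),
        Nat.cast_nonneg (α := ℝ) r]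
    · rw [norm_zero]; positivity

theorem drive_herm (l : ℕ) (β : ℂ) (n k : ℕ) :
    (starRingEnd ℂ) (drive l β n k) = drive l β k n := by
  simp only [drive, map_mul, map_sub, map_div₀, Complex.conj_I, Complex.conj_conj, conj_lowering,
    map_ofNat]
  ring

theorem drive_band {r : ℕ} (hr : 1 ≤ r) (β : ℂ) (n k : ℕ)
    (h : n + 2 * r < k ∨ k + 2 * r < n) : drive (r + 1) β n k = 0 := by
  rw [drive, lowering, lowering, if_neg (by omega), if_neg (by omega)]
  simp

theorem norm_drive_le {r : ℕ} (hr : 1 ≤ r) (β : ℂ) (n k : ℕ) :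
    ‖drive (r + 1) β n k‖ ≤ ((r : ℝ) + 1) ^ r * ‖β‖ * ((n : ℝ) + 1) ^ r := by
  obtain ⟨h1, h2⟩ := norm_lowering_le hr n k
  rw [drive, norm_mul, norm_div, Complex.norm_I]
  have h3 : ‖β * lowering (r + 1) k n - (starRingEnd ℂ) β * lowering (r + 1) n k‖ ≤
      ‖β‖ * (((r : ℝ) + 1) ^ r * ((n : ℝ) + 1) ^ r) +
        ‖β‖ * (((r : ℝ) + 1) ^ r * ((n : ℝ) + 1) ^ r) := by
    refine (norm_sub_le _ _).trans ?_
    rw [norm_mul, norm_mul, RCLike.norm_conj]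
    gcongr
  have h4 : ‖(2 : ℂ)‖ = 2 := by simp
  rw [h4]
  linarith

theorem isCoupling_drive {r : ℕ} (hr : 1 ≤ r) (β : ℂ) :
    IsCoupling (2 * r) r (((r : ℝ) + 1) ^ r * ‖β‖) (drive (r + 1) β) :=
  ⟨drive_herm _ β, drive_band hr β, norm_drive_le hr β⟩

/-- Hermitian band matrices with entries of order `d / 2`. -/
structure IsPerturbation (D d : ℕ) (B : ℝ) (H : ℕ → ℕ → ℂ) : Prop where
  herm : ∀ n k, (starRingEnd ℂ) (H n k) = H k n
  band : ∀ n k, n + D < k ∨ k + D < n → H n k = 0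
  bound : ∀ n k, ‖H n k‖ ^ 2 ≤ B ^ 2 * ((n : ℝ) + 1) ^ d

theorem isCoupling_drive_add {r d : ℕ} (hr : 1 ≤ r) (hd : d ≤ 2 * r) (β : ℂ) {B : ℝ} (hB : 0 ≤ B)
    {H : ℕ → ℕ → ℂ} (hH : IsPerturbation (2 * r) d B H) {ε : ℝ} (hε : 0 ≤ ε) :
    IsCoupling (2 * r) r (((r : ℝ) + 1) ^ r * ‖β‖ + ε * B)
      fun n k => drive (r + 1) β n k + ε * H n k where
  herm n k := by rw [map_add, map_mul, drive_herm, hH.herm, Complex.conj_ofReal]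
  band n k h := by rw [drive_band hr β n k h, hH.band n k h, mul_zero, add_zero]
  bound n k := by
    refine (norm_add_le _ _).trans ?_
    rw [add_mul, norm_mul, Complex.norm_real, Real.norm_of_nonneg hε, mul_assoc ε]
    refine add_le_add (norm_drive_le hr β n k) (mul_le_mul_of_nonneg_left ?_ hε)
    refine (sq_le_sq₀ (norm_nonneg _) (by positivity)).1 ((hH.bound n k).trans ?_)
    rw [mul_pow, ← pow_mul]
    gcongr
    · linarith [Nat.cast_nonneg (α := ℝ) n]
    · omega

variable {F : Type*} [NormedAddCommGroup F] [InnerProductSpace ℂ F]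
  (b : HilbertBasis ℕ ℂ F)

theorem norm_lowering_sq_le (l : ℕ) {R M : ℕ} (hR : R ≤ M) (v : F) :
    ‖matOp b R (lowering l) v‖ ^ 2 ≤ ‖diagOp b M (pw l) v‖ ^ 2 := by
  rw [norm_lowering_sq, norm_diagOp_sq b M (pw_nonneg l)]
  refine (Finset.sum_le_sum_of_subset_of_nonneg (Finset.range_mono hR)
    fun _ _ _ => by positivity).trans (Finset.sum_le_sum fun k _ => ?_)
  refine mul_le_mul_of_nonneg_right ?_ (sq_nonneg _)
  have : k.descFactorial l ≤ (k + 1) ^ l :=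
    (Nat.descFactorial_le_pow k l).trans (Nat.pow_le_pow_left (by omega) l)
  unfold pw
  exact_mod_cast this

theorem norm_le_norm_diagOp {M : ℕ} {v : F} (hv : proj b M v = v) (m : ℕ) :
    ‖v‖ ^ 2 ≤ ‖diagOp b M (pw m) v‖ ^ 2 := by
  rw [norm_diagOp_sq b M (pw_nonneg m), norm_sq_eq_sum b ((proj_eq_self_iff b).1 hv)]
  refine Finset.sum_le_sum fun k _ => le_mul_of_one_le_left (sq_nonneg _) ?_
  exact one_le_pow₀ (by linarith [Nat.cast_nonneg (α := ℝ) k])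

theorem norm_jumpOp_sq_le (l : ℕ) (β : ℂ) {R M : ℕ} (hR : R ≤ M) {v : F} (hv : proj b M v = v) :
    ‖jumpOp b l β R v‖ ^ 2 ≤ 2 * (1 + ‖β‖ ^ 2) * ‖diagOp b M (pw l) v‖ ^ 2 := by
  have h1 := norm_lowering_sq_le b l hR v
  have h2 := norm_le_norm_diagOp b hv l
  rw [jumpOp, sub_apply, smul_apply, one_apply_eq_self]
  have h3 : ‖matOp b R (lowering l) v - β • v‖ ≤ ‖matOp b R (lowering l) v‖ + ‖β‖ * ‖v‖ :=
    (norm_sub_le _ _).trans_eq (by rw [norm_smul])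
  have h4 := pow_le_pow_left₀ (norm_nonneg _) h3 2
  nlinarith [sq_nonneg (‖matOp b R (lowering l) v‖ - ‖β‖ * ‖v‖),
    mul_le_mul_of_nonneg_left h2 (sq_nonneg ‖β‖)]

/-- The two cuts differ by lowering applied to coordinates k ≥ R, where one more power of k + 1
yields the factor 1/(R+1). -/
theorem norm_jumpOp_sub_sq_le (l : ℕ) (β : ℂ) {R M : ℕ} (hR : R ≤ M) (v : F) :
    ‖(jumpOp b l β M - jumpOp b l β R) v‖ ^ 2 ≤
      ((R : ℝ) + 1)⁻¹ * ‖diagOp b M (pw (l + 1)) v‖ ^ 2 := by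
  have e : (jumpOp b l β M - jumpOp b l β R) v = matOp b M (lowering l) (v - proj b R v) := by
    rw [map_sub, ← mul_apply_eq_comp, lowering_mul_proj b l hR, jumpOp, jumpOp, sub_sub_sub_cancel_right,
      sub_apply]
  rw [e, norm_lowering_sq, norm_diagOp_sq b M (pw_nonneg _), Finset.mul_sum]
  refine Finset.sum_le_sum fun k _ => ?_
  rw [inner_sub_right, inner_proj]
  split_ifs with h
  · rw [sub_self]
    have := pw_nonneg (l + 1) k
    have h2 : (0 : ℝ) ≤ ((R : ℝ) + 1)⁻¹ * (pw (l + 1) k * ‖⟪b k, v⟫_ℂ‖ ^ 2) := by positivity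
    simpa using h2
  · rw [sub_zero, ← mul_assoc]
    refine mul_le_mul_of_nonneg_right ?_ (sq_nonneg _)
    rw [← div_eq_inv_mul, le_div_iff₀ (by positivity)]
    have h1 : (k.descFactorial l : ℝ) ≤ ((k : ℝ) + 1) ^ l := by
      have : k.descFactorial l ≤ (k + 1) ^ l :=
        (Nat.descFactorial_le_pow k l).trans (Nat.pow_le_pow_left (by omega) l)
      exact_mod_cast this
    have h2 : (R : ℝ) ≤ k := by exact_mod_cast not_lt.1 h
    unfold pw
    rw [pow_succ]
    gcongr

variable {b}

theorem matOp_drift_add (l M : ℕ) (G H : ℕ → ℕ → ℂ) (ε : ℝ) :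
    matOp b M (drift l fun n k => G n k + ε * H n k) =
      matOp b M (drift l G) + (ε : ℂ) • matOp b M (fun n k => -Complex.I * H n k) := by
  refine op_ext (b := b) fun n k => ?_
  rw [add_apply, smul_apply, inner_add_right, inner_smul_right, inner_matOp_basis,
    inner_matOp_basis, inner_matOp_basis]
  split_ifs
  · simp only [drift]; ring
  · simp

/-- The constant in the bound of a perturbation relative to weights. -/
def perturbConst (D q d : ℕ) : ℝ := (2 * D + 1) ^ 2 * ((D : ℝ) + 1) ^ (q + d)

theorem perturbConst_nonneg (D q d : ℕ) : 0 ≤ perturbConst D q d := by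
  unfold perturbConst; positivity

theorem norm_weighted_perturbation_sq_le {D d : ℕ} {B : ℝ} {H : ℕ → ℕ → ℂ}
    (hH : IsPerturbation D d B H) (q M : ℕ) (v : F) :
    ‖diagOp b M (pw q) (matOp b M (fun n k => -Complex.I * H n k) v)‖ ^ 2 ≤
      B ^ 2 * perturbConst D q d * ‖diagOp b M (pw (q + d)) v‖ ^ 2 := by
  refine (norm_weighted_band_sq_le b (D := D) (d := d) (B := B ^ 2) (sq_nonneg B)
    (fun n k h => by rw [hH.band n k h, mul_zero]) (fun n k => ?_) M v).trans (le_of_eq ?_)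
  · rw [norm_mul, norm_neg, Complex.norm_I, one_mul]
    exact hH.bound n k
  · unfold perturbConst; ring

variable [CompleteSpace F]

open TraceClass

theorem gen_perturbation (l M : ℕ) (G H : ℕ → ℕ → ℂ) (ε : ℝ) (x : TraceClass b) :
    (gen b l (fun n k => G n k + ε * H n k) M - gen b l G M) x =
      ε • cross (matOp b M (fun n k => -Complex.I * H n k)) 1 x := by
  refine op_injective ?_
  change op (gen b l (fun n k => G n k + ε * H n k) M x - gen b l G M x) = _
  rw [map_sub, map_smul, gen, gen, op_lindblad, op_lindblad, op_cross, matOp_drift_add,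
    ← Complex.coe_smul]
  set A := matOp b M (lowering l)
  set K := matOp b M (drift l G)
  set S := matOp b M (fun n k => -Complex.I * H n k)
  simp only [star_add, star_smul, star_one, RCLike.star_def, Complex.conj_ofReal, add_mul, mul_add,
    smul_mul_assoc, mul_smul_comm, mul_one, one_mul, smul_add]
  abel

/-- A positive element dominating the commutator with the perturbation. -/
def dominating (B : ℝ) (H : ℕ → ℕ → ℂ) (M : ℕ) (x : TraceClass b) : TraceClass b :=
  B⁻¹ • conj (matOp b M (fun n k => -Complex.I * H n k)) x + B • x

theorem dominating_between {B : ℝ} (hB : 0 < B) (H : ℕ → ℕ → ℂ) (M : ℕ) {x : TraceClass b}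
    (hx : 0 ≤ op x) :
    0 ≤ op (dominating B H M x + cross (matOp b M (fun n k => -Complex.I * H n k)) 1 x) ∧
      0 ≤ op (dominating B H M x - cross (matOp b M (fun n k => -Complex.I * H n k)) 1 x) := by
  have h := cross_between hx (matOp b M (fun n k => -Complex.I * H n k)) 1 (inv_pos.2 hB)
  rw [inv_inv, conj_one] at h
  exact h

theorem dominating_nonneg {B : ℝ} (hB : 0 < B) (H : ℕ → ℕ → ℂ) (M : ℕ) {x : TraceClass b}
    (hx : 0 ≤ op x) : 0 ≤ op (dominating B H M x) :=
  op_add_nonneg (op_smul_nonneg (inv_pos.2 hB).le (op_conj_nonneg _ hx)) (op_smul_nonneg hB.le hx)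

theorem dominating_block (B : ℝ) (H : ℕ → ℕ → ℂ) {M : ℕ} {x : TraceClass b}
    (hx : conj (proj b M) x = x) :
    conj (proj b M) (dominating B H M x) = dominating B H M x := by
  rw [dominating, map_add, map_smul, map_smul, conj_conj, proj_mul_matOp b le_rfl, hx]

/-- The quadratic term carries B² from the size of H and B⁻¹ from the definition, so the bound is
linear in B; this makes the final estimate linear in Λ. -/
theorem moment_dominating_le {D d : ℕ} {B : ℝ} (hB : 0 < B) {H : ℕ → ℕ → ℂ}
    (hH : IsPerturbation D d B H) (q M : ℕ) {x : TraceClass b} (hx : 0 ≤ op x) :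
    moment b q M (dominating B H M x) ≤
      B * (perturbConst D q d + 1) * moment b (q + d) M x := by
  have h1 : tr (conj (diagOp b M (pw q) * matOp b M (fun n k => -Complex.I * H n k)) x) ≤
      B ^ 2 * perturbConst D q d * tr (conj (diagOp b M (pw (q + d))) x) :=
    tr_conj_le hx fun v => norm_weighted_perturbation_sq_le hH q M v
  rw [← conj_conj] at h1
  have h2 := moment_mono (Nat.le_add_right q d) M hx
  rw [dominating, map_add, map_smul, map_smul, smul_eq_mul, smul_eq_mul]
  rw [← moment_apply, ← moment_apply] at h1
  have h3 : B⁻¹ * (B ^ 2 * perturbConst D q d * moment b (q + d) M x) =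
      B * perturbConst D q d * moment b (q + d) M x := by field_simp
  have h4 := mul_le_mul_of_nonneg_left h1 (inv_pos.2 hB).le
  have h5 := mul_le_mul_of_nonneg_left h2 hB.le
  linarith

theorem tr_jump_le (l : ℕ) (β : ℂ) {R M : ℕ} (hR : R ≤ M) {x : TraceClass b} (hx : 0 ≤ op x)
    (hM : conj (proj b M) x = x) :
    tr (conj (jumpOp b l β R) x) ≤ 2 * (1 + ‖β‖ ^ 2) * moment b l M x := by
  obtain ⟨v, hv, hs⟩ := exists_hasSum_tr_conj_block hx hM
  exact hasSum_le (fun n => norm_jumpOp_sq_le b l β hR (hv n)) (hs (jumpOp b l β R))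
    ((hs (diagOp b M (pw l))).mul_left _)

/-- Comparison of the truncated semigroups in the expectation of `L† L`. -/
theorem abs_tr_jump_flow_sub_le {r D d : ℕ} (hr : 1 ≤ r) (β : ℂ) {Γ₀ Γ B ε : ℝ} (hB : 0 < B)
    (hε : 0 ≤ ε) {H : ℕ → ℕ → ℂ} (h0 : IsCoupling D r Γ₀ (drive (r + 1) β))
    (hG : IsCoupling D r Γ fun n k => drive (r + 1) β n k + ε * H n k)
    (hH : IsPerturbation D d B H) {M : ℕ} {x : TraceClass b} (hx : 0 ≤ op x)
    (hM : conj (proj b M) x = x) {R : ℝ}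
    (hR : moment b (r + 1 + d + 2) M x ≤ R)
    (hR' : momentConst r D (r + 1 + d + 1) * (1 + Γ) ^ (r + 1 + d + 1 + r + 1) * tr x ≤ R)
    {t : ℝ} (ht : 0 ≤ t) :
    |tr (conj (jumpOp b (r + 1) β M) (flow (gen b (r + 1) (drive (r + 1) β) M) t x)) -
      tr (conj (jumpOp b (r + 1) β M) (flow (gen b (r + 1)
        (fun n k => drive (r + 1) β n k + ε * H n k) M) t x))| ≤
      ε * (2 * (1 + ‖β‖ ^ 2) * (B * (perturbConst D (r + 1) d + 1)) * R *
          (1 - Real.exp (-((r + 1).factorial * t))) +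
        ((M : ℝ) + 1)⁻¹ * ((1 + (r + 1).factorial) * ((r : ℝ) + 2) * ‖β‖ ^ 2 *
          ((1 + momentConst r D (r + 1) * (1 + Γ₀) ^ (r + 1 + r + 1)) *
            (B * (perturbConst D (r + 2) d + 1) * R))) * t) := by
  set A := gen b (r + 1) (drive (r + 1) β) M with hA
  set A' := gen b (r + 1) (fun n k => drive (r + 1) β n k + ε * H n k) M with hA'
  set φ : TraceClass b →L[ℝ] ℝ := tr.comp (conj (jumpOp b (r + 1) β M)) with hφ
  set μ : ℝ := ((r + 1).factorial : ℝ) with hμ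
  have hμ1 : 1 ≤ μ := by rw [hμ]; exact_mod_cast (r + 1).factorial_pos
  set c : ℝ := 2 * (1 + ‖β‖ ^ 2) * (B * (perturbConst D (r + 1) d + 1)) * R with hc
  set e : ℝ := ((M : ℝ) + 1)⁻¹ * ((1 + μ) * ((r : ℝ) + 2) * ‖β‖ ^ 2 *
          ((1 + momentConst r D (r + 1) * (1 + Γ₀) ^ (r + 1 + r + 1)) *
            (B * (perturbConst D (r + 2) d + 1) * R))) with he
  have hR0 : 0 ≤ R := (moment_nonneg _ _ hx).trans hR
  have hΓ₀ := h0.nonneg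
  have hp1 := perturbConst_nonneg D (r + 1) d
  have hp2 := perturbConst_nonneg D (r + 2) d
  have hm := (momentConst_pos r D (r + 1)).le
  have hc0 : 0 ≤ c := by positivity
  set σ : ℝ → TraceClass b := fun s => flow A' s x with hσ
  have key : ∀ s, 0 ≤ s → s ≤ t →
      |φ (flow A (t - s) ((A' - A) (σ s)))| ≤ ε * (c * Real.exp (-(μ * (t - s))) + e) := by
    intro s hs hst
    have hσ0 : 0 ≤ op (σ s) := flow_gen_nonneg _ _ _ hs hx
    have hσM : conj (proj b M) (σ s) = σ s := flow_gen_block _ _ hM s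
    have hmom : moment b (r + 1 + d + 2) M (σ s) ≤ R :=
      (moment_flow_le (m := r + 1 + d + 1) hr hG M hx hs).trans (max_le hR hR')
    set z := dominating B H M (σ s) with hz
    have hz0 : 0 ≤ op z := dominating_nonneg hB H M hσ0
    have hzM : conj (proj b M) z = z := dominating_block B H hσM
    set y := cross (matOp b M (fun n k => -Complex.I * H n k)) 1 (σ s) with hy
    have hts : 0 ≤ t - s := sub_nonneg.2 hst
    -- Both z + y and z - y are positive, and the unperturbed flow followed by φ is a positive
    -- functional, so y may be replaced by z before the decay is used.
    have h1 : |φ (flow A (t - s) y)| ≤ φ (flow A (t - s) z) := by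
      obtain ⟨h2, h3⟩ := dominating_between hB H M hσ0
      have h4 := tr_nonneg (op_conj_nonneg (jumpOp b (r + 1) β M)
        (flow_gen_nonneg (r + 1) (drive (r + 1) β) M hts h2))
      have h5 := tr_nonneg (op_conj_nonneg (jumpOp b (r + 1) β M)
        (flow_gen_nonneg (r + 1) (drive (r + 1) β) M hts h3))
      rw [map_add, map_add, map_add] at h4
      rw [map_sub, map_sub, map_sub] at h5
      have h6 : 0 ≤ φ (flow A (t - s) z) + φ (flow A (t - s) y) := h4
      have h7 : 0 ≤ φ (flow A (t - s) z) - φ (flow A (t - s) y) := h5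
      rw [abs_le]
      constructor <;> linarith
    have hmz : moment b (r + 2) M z ≤ B * (perturbConst D (r + 2) d + 1) * R := by
      refine (moment_dominating_le hB hH (r + 2) M hσ0).trans ?_
      refine mul_le_mul_of_nonneg_left ?_ (by positivity)
      exact (moment_mono (by omega) M hσ0).trans hmom
    -- On a block the trace is the moment of order 0; the moment bound along the flow of z contains
    -- tr z.
    have htz : tr z ≤ moment b (r + 2) M z := by
      rw [← moment_zero_of_block hzM]
      exact moment_mono (Nat.zero_le _) M hz0
    have hflow : ∀ u, 0 ≤ u → moment b (r + 1 + 1) M (flow A u z) ≤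
        (1 + momentConst r D (r + 1) * (1 + Γ₀) ^ (r + 1 + r + 1)) *
            (B * (perturbConst D (r + 2) d + 1) * R) := by
      intro u hu
      refine (moment_flow_le (m := r + 1) hr h0 M hz0 hu).trans ?_
      have h6 : 0 ≤ moment b (r + 2) M z := moment_nonneg _ _ hz0
      have h7 : 0 ≤ momentConst r D (r + 1) * (1 + Γ₀) ^ (r + 1 + r + 1) := by positivity
      refine max_le ?_ ?_
      · change moment b (r + 2) M z ≤ _
        nlinarith
      · have h8 := mul_le_mul_of_nonneg_left (htz.trans hmz) h7
        nlinarith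
    have h9 := tr_jump_flow_le (r + 1) (by omega) β hz0 hzM hflow hts
    have h10 : φ z ≤ c := by
      refine (tr_jump_le (r + 1) β le_rfl hz0 hzM).trans ?_
      rw [hc, mul_assoc _ _ R]
      refine mul_le_mul_of_nonneg_left ?_ (by positivity)
      refine (moment_dominating_le hB hH (r + 1) M hσ0).trans ?_
      refine mul_le_mul_of_nonneg_left ?_ (by positivity)
      exact (moment_mono (by omega) M hσ0).trans hmom
    rw [gen_perturbation, map_smul, map_smul, smul_eq_mul, abs_mul, abs_of_nonneg hε]
    refine mul_le_mul_of_nonneg_left (h1.trans (h9.trans ?_)) hε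
    refine add_le_add ?_ (le_of_eq ?_)
    · rw [mul_comm c]
      exact mul_le_mul_of_nonneg_left h10 (Real.exp_pos _).le
    · rw [he]; push_cast; ring
  have hexp : ∀ s, HasDerivAt (fun s => Real.exp (-(μ * (t - s)))) (Real.exp (-(μ * (t - s))) * μ) s := by
    intro s
    have h1 : HasDerivAt (fun s => -(μ * (t - s))) μ s := by
      convert! (((hasDerivAt_id s).const_sub t).const_mul μ).neg using 1
      ring
    exact h1.exp
  -- Duhamel in differential form: the comparison function is the antiderivative, vanishing at 0, of
  -- the bound in `key`. It yields the factor c/μ, of which 1/μ = 1/l! ≤ 1 is dropped below.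
  have h := image_norm_le_of_norm_deriv_right_le_deriv_boundary
    (f := fun s => φ (flow A (t - s) (σ s)) - φ (flow A t x))
    (f' := fun s => φ (flow A (t - s) ((A' - A) (σ s))))
    (B := fun s => ε * (c / μ * (Real.exp (-(μ * (t - s))) - Real.exp (-(μ * t))) + e * s))
    (B' := fun s => ε * (c * Real.exp (-(μ * (t - s))) + e)) (a := 0) (b := t) ?_ ?_ ?_ ?_ ?_
    (Set.right_mem_Icc.2 ht)
  · simp only [sub_self, mul_zero, neg_zero, Real.exp_zero, flow_zero, one_apply_eq_self,
      Real.norm_eq_abs] at h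
    rw [abs_sub_comm]
    refine h.trans (mul_le_mul_of_nonneg_left (add_le_add ?_ le_rfl) hε)
    refine mul_le_mul_of_nonneg_right (div_le_self hc0 hμ1) ?_
    rw [sub_nonneg, Real.exp_le_one_iff]
    nlinarith
  · exact fun s _ => ((φ.hasFDerivAt.comp_hasDerivAt s
      (hasDerivAt_flow_flow A A' x t s)).sub_const _).continuousAt.continuousWithinAt
  · exact fun s _ => ((φ.hasFDerivAt.comp_hasDerivAt s
      (hasDerivAt_flow_flow A A' x t s)).sub_const _).hasDerivWithinAt
  · simp [hσ, flow_zero]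
  · intro s
    have h1 := ((((hexp s).sub_const (Real.exp (-(μ * t)))).const_mul (c / μ)).add
      ((hasDerivAt_id s).const_mul e)).const_mul ε
    convert! h1 using 1
    field_simp
  · intro s hs
    rw [Real.norm_eq_abs]
    exact key s hs.1 hs.2.le

end Perturbation

/-! ### Passing to the limit in the jump expectations -/

section Limits

theorem cauchySeq_of_approx {E : Type*} [SeminormedAddCommGroup E] {f : ℕ → E} {g : ℕ → ℕ → E}
    {η : ℕ → ℝ} (hη : Tendsto η atTop (𝓝 0)) (hg : ∀ R, CauchySeq (g R))
    (h : ∀ R, ∀ M ≥ R, ‖f M - g R M‖ ≤ η R) : CauchySeq f := by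
  rw [Metric.cauchySeq_iff]
  intro ε hε
  obtain ⟨R, hR⟩ := (hη.eventually (Iio_mem_nhds (show (0 : ℝ) < ε / 3 by positivity))).exists
  obtain ⟨N, hN⟩ := Metric.cauchySeq_iff.1 (hg R) (ε / 3) (by positivity)
  refine ⟨max N R, fun m hm n hn => ?_⟩
  have h1 := hN m (le_of_max_le_left hm) n (le_of_max_le_left hn)
  have h2 := h R m (le_of_max_le_right hm)
  have h3 := h R n (le_of_max_le_right hn)
  have hR : η R < ε / 3 := hR
  rw [dist_eq_norm] at h1 ⊢
  have e : f m - f n = (f m - g R m) + (g R m - g R n) - (f n - g R n) := by abel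
  rw [e]
  have h4 := norm_sub_le ((f m - g R m) + (g R m - g R n)) (f n - g R n)
  have h5 := norm_add_le (f m - g R m) (g R m - g R n)
  linarith

variable {F : Type*} [NormedAddCommGroup F] [InnerProductSpace ℂ F]
  {b : HilbertBasis ℕ ℂ F}

theorem toFock_single (k : ℕ) (c : ℂ) : toFock b (Finsupp.single k c) = c • b k := by
  rw [toFock, Finsupp.linearCombination_single]

variable [CompleteSpace F]

open TraceClass

/-- With δ = 1/√(R+1) the first term is small by the choice of δ, and in the second the factor
1/(R+1) outweighs 1/δ. -/
theorem norm_jump_sub_jump_le (l : ℕ) (β : ℂ) {R M : ℕ} (hR : R ≤ M) {x : TraceClass b}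
    (hx : 0 ≤ op x) (hM : conj (proj b M) x = x) :
    ‖conj (jumpOp b l β M) x - conj (jumpOp b l β R) x‖ ≤
      (√((R : ℝ) + 1))⁻¹ * ((2 * (1 + ‖β‖ ^ 2) + 2) * moment b (l + 1) M x) := by
  set s := √((R : ℝ) + 1) with hs
  have hs1 : 1 ≤ s := Real.one_le_sqrt.2 (by linarith [Nat.cast_nonneg (α := ℝ) R])
  have hs0 : 0 < s := by linarith
  have hss : s * s = (R : ℝ) + 1 := Real.mul_self_sqrt (by positivity)
  have h1 := norm_conj_add_sub_le hx (jumpOp b l β R) (jumpOp b l β M - jumpOp b l β R)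
    (inv_pos.2 hs0)
  rw [add_sub_cancel, inv_inv] at h1
  refine h1.trans ?_
  have h2 := tr_jump_le l β hR hx hM
  have h3 : tr (conj (jumpOp b l β M - jumpOp b l β R) x) ≤
      ((R : ℝ) + 1)⁻¹ * moment b (l + 1) M x :=
    tr_conj_le hx fun v => norm_jumpOp_sub_sq_le b l β hR v
  have h4 := moment_mono (Nat.le_succ l) M hx
  have h5 : 0 ≤ moment b (l + 1) M x := moment_nonneg _ _ hx
  have h6 : s⁻¹ * tr (conj (jumpOp b l β R) x) ≤
      s⁻¹ * (2 * (1 + ‖β‖ ^ 2) * moment b (l + 1) M x) := by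
    refine mul_le_mul_of_nonneg_left (h2.trans ?_) (inv_pos.2 hs0).le
    exact mul_le_mul_of_nonneg_left h4 (by positivity)
  have h7 : (s + 1) * ((R : ℝ) + 1)⁻¹ ≤ s⁻¹ * 2 := by
    rw [← hss, mul_inv, ← mul_assoc]
    have : (s + 1) * s⁻¹ ≤ 2 := by
      rw [← div_eq_mul_inv, div_le_iff₀ hs0]; linarith
    nlinarith [inv_pos.2 hs0]
  have h8 : (s + 1) * tr (conj (jumpOp b l β M - jumpOp b l β R) x) ≤
      s⁻¹ * 2 * moment b (l + 1) M x := by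
    refine (mul_le_mul_of_nonneg_left h3 (by positivity)).trans ?_
    rw [← mul_assoc]
    exact mul_le_mul_of_nonneg_right h7 h5
  linarith

/-- For a fixed cut R the jump operator is bounded and conjugation is continuous. The moment bound
makes replacing the cut M by R uniformly cheap in M ≥ R, so the two limits can be interchanged. -/
theorem exists_tendsto_jump (l : ℕ) (β : ℂ) {σ : ℕ → TraceClass b} {y : TraceClass b}
    (hσ : Tendsto σ atTop (𝓝 y)) (h0 : ∀ M, 0 ≤ op (σ M))
    (hM : ∀ M, conj (proj b M) (σ M) = σ M) {R : ℝ} (hR : ∀ M, moment b (l + 1) M (σ M) ≤ R) :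
    ∃ B, Tendsto (fun M => conj (jumpOp b l β M) (σ M)) atTop (𝓝 B) := by
  refine cauchySeq_tendsto_of_complete (cauchySeq_of_approx
    (g := fun R M => conj (jumpOp b l β R) (σ M))
    (η := fun N => (√((N : ℝ) + 1))⁻¹ * ((2 * (1 + ‖β‖ ^ 2) + 2) * R)) ?_ ?_ ?_)
  · have h1 : Tendsto (fun M : ℕ => √((M : ℝ) + 1)) atTop atTop :=
      Real.tendsto_sqrt_atTop.comp
        (tendsto_atTop_add_const_right _ 1 tendsto_natCast_atTop_atTop)
    simpa using h1.inv_tendsto_atTop.mul_const ((2 * (1 + ‖β‖ ^ 2) + 2) * R)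
  · intro N
    exact (((conj (jumpOp b l β N)).continuous.tendsto y).comp hσ).cauchySeq
  · intro N M hNM
    refine (norm_jump_sub_jump_le l β hNM (h0 M) (hM M)).trans ?_
    have := hR M
    gcongr

theorem tr_conj_proj_le {x : TraceClass b} (hx : 0 ≤ op x) (M : ℕ) :
    tr (conj (proj b M) x) ≤ tr x := by
  rw [proj, tr_conj_diagOp M fun _ => zero_le_one]
  simp only [one_mul]
  exact sum_le_hasSum _ (fun n _ => diag_nonneg hx n) x.hasSum_tr

/-- The truncation errors vanish in the limit. -/
theorem abs_tr_le_of_tendsto {r D d : ℕ} (hr : 1 ≤ r) (β : ℂ) {Γ₀ Γ B ε : ℝ} (hB : 0 < B)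
    (hε : 0 ≤ ε) {H : ℕ → ℕ → ℂ} (h0 : IsCoupling D r Γ₀ (drive (r + 1) β))
    (hG : IsCoupling D r Γ fun n k => drive (r + 1) β n k + ε * H n k)
    (hH : IsPerturbation D d B H) {x : TraceClass b} (hx : 0 ≤ op x) (htr : tr x ≤ 1) {R : ℝ}
    (hR : ∀ M, moment b (r + 1 + d + 2) M (conj (proj b M) x) ≤ R)
    (hR' : momentConst r D (r + 1 + d + 1) * (1 + Γ) ^ (r + 1 + d + 1 + r + 1) ≤ R)
    {t : ℝ} (ht : 0 ≤ t) {X : TraceClass b}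
    (hX : Tendsto (fun M => conj (jumpOp b (r + 1) β M)
        (flow (gen b (r + 1) (drive (r + 1) β) M) t (conj (proj b M) x)) -
      conj (jumpOp b (r + 1) β M) (flow (gen b (r + 1)
        (fun n k => drive (r + 1) β n k + ε * H n k) M) t (conj (proj b M) x))) atTop (𝓝 X)) :
    |tr X| ≤ ε * (2 * (1 + ‖β‖ ^ 2) * (B * (perturbConst D (r + 1) d + 1)) * R *
          (1 - Real.exp (-((r + 1).factorial * t)))) := by
  set E : ℝ := (1 + (r + 1).factorial) * ((r : ℝ) + 2) * ‖β‖ ^ 2 *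
          ((1 + momentConst r D (r + 1) * (1 + Γ₀) ^ (r + 1 + r + 1)) *
            (B * (perturbConst D (r + 2) d + 1) * R)) with hE
  have h1 : Tendsto (fun M : ℕ => ε * (2 * (1 + ‖β‖ ^ 2) * (B * (perturbConst D (r + 1) d + 1)) *
      R * (1 - Real.exp (-((r + 1).factorial * t))) + ((M : ℝ) + 1)⁻¹ * E * t)) atTop
      (𝓝 (ε * (2 * (1 + ‖β‖ ^ 2) * (B * (perturbConst D (r + 1) d + 1)) *
      R * (1 - Real.exp (-((r + 1).factorial * t))) + 0 * E * t))) := by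
    have h2 : Tendsto (fun M : ℕ => ((M : ℝ) + 1)⁻¹) atTop (𝓝 0) :=
      (tendsto_atTop_add_const_right _ 1 tendsto_natCast_atTop_atTop).inv_tendsto_atTop
    exact (((h2.mul_const E).mul_const t).const_add _).const_mul ε
  rw [zero_mul, zero_mul, add_zero] at h1
  refine le_of_tendsto_of_tendsto ((tr.continuous.tendsto X).comp hX).abs h1
    (Eventually.of_forall fun M => ?_)
  have hb : conj (proj b M) (conj (proj b M) x) = conj (proj b M) x := by
    rw [conj_conj, proj_mul_proj b le_rfl]
  have hx' := op_conj_nonneg (proj b M) hx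
  have htrM : tr (conj (proj b M) x) ≤ 1 := (tr_conj_proj_le hx M).trans htr
  have h3 : 0 ≤ momentConst r D (r + 1 + d + 1) * (1 + Γ) ^ (r + 1 + d + 1 + r + 1) := by
    have := hG.nonneg
    have := (momentConst_pos r D (r + 1 + d + 1)).le
    positivity
  have h4 := abs_tr_jump_flow_sub_le hr β hB hε h0 hG hH hx' hb (hR M)
    ((mul_le_of_le_one_right h3 htrM).trans hR') ht
  simp only [Function.comp, map_sub]
  exact h4

theorem star_lowering_basis (l : ℕ) {M k : ℕ} (h : k + l < M) :
    star (matOp b M (lowering l)) (b k) =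
      ((√((k + l).descFactorial l : ℝ) : ℝ) : ℂ) • b (k + l) := by
  refine vec_ext (b := b) fun n => ?_
  rw [star_matOp, inner_matOp_basis, inner_smul_right, inner_basis, conj_lowering, lowering]
  by_cases e : n = k + l
  · rw [if_pos (by omega), if_pos (by omega), if_pos e, e, mul_one]
  · rw [if_neg e, mul_zero]
    split_ifs <;> first | rfl | omega

theorem creation_pow_single (l k : ℕ) :
    (creation ^ l) (Finsupp.single k 1) =
      Finsupp.single (k + l) (((√((k + l).descFactorial l : ℝ) : ℝ) : ℂ)) := by
  induction l with
  | zero => simp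
  | succ l ih =>
    rw [pow_succ', Module.End.mul_apply, ih, creation, Finsupp.linearCombination_single,
      Finsupp.smul_single, smul_eq_mul, ← Complex.ofReal_mul, ← add_assoc,
      Nat.succ_descFactorial_succ, mul_comm, Nat.cast_mul, Real.sqrt_mul (Nat.cast_nonneg _)]
    push_cast
    rfl

theorem annihilation_pow_single (l k : ℕ) :
    (annihilation ^ l) (Finsupp.single k 1) =
      Finsupp.single (k - l) (((√(k.descFactorial l : ℝ) : ℝ) : ℂ)) := by
  induction l with
  | zero => simp
  | succ l ih =>
    rw [pow_succ', Module.End.mul_apply, ih, annihilation, Finsupp.linearCombination_single,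
      Finsupp.smul_single, smul_eq_mul, ← Complex.ofReal_mul, Nat.sub_sub,
      Nat.descFactorial_succ, mul_comm, Nat.cast_mul, Real.sqrt_mul (Nat.cast_nonneg _)]

/-- A finite vector is moved up by at most l indices, so late cuts do not see the truncation. -/
theorem star_jumpOp_toFock (l : ℕ) (α : ℂ) (v : FinVec) :
    ∀ᶠ M in atTop, star (jumpOp b l (α ^ l) M) (toFock b v) = toFock b (jumpAdj l α v) := by
  induction v using Finsupp.induction_linear with
  | zero => simp
  | add v w hv hw =>
    filter_upwards [hv, hw] with M h1 h2
    rw [map_add, map_add, map_add, map_add, h1, h2]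
  | single k c =>
    filter_upwards [eventually_gt_atTop (k + l)] with M hM
    have e : Finsupp.single k c = c • Finsupp.single k (1 : ℂ) := by simp
    rw [e, map_smul, map_smul, map_smul, map_smul]
    congr 1
    rw [toFock_single, one_smul, jumpOp, star_sub, star_smul, star_one, sub_apply, smul_apply,
      one_apply_eq_self, star_lowering_basis l hM, jumpAdj, LinearMap.sub_apply,
      LinearMap.smul_apply, creation_pow_single, map_sub, map_smul, toFock_single, RCLike.star_def,
      map_pow, Module.End.one_apply, toFock_single, one_smul]

/-- The defining identity is tested on finite vectors, where the adjoint of the cut jump operator is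
eventually exact; trace norm convergence gives convergence of matrix elements on both sides. -/
theorem isJumpConj_of_tendsto (l : ℕ) (α : ℂ) {σ : ℕ → TraceClass b} {y B : TraceClass b}
    (hσ : Tendsto σ atTop (𝓝 y))
    (hB : Tendsto (fun M => conj (jumpOp b l (α ^ l) M) (σ M)) atTop (𝓝 B)) :
    IsJumpConj b l α (op y) (op B) := by
  intro v w
  have hop : ∀ {τ : ℕ → TraceClass b} {z : TraceClass b}, Tendsto τ atTop (𝓝 z) → ∀ u u' : F,
      Tendsto (fun M => ⟪u, op (τ M) u'⟫_ℂ) atTop (𝓝 ⟪u, op z u'⟫_ℂ) := by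
    intro τ z hτ u u'
    have h1 : Continuous fun X : F →L[ℂ] F => ⟪u, X u'⟫_ℂ := by fun_prop
    exact ((h1.comp opL.continuous).tendsto z).comp hτ
  refine tendsto_nhds_unique (hop hB _ _) ?_
  refine (hop hσ (toFock b (jumpAdj l α v)) (toFock b (jumpAdj l α w))).congr' ?_
  filter_upwards [star_jumpOp_toFock (b := b) l α v, star_jumpOp_toFock (b := b) l α w] with M h1 h2
  rw [op_conj, mul_apply_eq_comp, mul_apply_eq_comp, h2, ← h1,
    ContinuousLinearMap.star_eq_adjoint, ContinuousLinearMap.adjoint_inner_left]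

end Limits

/-! ### Matrix coefficients: from the algebraic formulas to the truncated operators -/

section FiniteVectors

/-- The matrix coefficients of an operator on finite vectors. -/
def ent (g : FOp) (n k : ℕ) : ℂ := g (Finsupp.single k 1) n

theorem apply_single (g : FOp) (k : ℕ) (c : ℂ) :
    g (Finsupp.single k c) = c • g (Finsupp.single k 1) := by
  rw [← map_smul, Finsupp.smul_single, smul_eq_mul, mul_one]

theorem fop_ext {g h : FOp} (H : ∀ n k, ent g n k = ent h n k) : g = h := by
  refine Finsupp.lhom_ext fun k c => ?_
  rw [apply_single, apply_single h]
  congr 1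
  ext n
  exact H n k

theorem ent_add (g h : FOp) (n k : ℕ) : ent (g + h) n k = ent g n k + ent h n k := rfl

theorem ent_sub (g h : FOp) (n k : ℕ) : ent (g - h) n k = ent g n k - ent h n k := rfl

theorem ent_smul (c : ℂ) (g : FOp) (n k : ℕ) : ent (c • g) n k = c * ent g n k := rfl

theorem ent_annihilation_pow (l n k : ℕ) : ent (annihilation ^ l) n k = lowering l n k := by
  rw [ent, annihilation_pow_single, Finsupp.single_apply, lowering]
  rcases le_or_gt l k with h | h
  · by_cases e : n + l = k
    · rw [if_pos (by omega), if_pos e]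
    · rw [if_neg (by omega), if_neg e]
  · rw [Nat.descFactorial_of_lt h, if_neg (show ¬n + l = k by omega)]
    simp

theorem ent_creation_pow (l n k : ℕ) : ent (creation ^ l) n k = lowering l k n := by
  rw [ent, creation_pow_single, Finsupp.single_apply, lowering]
  by_cases e : k + l = n
  · rw [if_pos e, if_pos e, e]
  · rw [if_neg e, if_neg e]

theorem ent_creation_mul_annihilation_pow (l n k : ℕ) :
    ent (creation ^ l * annihilation ^ l) n k =
      if n = k then ((n.descFactorial l : ℝ) : ℂ) else 0 := by
  rw [ent, Module.End.mul_apply, annihilation_pow_single, apply_single, Finsupp.smul_apply]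
  change _ • ent (creation ^ l) n (k - l) = _
  rw [ent_creation_pow, lowering, smul_eq_mul]
  rcases le_or_gt l k with h | h
  · by_cases e : n = k
    · subst e
      rw [if_pos (by omega), if_pos rfl, ← Complex.ofReal_mul,
        Real.mul_self_sqrt (Nat.cast_nonneg _)]
    · rw [if_neg (by omega), if_neg e, mul_zero]
  · rw [Nat.descFactorial_of_lt h]
    by_cases e : n = k
    · rw [if_pos e, e, Nat.descFactorial_of_lt h]; simp
    · rw [if_neg e]; simp

/-- The operator on finite vectors with the matrix `g` cut off to indices below `M`. -/
def matF (M : ℕ) (g : ℕ → ℕ → ℂ) : FOp :=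
  Finsupp.linearCombination ℂ fun k =>
    if k < M then ∑ n ∈ Finset.range M, Finsupp.single n (g n k) else 0

theorem ent_matF (M : ℕ) (g : ℕ → ℕ → ℂ) (n k : ℕ) :
    ent (matF M g) n k = if n < M ∧ k < M then g n k else 0 := by
  rw [ent, matF, Finsupp.linearCombination_single, one_smul]
  by_cases hk : k < M
  · rw [if_pos hk, Finsupp.finsetSum_apply]
    simp only [Finsupp.single_apply, Finset.sum_ite_eq', Finset.mem_range, hk, and_true]
  · rw [if_neg hk, if_neg (by omega)]; rfl

/-- The projection of the finite vectors onto the span of the first `M` basis vectors. -/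
def cutF (M : ℕ) : FOp := matF M fun n k => if n = k then 1 else 0

theorem cutF_single (M k : ℕ) :
    cutF M (Finsupp.single k 1) = if k < M then Finsupp.single k 1 else 0 := by
  ext n
  change ent (cutF M) n k = _
  rw [cutF, ent_matF]
  by_cases hn : n = k
  · subst hn
    by_cases hk : n < M <;> simp [hk]
  · by_cases hk : k < M <;> simp [hk, hn]

theorem cutF_apply (M : ℕ) (v : FinVec) (n : ℕ) : cutF M v n = if n < M then v n else 0 := by
  induction v using Finsupp.induction_linear with
  | zero => simp
  | add v w hv hw => rw [map_add, Finsupp.add_apply, hv, hw]; split_ifs <;> simp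
  | single k c =>
    rw [apply_single, cutF_single, Finsupp.smul_apply, Finsupp.single_apply]
    by_cases hk : k < M <;> by_cases hn : k = n <;> simp [hk, hn] <;> grind

theorem ent_mul_cutF (g : FOp) (M n k : ℕ) :
    ent (g * cutF M) n k = if k < M then ent g n k else 0 := by
  rw [ent, Module.End.mul_apply, cutF_single]
  split_ifs
  · rfl
  · rw [map_zero]; rfl

theorem ent_cutF_mul (g : FOp) (M n k : ℕ) :
    ent (cutF M * g) n k = if n < M then ent g n k else 0 := by
  rw [ent, Module.End.mul_apply, cutF_apply]
  rfl

theorem drift_band {l D : ℕ} {G : ℕ → ℕ → ℂ}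
    (hband : ∀ n k, n + D < k ∨ k + D < n → G n k = 0) (n k : ℕ)
    (h : n + D < k ∨ k + D < n) : drift l G n k = 0 := by
  rw [drift, hband n k h, if_neg (by omega), mul_zero, sub_zero]

variable {F : Type*} [NormedAddCommGroup F] [InnerProductSpace ℂ F] {b : HilbertBasis ℕ ℂ F}

theorem inner_toFock (v : FinVec) (n : ℕ) : ⟪b n, toFock b v⟫_ℂ = v n := by
  induction v using Finsupp.induction_linear with
  | zero => simp
  | add v w hv hw => rw [map_add, inner_add_right, hv, hw, Finsupp.add_apply]
  | single k c =>
    rw [toFock_single, inner_smul_right, inner_basis, Finsupp.single_apply]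
    by_cases h : n = k
    · rw [if_pos h, if_pos h.symm, mul_one]
    · rw [if_neg h, if_neg (Ne.symm h), mul_zero]

theorem restrictsTo_iff {x : F →L[ℂ] F} {u : FOp} :
    RestrictsTo b x u ↔ ∀ n k, ⟪b n, x (b k)⟫_ℂ = ent u n k := by
  constructor
  · intro h n k
    have := h (Finsupp.single k 1)
    rw [toFock_single, one_smul] at this
    rw [this, inner_toFock, ent]
  · intro h v
    induction v using Finsupp.induction_linear with
    | zero => simp
    | add v w hv hw => rw [map_add, map_add, map_add, map_add, hv, hw]
    | single k c =>
      rw [apply_single, map_smul, toFock_single, map_smul]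
      congr 1
      refine vec_ext (b := b) fun n => ?_
      rw [h, inner_toFock, ent]

theorem RestrictsTo.op_unique {x y : F →L[ℂ] F} {u : FOp} (hx : RestrictsTo b x u)
    (hy : RestrictsTo b y u) : x = y :=
  op_ext (b := b) fun n k => by rw [restrictsTo_iff.1 hx, restrictsTo_iff.1 hy]

theorem RestrictsTo.unique {x : F →L[ℂ] F} {u w : FOp} (hu : RestrictsTo b x u)
    (hw : RestrictsTo b x w) : u = w :=
  fop_ext fun n k => by rw [← restrictsTo_iff.1 hu, ← restrictsTo_iff.1 hw]

theorem RestrictsTo.add {x y : F →L[ℂ] F} {u w : FOp} (hx : RestrictsTo b x u)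
    (hy : RestrictsTo b y w) : RestrictsTo b (x + y) (u + w) := fun v => by
  rw [add_apply, hx, hy, LinearMap.add_apply, map_add]

theorem RestrictsTo.mul {x y : F →L[ℂ] F} {u w : FOp} (hx : RestrictsTo b x u)
    (hy : RestrictsTo b y w) : RestrictsTo b (x * y) (u * w) := fun v => by
  rw [mul_apply_eq_comp, hy, hx, Module.End.mul_apply]

theorem restrictsTo_proj (M : ℕ) : RestrictsTo b (proj b M) (cutF M) := by
  refine restrictsTo_iff.2 fun n k => ?_
  rw [cutF, ent_matF, inner_proj, inner_basis]
  by_cases hn : n < M <;> by_cases h : n = k <;> simp [hn, h]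

/-- Columns below M₀ of a band matrix have all their entries in rows below M₀ + D, so the cut at M
loses nothing. -/
theorem restrictsTo_matOp_mul_proj {M₀ M D : ℕ} (hM : M₀ + D ≤ M) {g : ℕ → ℕ → ℂ} {u : FOp}
    (hu : ∀ n k, ent u n k = g n k) (hg : ∀ n k, k + D < n → g n k = 0) :
    RestrictsTo b (matOp b M g * proj b M₀) (u * cutF M₀) := by
  refine restrictsTo_iff.2 fun n k => ?_
  rw [ent_mul_cutF, mul_apply_eq_comp, proj_basis]
  split_ifs with hk
  · rw [inner_matOp_basis, hu]
    split_ifs with h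
    · rfl
    · rw [hg n k (by omega)]
  · rw [map_zero, inner_zero_right]

theorem restrictsTo_proj_mul_matOp {M₀ M D : ℕ} (hM : M₀ + D ≤ M) {g : ℕ → ℕ → ℂ} {u : FOp}
    (hu : ∀ n k, ent u n k = g n k) (hg : ∀ n k, n + D < k → g n k = 0) :
    RestrictsTo b (proj b M₀ * matOp b M g) (cutF M₀ * u) := by
  refine restrictsTo_iff.2 fun n k => ?_
  rw [ent_cutF_mul, mul_apply_eq_comp, inner_proj]
  split_ifs with hn
  · rw [inner_matOp_basis, hu]
    split_ifs with h
    · rfl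
    · rw [hg n k (by omega)]
  · rfl

theorem conj_ent_of_isSymm {H : FOp} (h : IsSymm b H) (n k : ℕ) :
    (starRingEnd ℂ) (ent H n k) = ent H k n := by
  have := h (Finsupp.single k 1) (Finsupp.single n 1)
  rw [toFock_single, toFock_single, one_smul, one_smul, inner_toFock, ← inner_conj_symm,
    inner_toFock] at this
  exact this

variable [CompleteSpace F]

open TraceClass

/-- The truncated generators act on finite blocks by the formula for the generator. -/
theorem restrictsTo_gen {l D : ℕ} {G : ℕ → ℕ → ℂ}
    (hband : ∀ n k, n + D < k ∨ k + D < n → G n k = 0) {κ κd : FOp}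
    (hκ : ∀ n k, ent κ n k = drift l G n k)
    (hκd : ∀ n k, ent κd n k = (starRingEnd ℂ) (drift l G k n)) {M₀ M : ℕ} (h : M₀ + D ≤ M)
    {x : TraceClass b} (hx : conj (proj b M₀) x = x) {u : FOp} (hu : RestrictsTo b (op x) u) :
    RestrictsTo b (op (gen b l G M x))
      (annihilation ^ l * u * creation ^ l + κ * u + u * κd) := by
  set P := proj b M₀
  set p := cutF M₀
  have hP : RestrictsTo b P p := restrictsTo_proj M₀
  have hPP : P * P = P := proj_mul_proj b le_rfl
  have hxP : P * op x * P = op x := by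
    have := congrArg op hx
    rwa [op_conj, star_proj] at this
  have h1 : P * op x = op x := by rw [← hxP, ← mul_assoc, ← mul_assoc, hPP]
  have h2 : op x * P = op x := by rw [← hxP, mul_assoc, hPP]
  have hA : RestrictsTo b (matOp b M (lowering l) * P) (annihilation ^ l * p) :=
    restrictsTo_matOp_mul_proj h (ent_annihilation_pow l) fun n k hnk => by
      rw [lowering, if_neg (by omega)]
  have hAd : RestrictsTo b (P * star (matOp b M (lowering l))) (p * creation ^ l) := by
    rw [star_matOp]
    refine restrictsTo_proj_mul_matOp h (fun n k => ?_) fun n k hnk => ?_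
    · rw [ent_creation_pow, conj_lowering]
    · rw [lowering, if_neg (by omega), map_zero]
  have hK : RestrictsTo b (matOp b M (drift l G) * P) (κ * p) :=
    restrictsTo_matOp_mul_proj h hκ fun n k hnk => drift_band hband n k (Or.inr hnk)
  have hKd : RestrictsTo b (P * star (matOp b M (drift l G))) (p * κd) := by
    rw [star_matOp]
    refine restrictsTo_proj_mul_matOp h hκd fun n k hnk => ?_
    rw [drift_band hband k n (Or.inr hnk), map_zero]
  have hu1 : p * u = u := (hP.mul hu).unique (by rwa [h1])
  have hu2 : u * p = u := (hu.mul hP).unique (by rwa [h2])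
  have e1 : op (gen b l G M x) = (matOp b M (lowering l) * P) * op x *
      (P * star (matOp b M (lowering l))) + (matOp b M (drift l G) * P) * op x +
      op x * (P * star (matOp b M (drift l G))) := by
    rw [gen, op_lindblad]
    have e3 : ∀ X Y : F →L[ℂ] F, X * P * op x * (P * Y) = X * (P * op x * P) * Y := by
      intro X Y; noncomm_ring
    rw [e3, hxP, mul_assoc _ P, h1, ← mul_assoc (op x), h2]
  have e2 : annihilation ^ l * u * creation ^ l + κ * u + u * κd =
      (annihilation ^ l * p) * u * (p * creation ^ l) + (κ * p) * u + u * (p * κd) := by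
    rw [mul_assoc _ p, hu1, ← mul_assoc _ p, mul_assoc _ u p, hu2, mul_assoc κ, hu1,
      ← mul_assoc u p, hu2]
  rw [e1, e2]
  exact (((hA.mul hu).mul hAd).add (hK.mul hu)).add (hu.mul hKd)

/-- The effective drift `-i G - ½ a†^l a^l` on finite vectors. -/
def driftF (l : ℕ) (β : ℂ) (ε : ℝ) (H : FOp) : FOp :=
  (β / 2) • creation ^ l - ((starRingEnd ℂ) β / 2) • annihilation ^ l -
    (1 / 2 : ℂ) • (creation ^ l * annihilation ^ l) - (Complex.I * ε) • H

/-- The formal adjoint of the effective drift. -/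
def driftAdjF (l : ℕ) (β : ℂ) (ε : ℝ) (H : FOp) : FOp :=
  ((starRingEnd ℂ) β / 2) • annihilation ^ l - (β / 2) • creation ^ l -
    (1 / 2 : ℂ) • (creation ^ l * annihilation ^ l) + (Complex.I * ε) • H

theorem ent_driftF (l : ℕ) (β : ℂ) (ε : ℝ) (H : FOp) (n k : ℕ) :
    ent (driftF l β ε H) n k = drift l (fun n k => drive l β n k + ε * ent H n k) n k := by
  rw [driftF, ent_sub, ent_sub, ent_sub, ent_smul, ent_smul, ent_smul, ent_smul,
    ent_creation_pow, ent_annihilation_pow, ent_creation_mul_annihilation_pow, drift, drive]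
  have hI : Complex.I * Complex.I = -1 := Complex.I_mul_I
  split_ifs
  · push_cast
    linear_combination ((1 / 2 : ℂ)) * (β * lowering l k n -
      (starRingEnd ℂ) β * lowering l n k) * hI
  · linear_combination ((1 / 2 : ℂ)) * (β * lowering l k n -
      (starRingEnd ℂ) β * lowering l n k) * hI

theorem ent_driftAdjF (l : ℕ) (β : ℂ) (ε : ℝ) {H : FOp}
    (hH : ∀ n k, (starRingEnd ℂ) (ent H n k) = ent H k n) (n k : ℕ) :
    ent (driftAdjF l β ε H) n k =
      (starRingEnd ℂ) (drift l (fun n k => drive l β n k + ε * ent H n k) k n) := by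
  rw [← ent_driftF, driftF, driftAdjF, ent_sub, ent_sub, ent_sub, ent_add, ent_sub, ent_sub]
  simp only [ent_smul, ent_creation_pow, ent_annihilation_pow, ent_creation_mul_annihilation_pow,
    map_sub, map_mul, conj_lowering, hH, map_div₀, Complex.conj_conj, map_ofNat, map_one,
    Complex.conj_I, Complex.conj_ofReal]
  by_cases e : n = k
  · subst e
    simp only [if_true, Complex.conj_ofReal]; ring
  · rw [if_neg e, if_neg (Ne.symm e)]; simp only [map_zero]; ring

/-- Here A and C stand for a^l and a†^l. The identity moves the shifts β, β' and the perturbation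
into the drift, and needs no commutation relation. -/
theorem gksl_identity {R : Type*} [Ring R] [Algebra ℂ R] (A C H u : R) (β β' ε : ℂ) :
    (A - β • 1) * u * (C - β' • 1) - (1 / 2 : ℂ) • ((C - β' • 1) * (A - β • 1) * u +
        u * ((C - β' • 1) * (A - β • 1))) + ε • ((-Complex.I) • (H * u - u * H)) =
      A * u * C +
        ((β / 2) • C - (β' / 2) • A - (1 / 2 : ℂ) • (C * A) - (Complex.I * ε) • H) * u +
        u * ((β' / 2) • A - (β / 2) • C - (1 / 2 : ℂ) • (C * A) + (Complex.I * ε) • H) := by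
  simp only [sub_mul, mul_sub, mul_add, smul_mul_assoc, mul_smul_comm, one_mul, mul_one,
    smul_sub, smul_add, smul_smul, mul_assoc]
  module

theorem perturbedPhoton_eq (l : ℕ) (α : ℂ) (ε : ℝ) (H u : FOp) :
    perturbedPhoton l α ε H u = annihilation ^ l * u * creation ^ l +
      driftF l (α ^ l) ε H * u + u * driftAdjF l (α ^ l) ε H := by
  rw [perturbedPhoton, photon, dissipator, hamiltonian, jump, jumpAdj, driftF, driftAdjF, ← map_pow]
  exact gksl_identity (annihilation ^ l) (creation ^ l) H u (α ^ l) _ ε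

theorem photon_eq (l : ℕ) (α : ℂ) (H : FOp) : photon l α = perturbedPhoton l α 0 H := by
  ext1 x
  simp [perturbedPhoton]

end FiniteVectors

/-! ### The semigroups of the statement as limits of truncated flows -/

section Correspondence

variable {F : Type*} [NormedAddCommGroup F] [InnerProductSpace ℂ F] [CompleteSpace F]
  {b : HilbertBasis ℕ ℂ F}

open TraceClass

/-- The vectors |x| v and x v have the same norm, so the absolute value annihilates the same basis
vectors and its trace is a finite sum. -/
theorem isTraceSA_of_finite {x : F →L[ℂ] F} (hx : IsSelfAdjoint x) {M : ℕ}
    (h : ∀ n, M ≤ n → x (b n) = 0) : IsTraceSA b x := by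
  refine ⟨hx, ?_⟩
  rw [traceNorm, tsum_eq_sum (s := Finset.range M)]
  · exact ENNReal.sum_lt_top.2 fun _ _ => ENNReal.ofReal_lt_top
  · intro n hn
    have h1 : star (CFC.abs x) * CFC.abs x = star x * x := by
      rw [(CFC.abs_nonneg x).isSelfAdjoint.star_eq, CFC.abs_mul_abs]
    have h2 : ‖CFC.abs x (b n)‖ ^ 2 = 0 := by
      rw [← re_inner_star_mul, h1, re_inner_star_mul, h n (by simpa using hn), norm_zero,
        zero_pow two_ne_zero]
    rw [norm_eq_zero.1 (pow_eq_zero_iff two_ne_zero |>.1 h2), inner_zero_right]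
    simp

theorem isFinSupp_iff {x : F →L[ℂ] F} :
    IsFinSupp b x ↔ ∃ z ∈ finiteBlocks b, x = op z := by
  constructor
  · rintro ⟨hx, M, hM⟩
    -- `IsFinSupp` allows the index M itself, whereas blocks consist of indices strictly below their
    -- size, hence M + 1.
    have h1 : ∀ n, M + 1 ≤ n → x (b n) = 0 := fun n hn => vec_ext (b := b) fun m => by
      rw [hM m n (Or.inr hn), inner_zero_right]
    refine ⟨mk x (isTraceSA_of_finite hx h1), ⟨M + 1, op_injective ?_⟩, rfl⟩
    rw [op_conj, star_proj, op_mk]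
    refine op_ext (b := b) fun m n => ?_
    rw [mul_apply_eq_comp, mul_apply_eq_comp, proj_basis, inner_proj]
    by_cases hn : n < M + 1
    · rw [if_pos hn]
      split_ifs with hm
      · rfl
      · rw [hM m n (Or.inl (by omega))]
    · rw [if_neg hn, map_zero, inner_zero_right, h1 n (by omega), inner_zero_right, ite_self]
  · rintro ⟨z, ⟨M, hM⟩, rfl⟩
    refine ⟨z.isTraceSA.1, M, fun m n hmn => ?_⟩
    rw [← hM, op_conj, star_proj, mul_apply_eq_comp, mul_apply_eq_comp, proj_basis, inner_proj]
    rcases hmn with h | h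
    · rw [if_neg (by omega)]
    · rw [if_neg (show ¬n < M by omega), map_zero, inner_zero_right, ite_self]

theorem exists_restrictsTo {z : TraceClass b} (hz : z ∈ finiteBlocks b) :
    ∃ u, RestrictsTo b (op z) u := by
  obtain ⟨M, hM⟩ := hz
  refine ⟨matF M fun n k => ⟪b n, op z (b k)⟫_ℂ, restrictsTo_iff.2 fun n k => ?_⟩
  rw [ent_matF]
  conv_lhs => rw [← hM, op_conj, star_proj, mul_apply_eq_comp, mul_apply_eq_comp, proj_basis,
    inner_proj]
  by_cases hn : n < M <;> by_cases hk : k < M <;> simp [hn, hk]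

/-- The matrix of the Hamiltonian in the interaction with the drive. -/
def hamMatrix (l : ℕ) (α : ℂ) (ε : ℝ) (H : FOp) (n k : ℕ) : ℂ :=
  drive l (α ^ l) n k + ε * ent H n k

theorem coreGraph_iff {l D : ℕ} {α : ℂ} {ε : ℝ} {H : FOp}
    (hH : ∀ n k, (starRingEnd ℂ) (ent H n k) = ent H k n)
    (hband : ∀ n k, n + D < k ∨ k + D < n → hamMatrix l α ε H n k = 0) {x y : F →L[ℂ] F} :
    CoreGraph b (perturbedPhoton l α ε H) x y ↔
      ∃ z ∈ finiteBlocks b, x = op z ∧ y = op (coreGen b l D (hamMatrix l α ε H) z) := by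
  have key : ∀ z ∈ finiteBlocks b, ∀ u, RestrictsTo b (op z) u →
      RestrictsTo b (op (coreGen b l D (hamMatrix l α ε H) z)) (perturbedPhoton l α ε H u) := by
    rintro z ⟨M, hM⟩ u hu
    rw [perturbedPhoton_eq, ← gen_eq_coreGen l hband le_rfl hM]
    exact restrictsTo_gen hband (ent_driftF l _ ε H) (ent_driftAdjF l _ ε hH) le_rfl hM hu
  constructor
  · rintro ⟨hx, u, hu, hy⟩
    obtain ⟨z, hz, rfl⟩ := isFinSupp_iff.1 hx
    exact ⟨z, hz, rfl, hy.op_unique (key z hz u hu)⟩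
  · rintro ⟨z, hz, rfl, rfl⟩
    obtain ⟨u, hu⟩ := exists_restrictsTo hz
    exact ⟨isFinSupp_iff.2 ⟨z, hz, rfl⟩, u, hu, key z hz u hu⟩

theorem tendsto_traceNorm_iff {ι : Type*} {f : Filter ι} {z : ι → TraceClass b} :
    Tendsto (fun t => traceNorm b (op (z t))) f (𝓝 0) ↔ Tendsto z f (𝓝 0) := by
  rw [tendsto_zero_iff_norm_tendsto_zero]
  constructor
  · intro h
    exact (ENNReal.tendsto_toReal ENNReal.zero_ne_top).comp h
  · intro h
    have h1 := ENNReal.tendsto_ofReal h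
    rw [ENNReal.ofReal_zero] at h1
    simpa only [traceNorm_op] using h1

/-- The restriction of a semigroup to the space of self-adjoint trace class operators. -/
def restrict {P : ℝ≥0 → (F →L[ℂ] F) → (F →L[ℂ] F)} (hP : IsC0Semigroup b P) (t : ℝ≥0) :
    TraceClass b →L[ℝ] TraceClass b :=
  LinearMap.mkContinuous
    { toFun := fun z => mk (P t (op z)) (hP.maps_to t _ z.isTraceSA)
      map_add' := fun x y => op_injective (by
        simp only [op_mk, map_add]
        exact hP.map_add t _ _ x.isTraceSA y.isTraceSA)
      map_smul' := fun c x => op_injective (by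
        simp only [op_mk, map_smul, RingHom.id_apply, ← Complex.coe_smul]
        exact hP.map_smul t c _ x.isTraceSA) }
    (hP.bounded t).choose fun x => by
      have h := (hP.bounded t).choose_spec (op x) x.isTraceSA
      change (traceNorm b (P t (op x))).toReal ≤ _ * (traceNorm b (op x)).toReal
      have h1 := ENNReal.toReal_mono (ENNReal.mul_ne_top ENNReal.coe_ne_top x.isTraceSA.2.ne) h
      rwa [ENNReal.toReal_mul, ENNReal.coe_toReal] at h1

theorem op_restrict {P : ℝ≥0 → (F →L[ℂ] F) → (F →L[ℂ] F)} (hP : IsC0Semigroup b P) (t : ℝ≥0)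
    (z : TraceClass b) : op (restrict hP t z) = P t (op z) := rfl

theorem isSemigroup_restrict {P : ℝ≥0 → (F →L[ℂ] F) → (F →L[ℂ] F)} (hP : IsC0Semigroup b P) :
    IsSemigroup (restrict hP) where
  zero := ContinuousLinearMap.ext fun z => op_injective (hP.zero _ z.isTraceSA)
  add s t z := op_injective (hP.add s t _ z.isTraceSA)
  tendsto z := by
    rw [← tendsto_sub_nhds_zero_iff, ← tendsto_traceNorm_iff]
    simp only [map_sub, op_restrict]
    exact hP.continuous _ z.isTraceSA

theorem generatorGraph_iff {P : ℝ≥0 → (F →L[ℂ] F) → (F →L[ℂ] F)}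
    {T : ℝ≥0 → TraceClass b →L[ℝ] TraceClass b}
    (h : ∀ t z, P t (op z) = op (T t z)) (x y : TraceClass b) :
    GeneratorGraph b P (op x) (op y) ↔ IsGenerator T x y := by
  rw [GeneratorGraph, and_iff_right x.isTraceSA, and_iff_right y.isTraceSA, IsGenerator]
  refine Iff.trans ?_ (tendsto_traceNorm_iff.trans tendsto_sub_nhds_zero_iff)
  refine iff_of_eq (congrArg (fun f => Tendsto f _ _) (funext fun t => ?_))
  rw [h, map_sub, map_smul, map_sub, ← Complex.coe_smul, Complex.ofReal_inv]

theorem closureGraph_iff {A : ℕ → TraceClass b →L[ℝ] TraceClass b}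
    {𝓖 : TraceClass b → TraceClass b} (h : Approximates A (finiteBlocks b) 𝓖) {𝓛 : FOp → FOp}
    (hc : ∀ x y : F →L[ℂ] F, CoreGraph b 𝓛 x y ↔
      ∃ z ∈ finiteBlocks b, x = op z ∧ y = op (𝓖 z)) (x y : TraceClass b) :
    ClosureGraph b 𝓛 (op x) (op y) ↔ (x, y) ∈ h.graph.topologicalClosure := by
  have hlt : ∀ (z : TraceClass b) {δ : ℝ}, 0 < δ →
      (traceNorm b (op z) < ENNReal.ofReal δ ↔ ‖z‖ < δ) := fun z δ hδ => by
    rw [traceNorm_op, ENNReal.ofReal_lt_ofReal_iff hδ]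
  rw [ClosureGraph, and_iff_right x.isTraceSA, and_iff_right y.isTraceSA]
  change _ ↔ (x, y) ∈ closure (h.graph : Set (TraceClass b × TraceClass b))
  rw [Metric.mem_closure_iff]
  constructor
  · intro hx ε hε
    obtain ⟨x', y', hxy, h1, h2⟩ := hx (ENNReal.ofReal ε) (ENNReal.ofReal_pos.2 hε)
    obtain ⟨z, hz, rfl, rfl⟩ := (hc _ _).1 hxy
    refine ⟨(z, 𝓖 z), ⟨hz, rfl⟩, ?_⟩
    rw [← map_sub, hlt _ hε] at h1 h2
    rw [Prod.dist_eq, dist_eq_norm, dist_eq_norm]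
    exact max_lt h1 h2
  · intro hx δ hδ
    obtain ⟨ε, hε, hεδ⟩ := ENNReal.lt_iff_exists_nnreal_btwn.1 hδ
    have hε' : (0 : ℝ) < ε := by exact_mod_cast hε
    obtain ⟨⟨z, w⟩, ⟨hz, hw⟩, hd⟩ := hx ε hε'
    obtain rfl : w = 𝓖 z := hw
    rw [Prod.dist_eq, dist_eq_norm, dist_eq_norm, max_lt_iff] at hd
    have e : ENNReal.ofReal ε = ε := ENNReal.ofReal_coe_nnreal
    refine ⟨op z, op (𝓖 z), (hc _ _).2 ⟨z, hz, rfl, rfl⟩, ?_, ?_⟩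
    · rw [← map_sub]
      exact (e ▸ (hlt _ hε').2 hd.1).trans hεδ
    · rw [← map_sub]
      exact (e ▸ (hlt _ hε').2 hd.2).trans hεδ

theorem exists_isSemigroupOf {A : ℕ → TraceClass b →L[ℝ] TraceClass b}
    {𝓖 : TraceClass b → TraceClass b} (h : Approximates A (finiteBlocks b) 𝓖) {𝓛 : FOp → FOp}
    (hc : ∀ x y : F →L[ℂ] F, CoreGraph b 𝓛 x y ↔
      ∃ z ∈ finiteBlocks b, x = op z ∧ y = op (𝓖 z)) :
    ∃ P, IsSemigroupOf b 𝓛 P := by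
  classical
  -- The value 0 outside the self-adjoint trace class operators is arbitrary; no condition on a
  -- semigroup looks there.
  set P : ℝ≥0 → (F →L[ℂ] F) → (F →L[ℂ] F) := fun t x =>
    if hx : IsTraceSA b x then op (h.limit t (mk x hx)) else 0 with hPdef
  have hP : ∀ t (z : TraceClass b), P t (op z) = op (h.limit t z) := fun t z => by
    simp only [hPdef]
    rw [dif_pos z.isTraceSA, mk_op]
  have hS := h.isSemigroup
  refine ⟨P, ⟨?_, ?_, ?_, ?_, ?_, ?_, ?_⟩, fun x y => ?_⟩
  · intro t x hx
    rw [← op_mk x hx, hP]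
    exact isTraceSA _
  · intro t x y hx hy
    rw [← op_mk x hx, ← op_mk y hy, ← map_add, hP, hP, hP, map_add, map_add]
  · intro t r x hx
    rw [← op_mk x hx, Complex.coe_smul, ← map_smul, hP, hP, map_smul, map_smul, Complex.coe_smul]
  · intro t
    refine ⟨1, fun x hx => ?_⟩
    rw [← op_mk x hx, hP, traceNorm_op, traceNorm_op, ENNReal.coe_one, one_mul]
    exact ENNReal.ofReal_le_ofReal (h.norm_limit_le t _)
  · intro x hx
    rw [← op_mk x hx, hP, hS.zero]
    rfl
  · intro s t x hx
    rw [← op_mk x hx, hP, hP, hP, hS.add]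
  · intro x hx
    rw [← op_mk x hx]
    simp only [hP, ← map_sub]
    rw [tendsto_traceNorm_iff, tendsto_sub_nhds_zero_iff]
    exact hS.tendsto _
  · by_cases hxy : IsTraceSA b x ∧ IsTraceSA b y
    · exact (generatorGraph_iff hP (mk x hxy.1) (mk y hxy.2)).trans
        ((h.isGenerator_iff _ _).trans (closureGraph_iff h hc (mk x hxy.1) (mk y hxy.2)).symm)
    · exact ⟨fun H => absurd ⟨H.1, H.2.1⟩ hxy, fun H => absurd ⟨H.1, H.2.1⟩ hxy⟩

/-- The generator of P is the closure from the core, as is that of the limit semigroup, and the core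
is dense, so the two semigroups agree. -/
theorem isSemigroupOf_apply {A : ℕ → TraceClass b →L[ℝ] TraceClass b}
    {𝓖 : TraceClass b → TraceClass b} (h : Approximates A (finiteBlocks b) 𝓖) {𝓛 : FOp → FOp}
    (hc : ∀ x y : F →L[ℂ] F, CoreGraph b 𝓛 x y ↔
      ∃ z ∈ finiteBlocks b, x = op z ∧ y = op (𝓖 z))
    {P : ℝ≥0 → (F →L[ℂ] F) → (F →L[ℂ] F)} (hP : IsSemigroupOf b 𝓛 P) (t : ℝ≥0)
    (z : TraceClass b) : P t (op z) = op (h.limit t z) := by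
  have hgen : ∀ x y, IsGenerator (restrict hP.1) x y ↔ IsGenerator h.limit x y := fun x y => by
    rw [← generatorGraph_iff (P := P) (T := restrict hP.1) (fun _ _ => rfl), hP.2,
      closureGraph_iff h hc, h.isGenerator_iff]
  rw [← op_restrict hP.1]
  congr 1
  refine (isSemigroup_restrict hP.1).eq_of_isGenerator h.isSemigroup h.norm_limit_le
    (fun x y => (hgen x y).1) (h.dense.mono fun x hx => ?_) t z
  exact ⟨𝓖 x, (hgen _ _).2 (h.isGenerator hx)⟩

end Correspondence

/-! ### Matrix coefficients of polynomials in a and a† -/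

section Ladder

/-- The operators given by words in the annihilation and creation operators. -/
def wordOp : FreeMonoid (Fin 2) →* FOp := FreeMonoid.lift ![annihilation, creation]

theorem ladder_eq_sum (p : NCPoly) :
    ladder p = ∑ w ∈ (wordCoeff p).support, wordCoeff p w • wordOp w := by
  have h : FreeAlgebra.lift ℂ ![annihilation, creation] =
      (MonoidAlgebra.lift ℂ FOp (FreeMonoid (Fin 2)) wordOp).comp
        (FreeAlgebra.equivMonoidAlgebraFreeMonoid (R := ℂ) (X := Fin 2)).toAlgHom := by
    refine FreeAlgebra.hom_ext (funext fun i => ?_)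
    simp [FreeAlgebra.equivMonoidAlgebraFreeMonoid, wordOp]
  rw [ladder, h]
  simp only [AlgHom.comp_apply]
  rw [MonoidAlgebra.lift_apply]
  rfl

/-- Each letter moves the index by at most one and multiplies the coefficient by the square root of
a number at most k plus the length of the word. -/
theorem wordOp_single (w : FreeMonoid (Fin 2)) (k : ℕ) :
    ∃ (n : ℕ) (c : ℂ), wordOp w (Finsupp.single k 1) = Finsupp.single n c ∧ n ≤ k + w.length ∧
      k ≤ n + w.length ∧ ‖c‖ ^ 2 ≤ ((k : ℝ) + w.length) ^ w.length := by
  induction w using FreeMonoid.recOn with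
  | one => exact ⟨k, 1, by simp, by simp, by simp, by simp⟩
  | of_mul x w ih =>
    obtain ⟨n, c, h1, h2, h3, h4⟩ := ih
    rw [map_mul, Module.End.mul_apply, h1, FreeMonoid.length_mul, FreeMonoid.length_of, wordOp,
      FreeMonoid.lift_eval_of]
    have h5 : (n : ℝ) ≤ k + w.length := by exact_mod_cast h2
    have key : ∀ s : ℝ, 0 ≤ s → s ≤ (k : ℝ) + (1 + w.length : ℕ) →
        ‖c * ((√s : ℝ) : ℂ)‖ ^ 2 ≤ ((k : ℝ) + (1 + w.length : ℕ)) ^ (1 + w.length) := by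
      intro s hs hs2
      rw [norm_mul, mul_pow, Complex.norm_real, Real.norm_of_nonneg (Real.sqrt_nonneg _),
        Real.sq_sqrt hs, add_comm 1 w.length, pow_succ _ w.length]
      rw [add_comm 1 w.length] at hs2
      have h6 : (k : ℝ) + w.length ≤ (k : ℝ) + (w.length + 1 : ℕ) := by push_cast; linarith
      exact mul_le_mul (h4.trans (pow_le_pow_left₀ (by positivity) h6 _)) hs2 hs (by positivity)
    fin_cases x
    -- For n = 0 the truncated index stays 0 and the coefficient becomes 0, so the bounds persist.
    · refine ⟨n - 1, c * ((√(n : ℝ) : ℝ) : ℂ), ?_, by omega, by omega,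
        key n (Nat.cast_nonneg n) ?_⟩
      · simp [annihilation, Finsupp.linearCombination_single]
      · push_cast; linarith
    · refine ⟨n + 1, c * ((√((n : ℝ) + 1) : ℝ) : ℂ), ?_, by omega, by omega,
        key ((n : ℝ) + 1) (by positivity) ?_⟩
      · simp [creation, Finsupp.linearCombination_single]
      · push_cast; linarith

theorem ent_wordOp_of_far {w : FreeMonoid (Fin 2)} {n k : ℕ}
    (h : n + w.length < k ∨ k + w.length < n) : ent (wordOp w) n k = 0 := by
  obtain ⟨m, c, h1, h2, h3, -⟩ := wordOp_single w k
  rw [ent, h1, Finsupp.single_apply, if_neg (by omega)]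

theorem norm_ent_wordOp_sq_le {w : FreeMonoid (Fin 2)} {d : ℕ} (hw : w.length ≤ d) (n k : ℕ) :
    ‖ent (wordOp w) n k‖ ^ 2 ≤ ((2 * (d : ℝ) + 1) * ((n : ℝ) + 1)) ^ d := by
  obtain ⟨m, c, h1, h2, h3, h4⟩ := wordOp_single w k
  rw [ent, h1, Finsupp.single_apply]
  split_ifs with h
  · subst h
    have h5 : (w.length : ℝ) ≤ d := by exact_mod_cast hw
    have h6 : (k : ℝ) ≤ m + w.length := by exact_mod_cast h3
    have h7 : (0 : ℝ) ≤ (d : ℝ) * m := by positivity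
    have h8 : (k : ℝ) + w.length ≤ (2 * (d : ℝ) + 1) * ((m : ℝ) + 1) := by nlinarith
    have h9 : (1 : ℝ) ≤ (2 * (d : ℝ) + 1) * ((m : ℝ) + 1) := by
      nlinarith [Nat.cast_nonneg (α := ℝ) d, Nat.cast_nonneg (α := ℝ) m]
    exact h4.trans ((pow_le_pow_left₀ (by positivity) h8 _).trans (pow_le_pow_right₀ h9 hw))
  · rw [norm_zero, zero_pow two_ne_zero]; positivity

/-- The number of words of length at most `d` in two letters, with the growth of their matrix
coefficients. -/
def wordConst (d : ℕ) : ℝ :=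
  ({w : FreeMonoid (Fin 2) | w.length ≤ d}.ncard : ℝ) * (2 * (d : ℝ) + 1) ^ d

theorem finite_words (d : ℕ) : {w : FreeMonoid (Fin 2) | w.length ≤ d}.Finite :=
  List.finite_length_le (Fin 2) d

theorem wordConst_pos (d : ℕ) : 0 < wordConst d := by
  have h : 0 < {w : FreeMonoid (Fin 2) | w.length ≤ d}.ncard :=
    (Set.ncard_pos (finite_words d)).2 ⟨1, Nat.zero_le d⟩
  unfold wordConst
  positivity

theorem isPerturbation_ladder {F : Type*} [NormedAddCommGroup F] [InnerProductSpace ℂ F]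
    {b : HilbertBasis ℕ ℂ F} {p : NCPoly} (hp : IsSymm b (ladder p)) {D : ℕ}
    (hD : ncDegree p ≤ D) {Λ : ℝ} (hΛ : maxCoeff p ≤ Λ) :
    IsPerturbation D (ncDegree p) (wordConst (ncDegree p) * Λ) (ent (ladder p)) := by
  set d := ncDegree p with hd
  have hlen : ∀ w ∈ (wordCoeff p).support, w.length ≤ d := fun w hw =>
    Finset.le_sup (f := FreeMonoid.length) hw
  have hent : ∀ n k, ent (ladder p) n k =
      ∑ w ∈ (wordCoeff p).support, wordCoeff p w * ent (wordOp w) n k := fun n k => by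
    rw [ladder_eq_sum, ent, LinearMap.sum_apply, Finsupp.finsetSum_apply]
    rfl
  have hΛ0 : 0 ≤ Λ := (NNReal.coe_nonneg _).trans hΛ
  refine ⟨conj_ent_of_isSymm hp, fun n k h => ?_, fun n k => ?_⟩
  · rw [hent]
    refine Finset.sum_eq_zero fun w hw => ?_
    have := hlen w hw
    rw [ent_wordOp_of_far (by omega), mul_zero]
  · set a : ℝ := ((2 * (d : ℝ) + 1) * ((n : ℝ) + 1)) ^ d with ha
    have ha0 : 0 ≤ a := by positivity
    have h1 : ‖ent (ladder p) n k‖ ≤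
        ({w : FreeMonoid (Fin 2) | w.length ≤ d}.ncard : ℝ) * (Λ * √a) := by
      rw [hent]
      refine (norm_sum_le _ _).trans ((Finset.sum_le_card_nsmul _ _ (Λ * √a) fun w hw => ?_).trans ?_)
      · rw [norm_mul]
        refine mul_le_mul ?_ ?_ (norm_nonneg _) hΛ0
        · refine le_trans ?_ hΛ
          exact_mod_cast Finset.le_sup (f := fun w => ‖wordCoeff p w‖₊) hw
        · exact Real.le_sqrt_of_sq_le (norm_ent_wordOp_sq_le (hlen w hw) n k)
      · rw [nsmul_eq_mul]
        refine mul_le_mul_of_nonneg_right ?_ (by positivity)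
        rw [← Set.ncard_coe_finset]
        exact_mod_cast Set.ncard_le_ncard (fun w hw => hlen w hw) (finite_words d)
    refine (pow_le_pow_left₀ (norm_nonneg _) h1 2).trans ?_
    rw [mul_pow, mul_pow, Real.sq_sqrt ha0, ha, mul_pow (2 * (d : ℝ) + 1)]
    unfold wordConst
    have h2 : (1 : ℝ) ≤ (2 * (d : ℝ) + 1) ^ d :=
      one_le_pow₀ (by linarith [Nat.cast_nonneg (α := ℝ) d])
    -- Only the first power of (2d+1)^d is needed; it is enlarged to fit the square of `wordConst`.
    have h3 : (2 * (d : ℝ) + 1) ^ d ≤ ((2 * (d : ℝ) + 1) ^ d) ^ 2 := le_self_pow₀ h2 two_ne_zero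
    calc _ = ({w : FreeMonoid (Fin 2) | w.length ≤ d}.ncard : ℝ) ^ 2 * Λ ^ 2 * ((n : ℝ) + 1) ^ d *
          (2 * (d : ℝ) + 1) ^ d := by ring
      _ ≤ ({w : FreeMonoid (Fin 2) | w.length ≤ d}.ncard : ℝ) ^ 2 * Λ ^ 2 * ((n : ℝ) + 1) ^ d *
          ((2 * (d : ℝ) + 1) ^ d) ^ 2 := mul_le_mul_of_nonneg_left h3 (by positivity)
      _ = _ := by ring

end Ladder

/-! ### Moments and the Sobolev norm -/

section Sobolev

variable {F : Type*} [NormedAddCommGroup F] [InnerProductSpace ℂ F]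
  {b : HilbertBasis ℕ ℂ F}

theorem isWeighted_unique {k : ℝ} {x y y' : F →L[ℂ] F} (h : IsWeighted b k x y)
    (h' : IsWeighted b k x y') : y = y' :=
  op_ext (b := b) fun n k => by rw [h, h']

variable [CompleteSpace F]

open TraceClass

theorem inner_op_eq_diag (x : TraceClass b) (n : ℕ) : ⟪b n, op x (b n)⟫_ℂ = (diag x n : ℂ) := by
  have h1 : (starRingEnd ℂ) ⟪b n, op x (b n)⟫_ℂ = ⟪b n, op x (b n)⟫_ℂ := by
    rw [inner_conj_symm]
    conv_lhs => rw [← x.isTraceSA.1.star_eq, ContinuousLinearMap.star_eq_adjoint,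
      ContinuousLinearMap.adjoint_inner_left]
  exact (Complex.conj_eq_iff_re.1 h1).symm

theorem trace_op (x : TraceClass b) : trace b (op x) = (tr x : ℂ) := by
  rw [trace]
  simp only [inner_op_eq_diag]
  exact (x.hasSum_tr.mapL Complex.ofRealCLM).tsum_eq

theorem tr_eq_one_of_isState {x : TraceClass b} (hx : IsState b (op x)) : tr x = 1 := by
  have h := hx.2.mapL Complex.reCLM
  simp only [inner_op_eq_diag] at h
  exact x.hasSum_tr.unique h

theorem sobolevNorm_eq {k : ℝ} {x y : F →L[ℂ] F} (h : IsWeighted b k x y) :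
    sobolevNorm b k x = traceNorm b y := by
  refine le_antisymm (iInf₂_le y h) (le_iInf₂ fun y' h' => ?_)
  rw [isWeighted_unique h h']

/-- The diagonal of the weighted operator y is the diagonal of x times (n+1)^(k/2), and the absolute
diagonal sums of y are at most its trace norm. -/
theorem moment_le_sobolevNorm {k : ℝ} {m : ℕ} (hk : k = 2 * m) {x : TraceClass b}
    (hx : MemSobolev b k (op x)) (M : ℕ) :
    moment b m M (conj (proj b M) x) ≤ (sobolevNorm b k (op x)).toReal := by
  obtain ⟨-, y, hy, hxy⟩ := hx
  rw [sobolevNorm_eq hxy]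
  change _ ≤ ‖mk y hy‖
  rw [moment_apply, conj_conj, diagOp_mul_proj le_rfl, ← moment_apply, moment_eq_sum]
  refine le_trans (Finset.sum_le_sum fun n _ => ?_) (sum_abs_diag_le (mk y hy) (Finset.range M))
  refine le_trans (le_of_eq ?_) (le_abs_self _)
  have h0 : (0 : ℝ) < (n : ℝ) + 1 := by positivity
  have h1 : ((n : ℝ) + 1) ^ (k / 4) * ((n : ℝ) + 1) ^ (k / 4) = pw m n := by
    rw [← Real.rpow_add h0, pw, ← Real.rpow_natCast]
    congr 1
    rw [hk]; ring
  have h2 := hxy n n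
  rw [h1, inner_op_eq_diag, ← op_mk y hy, inner_op_eq_diag, ← Complex.ofReal_mul] at h2
  exact (Complex.ofReal_injective h2).symm

end Sobolev

/-! ### Constants and the final estimate -/

section Main

/-- The constant in front of the bound. -/
def growthConst (r : ℕ) : ℝ :=
  ∑ d ∈ Finset.range (2 * r + 1), 2 * (wordConst d * (perturbConst (2 * r) (r + 1) d + 1))

/-- The constant in the uniform bound of the moments. -/
def energyConst (r : ℕ) : ℝ :=
  ∑ d ∈ Finset.range (2 * r + 1), momentConst r (2 * r) (r + 1 + d + 1) *
    (((r : ℝ) + 1) ^ r + wordConst d) ^ (r + 1 + d + 1 + r + 1)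

theorem growth_term_pos (r d : ℕ) :
    0 < 2 * (wordConst d * (perturbConst (2 * r) (r + 1) d + 1)) := by
  have := wordConst_pos d
  have := perturbConst_nonneg (2 * r) (r + 1) d
  positivity

theorem energy_term_pos (r d : ℕ) : 0 < momentConst r (2 * r) (r + 1 + d + 1) *
    (((r : ℝ) + 1) ^ r + wordConst d) ^ (r + 1 + d + 1 + r + 1) := by
  have := wordConst_pos d
  have := momentConst_pos r (2 * r) (r + 1 + d + 1)
  positivity

theorem growthConst_pos (r : ℕ) : 0 < growthConst r :=
  Finset.sum_pos (fun d _ => growth_term_pos r d) ⟨0, by simp⟩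

theorem energyConst_pos (r : ℕ) : 0 < energyConst r :=
  Finset.sum_pos (fun d _ => energy_term_pos r d) ⟨0, by simp⟩

/-- Summing positive terms over all admissible degrees makes the constant depend on l alone. -/
theorem le_growthConst {r d : ℕ} (hd : d ≤ 2 * r) :
    2 * (wordConst d * (perturbConst (2 * r) (r + 1) d + 1)) ≤ growthConst r :=
  Finset.single_le_sum (f := fun d => 2 * (wordConst d * (perturbConst (2 * r) (r + 1) d + 1)))
    (fun d _ => (growth_term_pos r d).le) (Finset.mem_range.2 (by omega))

theorem le_energyConst {r d : ℕ} (hd : d ≤ 2 * r) {a e : ℝ} (ha : 0 ≤ a) (he : 0 ≤ e) :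
    momentConst r (2 * r) (r + 1 + d + 1) *
        (1 + (((r : ℝ) + 1) ^ r * a + wordConst d * e)) ^ (r + 1 + d + 1 + r + 1) ≤
      energyConst r * (1 + a + e) ^ (r + 1 + d + 1 + r + 1) := by
  have hw := wordConst_pos d
  have hm := momentConst_pos r (2 * r) (r + 1 + d + 1)
  have h1 : (1 : ℝ) ≤ ((r : ℝ) + 1) ^ r :=
    one_le_pow₀ (by linarith [Nat.cast_nonneg (α := ℝ) r])
  have h2 : 1 + (((r : ℝ) + 1) ^ r * a + wordConst d * e) ≤
      (((r : ℝ) + 1) ^ r + wordConst d) * (1 + a + e) := by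
    nlinarith [mul_nonneg hw.le ha, mul_nonneg (zero_le_one.trans h1) he]
  calc _ ≤ momentConst r (2 * r) (r + 1 + d + 1) *
        ((((r : ℝ) + 1) ^ r + wordConst d) * (1 + a + e)) ^ (r + 1 + d + 1 + r + 1) := by
        gcongr
    _ = (momentConst r (2 * r) (r + 1 + d + 1) *
          (((r : ℝ) + 1) ^ r + wordConst d) ^ (r + 1 + d + 1 + r + 1)) *
          (1 + a + e) ^ (r + 1 + d + 1 + r + 1) := by rw [mul_pow, mul_assoc]
    _ ≤ _ := by
        refine mul_le_mul_of_nonneg_right ?_ (by positivity)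
        exact Finset.single_le_sum (f := fun d => momentConst r (2 * r) (r + 1 + d + 1) *
          (((r : ℝ) + 1) ^ r + wordConst d) ^ (r + 1 + d + 1 + r + 1))
          (fun d _ => (energy_term_pos r d).le) (Finset.mem_range.2 (by omega))

variable {F : Type*} [NormedAddCommGroup F] [InnerProductSpace ℂ F] [CompleteSpace F]
  {b : HilbertBasis ℕ ℂ F}

open TraceClass

theorem exists_tendsto_jump_flow {r D : ℕ} (hr : 1 ≤ r) (β : ℂ) {Γ : ℝ} {G : ℕ → ℕ → ℂ}
    (hG : IsCoupling D r Γ G) {x : TraceClass b} (hx : 0 ≤ op x) {R : ℝ}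
    (hR : ∀ M, moment b (r + 2) M (conj (proj b M) x) ≤ R) (t : ℝ≥0) :
    ∃ B, Tendsto (fun M => conj (jumpOp b (r + 1) β M)
      (flow (gen b (r + 1) G M) t (conj (proj b M) x))) atTop (𝓝 B) := by
  have hb : ∀ M, conj (proj b M) (conj (proj b M) x) = conj (proj b M) x := fun M => by
    rw [conj_conj, proj_mul_proj b le_rfl]
  have hx' := fun M => op_conj_nonneg (proj b M) hx
  have hΓ := hG.nonneg
  have hm := (momentConst_pos r D (r + 1)).le
  refine exists_tendsto_jump (r + 1) β
    ((approximates_gen hr hG).tendsto_flow_of_tendsto t (tendsto_conj_proj x))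
    (fun M => flow_gen_nonneg _ _ _ t.2 (hx' M)) (fun M => flow_gen_block _ _ (hb M) _)
    (R := max R (momentConst r D (r + 1) * (1 + Γ) ^ (r + 1 + r + 1) * tr x)) fun M => ?_
  refine (moment_flow_le (m := r + 1) hr hG M (hx' M) t.2).trans (max_le_max (hR M) ?_)
  exact mul_le_mul_of_nonneg_left (tr_conj_proj_le hx M) (by positivity)

theorem hamMatrix_zero (l : ℕ) (α : ℂ) (H : FOp) : hamMatrix l α 0 H = drive l (α ^ l) := by
  ext n k
  rw [hamMatrix, Complex.ofReal_zero, zero_mul, add_zero]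

end Main

end Boson

open Boson TraceClass in
theorem theorem5p2 (l : ℕ) (hl : 2 ≤ l) :
    ∃ C K : ℝ, 0 < C ∧ 0 < K ∧
      ∀ (F : Type*) [NormedAddCommGroup F] [InnerProductSpace ℂ F] [CompleteSpace F]
        (b : HilbertBasis ℕ ℂ F) (α : ℂ) (p : Boson.NCPoly),
        Boson.IsSymm b (Boson.ladder p) →
        Boson.ncDegree p ≤ 2 * (l - 1) →
      ∀ ε : ℝ, 0 ≤ ε →
        (∃ P, Boson.IsSemigroupOf b (Boson.photon l α) P) ∧
        (∃ Q, Boson.IsSemigroupOf b (Boson.perturbedPhoton l α ε (Boson.ladder p)) Q) ∧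
        ∀ P Q : ℝ≥0 → (F →L[ℂ] F) → (F →L[ℂ] F),
          Boson.IsSemigroupOf b (Boson.photon l α) P →
          Boson.IsSemigroupOf b (Boson.perturbedPhoton l α ε (Boson.ladder p)) Q →
          ∀ (t : ℝ≥0) (ρ : F →L[ℂ] F), Boson.IsState b ρ →
            Boson.MemSobolev b (2 * ((l : ℝ) + Boson.ncDegree p + 2)) ρ →
            ∃ B : F →L[ℂ] F, Boson.IsTraceSA b B ∧ Boson.IsJumpConj b l α (P t ρ - Q t ρ) B ∧
              ‖Boson.trace b B‖ ≤
                ε * (C * Boson.maxCoeff p * (1 + ‖α‖ ^ (2 * l))) *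
                  (1 - Real.exp (-((l.factorial : ℝ) * t))) *
                  max (K * (1 + ‖α‖ ^ l + ε * Boson.maxCoeff p) ^ (2 * l + Boson.ncDegree p + 1))
                    (Boson.sobolevNorm b (2 * ((l : ℝ) + Boson.ncDegree p + 2)) ρ).toReal := by
  -- From here on r = l - 1 is the order of the coupling; l ≥ 2 becomes r ≥ 1.
  obtain ⟨r, rfl⟩ := Nat.exists_eq_add_of_le' (show 1 ≤ l by omega)
  have hr : 1 ≤ r := by omega
  refine ⟨growthConst r, energyConst r, growthConst_pos r, energyConst_pos r, ?_⟩
  intro F _ _ _ b α p hp hd ε hε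
  rw [Nat.add_sub_cancel] at hd
  set d := ncDegree p with hdd
  have hw := wordConst_pos d
  have hG₀ := isCoupling_drive hr (α ^ (r + 1))
  have hG : ∀ {Λ : ℝ}, maxCoeff p ≤ Λ → IsCoupling (2 * r) r
      (((r : ℝ) + 1) ^ r * ‖α ^ (r + 1)‖ + ε * (wordConst d * Λ))
      (hamMatrix (r + 1) α ε (ladder p)) := fun {Λ} hΛ =>
    isCoupling_drive_add hr hd _
      (mul_nonneg hw.le ((NNReal.coe_nonneg _).trans hΛ)) (isPerturbation_ladder hp hd hΛ) hε
  have hA₀ := approximates_gen (b := b) hr hG₀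
  have hA := approximates_gen (b := b) hr (hG le_rfl)
  have hherm := conj_ent_of_isSymm hp
  have hc₀ : ∀ x y : F →L[ℂ] F, CoreGraph b (photon (r + 1) α) x y ↔
      ∃ z ∈ finiteBlocks b, x = op z ∧
        y = op (coreGen b (r + 1) (2 * r) (drive (r + 1) (α ^ (r + 1))) z) := by
    intro x y
    rw [photon_eq _ _ (ladder p), ← hamMatrix_zero (r + 1) α (ladder p)]
    refine coreGraph_iff hherm ?_
    rw [hamMatrix_zero]
    exact hG₀.band
  have hc : ∀ x y : F →L[ℂ] F, CoreGraph b (perturbedPhoton (r + 1) α ε (ladder p)) x y ↔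
      ∃ z ∈ finiteBlocks b, x = op z ∧
        y = op (coreGen b (r + 1) (2 * r) (hamMatrix (r + 1) α ε (ladder p)) z) :=
    fun x y => coreGraph_iff hherm (hG le_rfl).band
  refine ⟨exists_isSemigroupOf hA₀ hc₀, exists_isSemigroupOf hA hc, ?_⟩
  intro P Q hP hQ t ρ hρ hmem
  obtain ⟨z, rfl⟩ : ∃ z : TraceClass b, ρ = op z := ⟨mk ρ hmem.1, rfl⟩
  have hz : 0 ≤ op z := (ContinuousLinearMap.nonneg_iff_isPositive _).2 hρ.1
  have hz1 := tr_eq_one_of_isState hρ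
  set w := (sobolevNorm b (2 * (((r + 1 : ℕ) : ℝ) + d + 2)) (op z)).toReal with hwdef
  have hmom : ∀ M, moment b (r + 1 + d + 2) M (conj (proj b M) z) ≤ w :=
    moment_le_sobolevNorm (by push_cast; ring) hmem
  have hmom' : ∀ M, moment b (r + 2) M (conj (proj b M) z) ≤ w := fun M =>
    (moment_mono (by omega) M (op_conj_nonneg _ hz)).trans (hmom M)
  obtain ⟨B₁, hB₁⟩ := exists_tendsto_jump_flow hr (α ^ (r + 1)) hG₀ hz hmom' t
  obtain ⟨B₂, hB₂⟩ := exists_tendsto_jump_flow hr (α ^ (r + 1)) (hG le_rfl) hz hmom' t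
  refine ⟨op (B₁ - B₂), isTraceSA _, ?_, ?_⟩
  · rw [isSemigroupOf_apply hA₀ hc₀ hP, isSemigroupOf_apply hA hc hQ, ← map_sub]
    refine isJumpConj_of_tendsto (r + 1) α
      ((hA₀.tendsto_flow_of_tendsto t (tendsto_conj_proj z)).sub
        (hA.tendsto_flow_of_tendsto t (tendsto_conj_proj z))) ?_
    simp only [map_sub]
    exact hB₁.sub hB₂
  · rw [trace_op, Complex.norm_real, Real.norm_eq_abs]
    have hexp : 0 ≤ 1 - Real.exp (-(((r + 1).factorial : ℝ) * t)) := by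
      rw [sub_nonneg, Real.exp_le_one_iff]
      exact neg_nonpos.2 (by positivity)
    -- The dominating element divides by B = `wordConst d * Λ`, which must be positive, while the
    -- largest coefficient may be 0. So the bound is proved for every larger Λ.
    have key : ∀ Λ : ℝ, (maxCoeff p : ℝ) < Λ → |tr (B₁ - B₂)| ≤
        ε * (growthConst r * Λ * (1 + ‖α‖ ^ (2 * (r + 1)))) *
          (1 - Real.exp (-(((r + 1).factorial : ℝ) * t))) *
          max (energyConst r * (1 + ‖α‖ ^ (r + 1) + ε * Λ) ^ (2 * (r + 1) + d + 1)) w := by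
      intro Λ hΛ
      have hΛ0 : 0 < Λ := (NNReal.coe_nonneg _).trans_lt hΛ
      set R := max (energyConst r * (1 + ‖α‖ ^ (r + 1) + ε * Λ) ^ (2 * (r + 1) + d + 1)) w
      have hR0 : 0 ≤ R := le_max_of_le_right ENNReal.toReal_nonneg
      have h1 := abs_tr_le_of_tendsto hr (α ^ (r + 1)) (mul_pos hw hΛ0) hε hG₀ (hG hΛ.le)
        (isPerturbation_ladder hp hd hΛ.le) hz hz1.le (R := R)
        (fun M => (hmom M).trans (le_max_right _ _)) ?_ t.2 (hB₁.sub hB₂)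
      · refine h1.trans ?_
        have h2 : ‖α ^ (r + 1)‖ ^ 2 = ‖α‖ ^ (2 * (r + 1)) := by
          rw [norm_pow, ← pow_mul, mul_comm]
        rw [h2]
        have h3 := mul_le_mul_of_nonneg_right (le_growthConst hd)
          (show 0 ≤ ε * (Λ * (1 + ‖α‖ ^ (2 * (r + 1)))) *
            (1 - Real.exp (-(((r + 1).factorial : ℝ) * t))) * R by positivity)
        refine le_trans (le_of_eq ?_) (h3.trans (le_of_eq ?_))
        · change ε * (2 * (1 + ‖α‖ ^ (2 * (r + 1))) * (wordConst d * Λ *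
            (perturbConst (2 * r) (r + 1) d + 1)) * R *
            (1 - Real.exp (-(((r + 1).factorial : ℝ) * t)))) = _
          ring
        · ring
      · refine le_trans ?_ (le_max_left _ _)
        have h4 := le_energyConst hd (norm_nonneg (α ^ (r + 1))) (mul_nonneg hε hΛ0.le)
        -- The exponent m + r + 1 of the moment bound with m = r + 1 + d + 1 is the exponent of γ.
        have e1 : 2 * (r + 1) + d + 1 = r + 1 + d + 1 + r + 1 := by ring
        have e2 : ε * (wordConst d * Λ) = wordConst d * (ε * Λ) := by ring
        rw [e1, ← norm_pow, e2]
        exact h4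
    -- The left side does not involve Λ and the right side is continuous in it, so Λ may decrease to
    -- the largest coefficient.
    have hcont : Continuous fun Λ : ℝ =>
        ε * (growthConst r * Λ * (1 + ‖α‖ ^ (2 * (r + 1)))) *
          (1 - Real.exp (-(((r + 1).factorial : ℝ) * t))) *
          max (energyConst r * (1 + ‖α‖ ^ (r + 1) + ε * Λ) ^ (2 * (r + 1) + d + 1)) w := by
      fun_prop
    exact ge_of_tendsto ((hcont.tendsto (maxCoeff p : ℝ)).mono_left nhdsWithin_le_nhds)
      (eventually_of_mem (self_mem_nhdsWithin (s := Set.Ioi (maxCoeff p : ℝ))) key)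

end
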